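/- Let $(P,\eta,\Lambda)$ be a Delzant labelled polytope: $P=\{L_1>0,\dots,L_d>0\}$ is a nonempty bounded open convex polytope in $\mathfrak t^*\cong\mathbb R^n$ with facets $F_1,\dots,F_d$, which is simple, $L_k$ is affine-linear with $dL_k=\eta_k\in\mathfrak t$ the chosen inward normal of $F_k$, and $\Lambda\subset\mathfrak t$ is a lattice such that at each vertex $p$ of $\overline P$ the normals $\eta_k$ of the facets through $p$ form a $\mathbb Z$-basis of $\Lambda$. Let $T=\mathfrak t/2\pi\Lambda$, and let $(M,\omega,T)$ with moment map $x:M\to\mathfrak t^*$ be the associated compact symplectic toric manifold: $M=(\overline P\times T)/\!\sim$, where over the relative interior of a face $F$ one divides by the subtorus generated by the $\eta_k$ with $F\subset F_k$, with the smooth structure and the symplectic form for which, at each vertex $p$ with normals $\eta_{k_1},\dots,\eta_{k_n}$ and dual basis $\eta_{k_i}^*$, the map $z\mapsto\big[p+\tfrac12\sum_i|z_i|^2\eta_{k_i}^*,\ \sum_i\arg(z_i)\,\eta_{k_i}\big]$ is a symplectic parametrization by an open subset of $\mathbb C^n$ with its standard symplectic form. Let $\nu=\{\nu_1,\dots,\nu_d\}$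 be any other set of inward normals to the facets of $P$, with defining functions $L_k^\nu$ ($dL_k^\nu=\nu_k$, $L_k^\nu=0$ on $F_k$). Let $u\in\mathcal S(P,\nu)$ be a symplectic potential: $u$ is continuous on $\overline P$; its restriction to $P$, and to the relative interior of each face of positive dimension, is smooth with positive definite Hessian; and $u-\tfrac12\sum_kL_k^\nu\log L_k^\nu$ is the restriction to $\overline P$ of a smooth function on an open neighbourhood of $\overline P$. Then: 1. The set $\mathring M$ of points of $M$ with trivial stabilizer in $T$ equals $x^{-1}(P)$ and is open and dense. On $\mathring M$, with action-angle coordinates $(x,\theta)$ from $\mathring M=P\times T$, one has $\omega=\sum_i dx_i\wedge d\theta_i$, and $$g_u=\sum_{i,j}G_{ij}\,dx_i\otimes dx_j+H_{ij}\,d\theta_i\otimes d\theta_j,\qquad G=\mathrm{Hess}\,u,\quad H=G^{-1},$$ is a smooth $T$-invariant Kähler metric compatible with $\omega$. 2. For each $k$ there is a unique real number $a_k$ with $a_k\nu_k=\eta_k$, and $a_k>0$. Let $D_k=x^{-1}(\mathring F_k)$ be the preimage of the relative interior of $F_k$. Say that $g_u$ has angle $\beta$ along $D_k$ if near each point of $D_k$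 there are a smooth submersion $w=re^{\sqrt{-1}\varphi}$ to $\mathbb C$ with $D_k=\{w=0\}$, a constant $c>0$ and a smooth symmetric 2-tensor $B$ such that off $D_k$ $$g_u=c\Big(dr\otimes dr+\big(\tfrac{\beta}{2\pi}\big)^2r^2\,d\varphi\otimes d\varphi\Big)+B,$$ and such that at the points of $D_k$ the tensor $B$ is positive definite on $TD_k$ with radical complementary to $TD_k$. Then: - if $a_k<1$, $g_u$ has a singularity of conical type along $D_k$, with angle $2\pi a_k<2\pi$; - if $a_k=1$, $g_u$ extends to a smooth Riemannian metric on $\mathring M\cup D_k$; - if $a_k>1$, $g_u$ has a singularity of large angle along $D_k$, with angle $2\pi a_k>2\pi$. If $a_k\ne1$, then $g_u$ does not extend to a smooth tensor on a neighbourhood of any point of $D_k$. The behaviour along $D_k$ depends only on $a_k$: if $\nu'$ is another set of inward normals with $a_k\nu'_k=\eta_k$ and $u'\in\mathcal S(P,\nu')$, then $g_u-g_{u'}$ extends to a smooth tensor on $\mathring M\cup D_k$. -/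

import Mathlib

open scoped Matrix Manifold ContDiff

noncomputable section

namespace Toric

/-- A labelled polytope in `𝔱* = ℝⁿ` with `d` facets: the normals `ν₁, …, ν_d` in `𝔱 = ℝⁿ` and the
constant terms of the defining functions `L_k(x) = ⟨x, ν_k⟩ + c_k`. The open polytope
`{L_k > 0 for all k}` is nonempty, its closure is compact, each `{L_k = 0}` cuts out a facet with
nonempty relative interior (so that no two facets coincide), and the polytope is simple. -/
structure LabelledPolytope (n d : ℕ) where
  normal : Fin d → Fin n → ℝ
  const : Fin d → ℝ
  nonempty' : ∃ x : Fin n → ℝ, ∀ k, 0 < x ⬝ᵥ normal k + const k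
  bounded' : Bornology.IsBounded {x : Fin n → ℝ | ∀ k, 0 ≤ x ⬝ᵥ normal k + const k}
  facet' : ∀ k, ∃ x : Fin n → ℝ,
    x ⬝ᵥ normal k + const k = 0 ∧ ∀ j, j ≠ k → 0 < x ⬝ᵥ normal j + const j
  simple' : ∀ x : Fin n → ℝ, (∀ k, 0 ≤ x ⬝ᵥ normal k + const k) →
    LinearIndependent ℝ (fun k : {k : Fin d // x ⬝ᵥ normal k + const k = 0} => normal k)

namespace LabelledPolytope

variable {n d : ℕ} (P : LabelledPolytope n d)

/-- The defining function `L_k`. -/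
def L (k : Fin d) (x : Fin n → ℝ) : ℝ := x ⬝ᵥ P.normal k + P.const k

/-- The open polytope `P`. -/
def openSet : Set (Fin n → ℝ) := {x | ∀ k, 0 < P.L k x}

/-- The compact polytope `P̄`. -/
def closedSet : Set (Fin n → ℝ) := {x | ∀ k, 0 ≤ P.L k x}

/-- The closed facet `F_k`. -/
def facet (k : Fin d) : Set (Fin n → ℝ) := {x | x ∈ P.closedSet ∧ P.L k x = 0}

/-- The relative interior of the facet `F_k`. -/
def facetInterior (k : Fin d) : Set (Fin n → ℝ) := {x | P.L k x = 0 ∧ ∀ j, j ≠ k → 0 < P.L j x}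

/-- The indices of the facets that contain `x`; for `x` in the relative interior of a face `F`
this is the set `I_F`. -/
def active (x : Fin n → ℝ) : Finset (Fin d) := {k | P.L k x = 0}

/-- The relative interior of the face `⋂_{k ∈ I} F_k`. -/
def faceInterior (I : Finset (Fin d)) : Set (Fin n → ℝ) :=
  {x | x ∈ P.closedSet ∧ P.active x = I}

/-- The vertices of `P̄`: the points that lie on `n` facets. -/
def IsVertex (p : Fin n → ℝ) : Prop := p ∈ P.closedSet ∧ (P.active p).card = n

/-- `(P, η, Λ)` is Delzant: the normals lie in `Λ`, and at each vertex the normals of the facets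
through it generate `Λ` (as they are linearly independent, they form a `ℤ`-basis of `Λ`, and `Λ` is
a lattice). -/
structure IsDelzant (Λ : Submodule ℤ (Fin n → ℝ)) : Prop where
  rational : ∀ k, P.normal k ∈ Λ
  unimodular : ∀ p, P.IsVertex p → Submodule.span ℤ (P.normal '' {k | k ∈ P.active p}) = Λ

/-- Two labelled polytopes with the same underlying polytope and the same numbering of its facets:
they differ only in the choice of the inward normals. -/
structure SamePolytope (P Q : LabelledPolytope n d) : Prop where
  openSet_eq : Q.openSet = P.openSet
  facet_eq : ∀ k, Q.facet k = P.facet k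

/-- The Guillemin potential `½ ∑ L_k log L_k`. -/
def guillemin (x : Fin n → ℝ) : ℝ := 1 / 2 * ∑ k, P.L k x * Real.log (P.L k x)

/-- The set `𝒮(P, ν)` of symplectic potentials. Only the values on `P̄` matter. Strict convexity of
the restriction to the interior of a face means that its Hessian, on the tangent space of the face,
is positive definite. -/
structure IsSymplecticPotential (u : (Fin n → ℝ) → ℝ) : Prop where
  continuousOn : ContinuousOn u P.closedSet
  smooth_face : ∀ I : Finset (Fin d), ContDiffOn ℝ ∞ u (P.faceInterior I)
  convex_face : ∀ (I : Finset (Fin d)), ∀ x ∈ P.faceInterior I, ∀ v : Fin n → ℝ, v ≠ 0 →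
    (∀ k ∈ I, v ⬝ᵥ P.normal k = 0) → 0 < iteratedDeriv 2 (fun t : ℝ => u (x + t • v)) 0
  boundary : ∃ (U : Set (Fin n → ℝ)) (f : (Fin n → ℝ) → ℝ), IsOpen U ∧ P.closedSet ⊆ U ∧
    ContDiffOn ℝ ∞ f U ∧ ∀ x ∈ P.closedSet, u x - P.guillemin x = f x

/-! ### Vertices and the linear algebra at a vertex -/

variable {P}

lemma mem_active {x : Fin n → ℝ} {k : Fin d} : k ∈ P.active x ↔ P.L k x = 0 := by
  simp [active]

lemma L_add (k : Fin d) (x v : Fin n → ℝ) : P.L k (x + v) = P.L k x + v ⬝ᵥ P.normal k := by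
  simp only [L, add_dotProduct]; ring

lemma continuous_L (k : Fin d) : Continuous (P.L k) := by
  unfold L dotProduct; fun_prop

lemma linearIndependent_active {x : Fin n → ℝ} (hx : x ∈ P.closedSet) :
    LinearIndependent ℝ (fun k : P.active x => P.normal k) := by
  have h := P.simple' x hx
  let e : P.active x → {k : Fin d // x ⬝ᵥ P.normal k + P.const k = 0} :=
    fun k => ⟨k.1, mem_active.1 k.2⟩
  have he : Function.Injective e := by
    intro a b hab
    have := congrArg Subtype.val hab
    exact Subtype.ext this
  exact h.comp e he

lemma isCompact_closedSet : IsCompact P.closedSet := by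
  refine Metric.isCompact_of_isClosed_isBounded ?_ P.bounded'
  have : P.closedSet = ⋂ k, {x | 0 ≤ P.L k x} := by
    ext x; simp [closedSet]
  rw [this]
  exact isClosed_iInter fun k => isClosed_le continuous_const (continuous_L k)

/-- Each point of `P̄` lies on a face that contains a vertex. -/
lemma exists_vertex {x : Fin n → ℝ} (hx : x ∈ P.closedSet) :
    ∃ p, P.IsVertex p ∧ P.active x ⊆ P.active p := by
  classical
  let F : Set (Fin n → ℝ) := {y | y ∈ P.closedSet ∧ ∀ k ∈ P.active x, P.L k y = 0}
  have hFc : IsCompact F := by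
    refine isCompact_closedSet.inter_right (t := {y | ∀ k ∈ P.active x, P.L k y = 0}) ?_
    have : {y | ∀ k ∈ P.active x, P.L k y = 0} = ⋂ k ∈ P.active x, {y | P.L k y = 0} := by
      ext y; simp
    rw [this]
    exact isClosed_biInter fun k _ => isClosed_eq (continuous_L k) continuous_const
  obtain ⟨p, hp⟩ := hFc.extremePoints_nonempty ⟨x, hx, fun k hk => mem_active.1 hk⟩
  have hpF : p ∈ F := hp.1
  refine ⟨p, ⟨hpF.1, ?_⟩, fun k hk => mem_active.2 (hpF.2 k hk)⟩
  have hli := linearIndependent_active hpF.1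
  by_contra hcard
  have hle : (P.active p).card ≤ n := by
    have := hli.fintype_card_le_finrank
    simpa using this
  -- a direction orthogonal to all active normals
  have hker : ∃ v : Fin n → ℝ, v ≠ 0 ∧ ∀ k ∈ P.active p, v ⬝ᵥ P.normal k = 0 := by
    let f : (Fin n → ℝ) →ₗ[ℝ] (P.active p → ℝ) :=
      (Matrix.of fun k : P.active p => P.normal k).mulVecLin
    have : ¬ Function.Injective f := by
      intro hf
      have := LinearMap.finrank_le_finrank_of_injective hf
      simp at this
      omega
    have hk : LinearMap.ker f ≠ ⊥ := fun h => this (LinearMap.ker_eq_bot.1 h)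
    obtain ⟨v, hv, hv0⟩ := Submodule.exists_mem_ne_zero_of_ne_bot hk
    refine ⟨v, hv0, fun k hk => ?_⟩
    have := congrFun (LinearMap.mem_ker.1 hv) ⟨k, hk⟩
    simpa [f, Matrix.mulVec, dotProduct_comm] using this
  obtain ⟨v, hv0, hv⟩ := hker
  -- both `p + ε v` and `p - ε v` lie in `F` for small `ε`
  have hev : ∀ᶠ t : ℝ in nhds 0, p + t • v ∈ F := by
    have h1 : ∀ k, ∀ᶠ t : ℝ in nhds 0, 0 ≤ P.L k (p + t • v) := by
      intro k
      by_cases hk : k ∈ P.active p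
      · refine Filter.Eventually.of_forall fun t => ?_
        rw [L_add, mem_active.1 hk, smul_dotProduct, hv k hk]; simp
      · have hpos : 0 < P.L k p := lt_of_le_of_ne (hpF.1 k) (fun h => hk (mem_active.2 h.symm))
        have hc : Continuous fun t : ℝ => P.L k (p + t • v) :=
          (continuous_L k).comp (by fun_prop)
        have : ∀ᶠ t : ℝ in nhds 0, 0 < P.L k (p + t • v) :=
          hc.continuousAt.eventually (lt_mem_nhds (by simpa using hpos))
        exact this.mono fun t ht => ht.le
    filter_upwards [Filter.eventually_all.2 h1] with t ht
    refine ⟨ht, fun k hk => ?_⟩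
    have hk' : k ∈ P.active p := mem_active.2 (hpF.2 k hk)
    rw [L_add, mem_active.1 hk', smul_dotProduct, hv k hk']; simp
  obtain ⟨ε, hε, hball⟩ := Metric.eventually_nhds_iff.1 hev
  have h1 : p + (ε / 2) • v ∈ F := hball (by simp [abs_of_pos hε]; linarith)
  have h2 : p + (-(ε / 2)) • v ∈ F := hball (by simp [abs_of_pos hε]; linarith)
  have hmem : p ∈ openSegment ℝ (p + (ε / 2) • v) (p + (-(ε / 2)) • v) := by
    refine ⟨1 / 2, 1 / 2, by norm_num, by norm_num, by norm_num, ?_⟩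
    module
  have := hp.2 h1 h2 hmem
  have h3 : (ε / 2) • v = 0 := by simpa using this
  rcases smul_eq_zero.1 h3 with h | h
  · linarith
  · exact hv0 h

/-- The facets through the vertex `p`, in increasing order. -/
def vertexIdx {p : Fin n → ℝ} (hp : P.IsVertex p) : Fin n ↪o Fin d :=
  (P.active p).orderEmbOfFin hp.2

/-- The matrix whose rows are the normals at the vertex `p`; the columns of its inverse are the dual
basis. -/
def vertexMat {p : Fin n → ℝ} (hp : P.IsVertex p) : Matrix (Fin n) (Fin n) ℝ :=
  Matrix.of fun i => P.normal (vertexIdx hp i)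

lemma mem_active_vertex {p : Fin n → ℝ} (hp : P.IsVertex p) {k : Fin d} :
    k ∈ P.active p ↔ ∃ i, vertexIdx hp i = k := by
  have := (P.active p).range_orderEmbOfFin hp.2
  rw [← Finset.mem_coe, ← this]; rfl

lemma isUnit_det_vertexMat {p : Fin n → ℝ} (hp : P.IsVertex p) :
    IsUnit (vertexMat hp).det := by
  rw [← Matrix.isUnit_iff_isUnit_det, ← Matrix.linearIndependent_rows_iff_isUnit]
  have h := linearIndependent_active hp.1
  have hm : ∀ i, vertexIdx hp i ∈ P.active p := fun i => (mem_active_vertex hp).2 ⟨i, rfl⟩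
  exact h.comp (fun i => ⟨vertexIdx hp i, hm i⟩) (fun a b hab => by
    simpa using hab)


lemma vertexMat_inv_mul {p : Fin n → ℝ} (hp : P.IsVertex p) :
    (vertexMat hp)⁻¹ * vertexMat hp = 1 := Matrix.nonsing_inv_mul _ (isUnit_det_vertexMat hp)

lemma vertexMat_mul_inv {p : Fin n → ℝ} (hp : P.IsVertex p) :
    vertexMat hp * (vertexMat hp)⁻¹ = 1 := Matrix.mul_nonsing_inv _ (isUnit_det_vertexMat hp)

lemma normal_vecMul_inv {p : Fin n → ℝ} (hp : P.IsVertex p) (i : Fin n) :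
    P.normal (vertexIdx hp i) ᵥ* (vertexMat hp)⁻¹ = Pi.single i 1 := by
  have h := vertexMat_mul_inv hp
  have : P.normal (vertexIdx hp i) = Pi.single i 1 ᵥ* vertexMat hp := by
    ext j; simp [vertexMat]
  rw [this, Matrix.vecMul_vecMul, h, Matrix.vecMul_one]

/-! ### The toric manifold as a set -/

variable (P) (Λ : Submodule ℤ (Fin n → ℝ))

/-- The preimage in `𝔱` of the isotropy group in `T = 𝔱 / 2πΛ` of the points over `x`: it is generated
by `2πΛ` and by the normals of the facets through `x`. -/
def isotropy (x : Fin n → ℝ) : AddSubgroup (Fin n → ℝ) :=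
  (Λ.toAddSubgroup.map (DistribSMul.toAddMonoidHom (Fin n → ℝ) (2 * Real.pi))) ⊔
    (Submodule.span ℝ (P.normal '' {k | k ∈ P.active x})).toAddSubgroup

/-- `(x, θ) ∼ (x', θ')` if `x = x'` and `θ`, `θ'` have the same class in `T / T_F`, where `F` is the
face whose relative interior contains `x`. -/
def toricSetoid : Setoid (P.closedSet × (Fin n → ℝ)) where
  r a b := a.1 = b.1 ∧ a.2 - b.2 ∈ P.isotropy Λ a.1
  iseqv :=
    { refl := fun a => ⟨rfl, by simp [zero_mem]⟩
      symm := by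
        rintro a b ⟨h1, h2⟩
        refine ⟨h1.symm, ?_⟩
        rw [← h1, ← neg_sub]
        exact neg_mem h2
      trans := by
        rintro a b c ⟨h1, h2⟩ ⟨h3, h4⟩
        refine ⟨h1.trans h3, ?_⟩
        rw [← h1] at h4
        have := add_mem h2 h4
        simpa using this }

/-- The toric manifold `M` of the Delzant polytope `(P, η, Λ)`: the compactification
`(P̄ × T) / ∼` of `P × T`, where `T = 𝔱 / 2πΛ`. -/
def ToricManifold (_hP : P.IsDelzant Λ) : Type := Quotient (P.toricSetoid Λ)

lemma mem_isotropy {x t : Fin n → ℝ} : t ∈ P.isotropy Λ x ↔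
    ∃ l ∈ Λ, ∃ s ∈ Submodule.span ℝ (P.normal '' {k | k ∈ P.active x}),
      (2 * Real.pi) • l + s = t := by
  simp [isotropy, AddSubgroup.mem_sup]

lemma two_pi_smul_mem_isotropy {x l : Fin n → ℝ} (hl : l ∈ Λ) :
    (2 * Real.pi) • l ∈ P.isotropy Λ x :=
  (P.mem_isotropy Λ).2 ⟨l, hl, 0, zero_mem _, by simp⟩

variable {P Λ} {hP : P.IsDelzant Λ}

lemma closedSet_of_openSet {x : Fin n → ℝ} (hx : x ∈ P.openSet) : x ∈ P.closedSet :=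
  fun k => (hx k).le

variable (P) in
/-- A point of the open polytope. -/
def basePoint : P.closedSet :=
  ⟨P.nonempty'.choose, fun k => (P.nonempty'.choose_spec k).le⟩

namespace ToricManifold

variable (hP) in
/-- The class of `(x, θ)`, for `x ∈ P̄`. -/
def mk (a : P.closedSet × (Fin n → ℝ)) : ToricManifold P Λ hP := Quotient.mk (P.toricSetoid Λ) a

open Classical in
variable (hP) in
/-- The point `[x, θ]` of `M` for `x ∈ P̄` (for `x ∉ P̄` the value is irrelevant). Its restriction to
`P × 𝔱` gives the action-angle coordinates. -/
def pt (a : (Fin n → ℝ) × (Fin n → ℝ)) : ToricManifold P Λ hP :=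
  if h : a.1 ∈ P.closedSet then mk hP (⟨a.1, h⟩, a.2) else mk hP (P.basePoint, a.2)

lemma pt_of_mem {x θ : Fin n → ℝ} (hx : x ∈ P.closedSet) : pt hP (x, θ) = mk hP (⟨x, hx⟩, θ) :=
  dif_pos hx

/-- The moment map `x : M → 𝔱*`. -/
def moment (m : ToricManifold P Λ hP) : Fin n → ℝ :=
  Quotient.lift (s := P.toricSetoid Λ) (fun a => (a.1 : Fin n → ℝ))
    (fun _ _ h => congrArg Subtype.val h.1) m

lemma moment_mem (m : ToricManifold P Λ hP) : moment m ∈ P.closedSet := by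
  induction m using Quotient.inductionOn with
  | h a => exact a.1.2

lemma exists_pt (m : ToricManifold P Λ hP) : ∃ θ, m = pt hP (moment m, θ) := by
  induction m using Quotient.inductionOn with
  | h a =>
    exact ⟨a.2, (pt_of_mem a.1.2).symm⟩

lemma moment_pt {x θ : Fin n → ℝ} (hx : x ∈ P.closedSet) : moment (pt hP (x, θ)) = x := by
  rw [pt_of_mem hx]; rfl

lemma pt_eq_pt {x θ θ' : Fin n → ℝ} (hx : x ∈ P.closedSet) :
    pt hP (x, θ) = pt hP (x, θ') ↔ θ - θ' ∈ P.isotropy Λ x := by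
  rw [pt_of_mem hx, pt_of_mem hx]
  refine Quotient.eq (r := P.toricSetoid Λ) |>.trans ?_
  change (_ ∧ _) ↔ _
  simp

/-- The torus `T = 𝔱 / 2πΛ`. -/
abbrev _root_.Toric.Torus (Λ : Submodule ℤ (Fin n → ℝ)) : Type :=
  (Fin n → ℝ) ⧸ (Λ.toAddSubgroup.map (DistribSMul.toAddMonoidHom (Fin n → ℝ) (2 * Real.pi)))

/-- The action of `T` on `M` by translation of the angles. -/
instance : VAdd (Torus Λ) (ToricManifold P Λ hP) where
  vadd t m := Quotient.map₂ (sa := QuotientAddGroup.leftRel _) (sb := P.toricSetoid Λ)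
    (sc := P.toricSetoid Λ) (fun s a => (a.1, s + a.2)) (by
      rintro s s' hs a a' ⟨h1, h2⟩
      refine ⟨h1, ?_⟩
      have h3 : -s + s' ∈ P.isotropy Λ a.1 :=
        (le_sup_left : _ ≤ P.isotropy Λ a.1) (QuotientAddGroup.leftRel_apply.1 hs)
      have := add_mem (neg_mem h3) h2
      have e : s + a.2 - (s' + a'.2) = -(-s + s') + (a.2 - a'.2) := by abel
      simpa only [e] using this) t m

lemma mk_vadd_pt (s x θ : Fin n → ℝ) :
    (QuotientAddGroup.mk s : Torus Λ) +ᵥ pt hP (x, θ) = pt hP (x, s + θ) := by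
  by_cases hx : x ∈ P.closedSet
  · rw [pt_of_mem hx, pt_of_mem hx]; rfl
  · rw [pt, pt, dif_neg hx, dif_neg hx]; rfl

instance : AddAction (Torus Λ) (ToricManifold P Λ hP) where
  zero_vadd m := by
    obtain ⟨θ, h⟩ := exists_pt m
    rw [h, ← QuotientAddGroup.mk_zero, mk_vadd_pt, zero_add]
  add_vadd s t m := by
    obtain ⟨θ, h⟩ := exists_pt m
    induction s using QuotientAddGroup.induction_on with
    | H s =>
      induction t using QuotientAddGroup.induction_on with
      | H t => rw [h, ← QuotientAddGroup.mk_add, mk_vadd_pt, mk_vadd_pt, mk_vadd_pt, add_assoc]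

/-! ### The charts at the vertices -/

/-- The point `p + ½ ∑ |z_i|² η_i^*` of `𝔱*`. -/
def chartMoment {p : Fin n → ℝ} (hp : P.IsVertex p) (z : Fin n → ℂ) : Fin n → ℝ :=
  p + (vertexMat hp)⁻¹ *ᵥ (fun i => 1 / 2 * ‖z i‖ ^ 2)

/-- The angle `∑ arg(z_i) η_i` in `𝔱`. -/
def chartAngle {p : Fin n → ℝ} (hp : P.IsVertex p) (z : Fin n → ℂ) : Fin n → ℝ :=
  (fun i => Complex.arg (z i)) ᵥ* vertexMat hp

/-- The coordinates `z_i = √(2 L_i(x)) exp(√-1 θ_i)` at a vertex, where `θ = ∑ θ_i η_i`. -/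
def coord {p : Fin n → ℝ} (hp : P.IsVertex p) (x θ : Fin n → ℝ) (i : Fin n) : ℂ :=
  (Real.sqrt (2 * P.L (vertexIdx hp i) x) : ℂ) *
    Complex.exp (((θ ᵥ* (vertexMat hp)⁻¹) i : ℝ) * Complex.I)

lemma L_chartMoment {p : Fin n → ℝ} (hp : P.IsVertex p) (z : Fin n → ℂ) (i : Fin n) :
    P.L (vertexIdx hp i) (chartMoment hp z) = 1 / 2 * ‖z i‖ ^ 2 := by
  have h0 : P.L (vertexIdx hp i) p = 0 := mem_active.1 ((mem_active_vertex hp).2 ⟨i, rfl⟩)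
  rw [chartMoment, L_add, h0, zero_add, dotProduct_comm]
  have : P.normal (vertexIdx hp i) ⬝ᵥ (vertexMat hp)⁻¹ *ᵥ (fun i => 1 / 2 * ‖z i‖ ^ 2) =
      (vertexMat hp *ᵥ ((vertexMat hp)⁻¹ *ᵥ (fun i => 1 / 2 * ‖z i‖ ^ 2))) i := rfl
  rw [this, Matrix.mulVec_mulVec, vertexMat_mul_inv, Matrix.one_mulVec]

lemma norm_coord {p : Fin n → ℝ} (hp : P.IsVertex p) (x θ : Fin n → ℝ) (i : Fin n) :
    ‖coord hp x θ i‖ = Real.sqrt (2 * P.L (vertexIdx hp i) x) := by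
  rw [coord, norm_mul, Complex.norm_exp_ofReal_mul_I, mul_one, Complex.norm_real,
    Real.norm_of_nonneg (Real.sqrt_nonneg _)]

lemma chartMoment_coord {p : Fin n → ℝ} (hp : P.IsVertex p) {x : Fin n → ℝ}
    (hx : x ∈ P.closedSet) (θ : Fin n → ℝ) : chartMoment hp (coord hp x θ) = x := by
  have h1 : (fun i => 1 / 2 * ‖coord hp x θ i‖ ^ 2) = vertexMat hp *ᵥ (x - p) := by
    ext i
    rw [norm_coord, Real.sq_sqrt (by have := hx (vertexIdx hp i); positivity)]
    have h0 : P.L (vertexIdx hp i) p = 0 := mem_active.1 ((mem_active_vertex hp).2 ⟨i, rfl⟩)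
    have h2 : x = p + (x - p) := by abel
    have h3 : (vertexMat hp *ᵥ (x - p)) i = (x - p) ⬝ᵥ P.normal (vertexIdx hp i) := by
      rw [dotProduct_comm]; rfl
    rw [h3]
    conv_lhs => rw [h2, L_add, h0]
    ring
  rw [chartMoment, h1, Matrix.mulVec_mulVec, vertexMat_inv_mul, Matrix.one_mulVec]
  abel

lemma int_of_mem {p : Fin n → ℝ} (hP : P.IsDelzant Λ) (hp : P.IsVertex p) {l : Fin n → ℝ}
    (hl : l ∈ Λ) (i : Fin n) : ∃ N : ℤ, (l ᵥ* (vertexMat hp)⁻¹) i = N := by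
  rw [← hP.unimodular p hp] at hl
  induction hl using Submodule.span_induction with
  | mem y hy =>
    obtain ⟨k, hk, rfl⟩ := hy
    obtain ⟨j, rfl⟩ := (mem_active_vertex hp).1 hk
    rw [normal_vecMul_inv]
    by_cases h : i = j
    · subst h; exact ⟨1, by simp⟩
    · exact ⟨0, by simp [h]⟩
  | zero => exact ⟨0, by simp⟩
  | add y z _ _ h1 h2 =>
    obtain ⟨a, ha⟩ := h1
    obtain ⟨b, hb⟩ := h2
    exact ⟨a + b, by rw [Matrix.add_vecMul, Pi.add_apply, ha, hb]; push_cast; ring⟩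
  | smul c y _ h =>
    obtain ⟨a, ha⟩ := h
    refine ⟨c * a, ?_⟩
    rw [← Int.cast_smul_eq_zsmul ℝ c y, Matrix.smul_vecMul, Pi.smul_apply, ha]
    push_cast; rfl

lemma span_vecMul_inv {p : Fin n → ℝ} (hp : P.IsVertex p) {x : Fin n → ℝ}
    (hxp : P.active x ⊆ P.active p) {s : Fin n → ℝ}
    (hs : s ∈ Submodule.span ℝ (P.normal '' {k | k ∈ P.active x})) {i : Fin n}
    (hi : vertexIdx hp i ∉ P.active x) : (s ᵥ* (vertexMat hp)⁻¹) i = 0 := by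
  induction hs using Submodule.span_induction with
  | mem y hy =>
    obtain ⟨k, hk, rfl⟩ := hy
    obtain ⟨j, rfl⟩ := (mem_active_vertex hp).1 (hxp hk)
    rw [normal_vecMul_inv]
    have : i ≠ j := by rintro rfl; exact hi hk
    simp [this]
  | zero => simp
  | add y z _ _ h1 h2 => rw [Matrix.add_vecMul, Pi.add_apply, h1, h2, add_zero]
  | smul c y _ h => rw [Matrix.smul_vecMul, Pi.smul_apply, h, smul_zero]

lemma coord_eq {p : Fin n → ℝ} (hP : P.IsDelzant Λ) (hp : P.IsVertex p) {x θ θ' : Fin n → ℝ}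
    (hxp : P.active x ⊆ P.active p) (h : θ - θ' ∈ P.isotropy Λ x) :
    coord hp x θ = coord hp x θ' := by
  ext i
  by_cases hi : vertexIdx hp i ∈ P.active x
  · simp [coord, mem_active.1 hi]
  · obtain ⟨l, hl, s, hs, e⟩ := (P.mem_isotropy Λ).1 h
    obtain ⟨N, hN⟩ := int_of_mem hP hp hl i
    have h1 : θ = θ' + ((2 * Real.pi) • l + s) := by rw [e]; abel
    have h2 : (θ ᵥ* (vertexMat hp)⁻¹) i = (θ' ᵥ* (vertexMat hp)⁻¹) i + 2 * Real.pi * N := by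
      rw [h1, Matrix.add_vecMul, Matrix.add_vecMul, Matrix.smul_vecMul, Pi.add_apply, Pi.add_apply,
        Pi.smul_apply, hN, span_vecMul_inv hp hxp hs hi]
      simp
    unfold coord
    rw [h2]
    congr 1
    rw [Complex.exp_eq_exp_iff_exists_int]
    exact ⟨N, by push_cast; ring⟩

/-- The points of `M` over the faces that contain the vertex `p`. -/
def chartSource (hP : P.IsDelzant Λ) (p : Fin n → ℝ) : Set (ToricManifold P Λ hP) :=
  {m | P.active (moment m) ⊆ P.active p}

/-- The domain `U_p ⊆ ℂⁿ` of the parametrization at the vertex `p`. -/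
def chartTarget {p : Fin n → ℝ} (hp : P.IsVertex p) : Set (Fin n → ℂ) :=
  {z | ∀ k, k ∉ P.active p → 0 < P.L k (chartMoment hp z)}

lemma chartMoment_mem {p : Fin n → ℝ} (hp : P.IsVertex p) {z : Fin n → ℂ}
    (hz : z ∈ chartTarget hp) : chartMoment hp z ∈ P.closedSet := by
  intro k
  by_cases hk : k ∈ P.active p
  · obtain ⟨i, rfl⟩ := (mem_active_vertex hp).1 hk
    rw [L_chartMoment]; positivity
  · exact (hz k hk).le

open Classical in
/-- The coordinates on `M` at the vertex `p`, set to `0` off the domain. -/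
def chartFun {p : Fin n → ℝ} (hP : P.IsDelzant Λ) (hp : P.IsVertex p) (m : ToricManifold P Λ hP) :
    Fin n → ℂ :=
  Quotient.lift (s := P.toricSetoid Λ)
    (fun a => if P.active a.1 ⊆ P.active p then coord hp a.1 a.2 else 0)
    (by
      rintro a b ⟨h1, h2⟩
      simp only [← h1]
      split_ifs with h
      · exact coord_eq hP hp h h2
      · rfl) m

lemma chartFun_pt {p : Fin n → ℝ} (hp : P.IsVertex p) {x θ : Fin n → ℝ}
    (hx : x ∈ P.closedSet) (hxp : P.active x ⊆ P.active p) :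
    chartFun hP hp (pt hP (x, θ)) = coord hp x θ := by
  rw [pt_of_mem hx]
  exact if_pos hxp

lemma active_chartMoment {p : Fin n → ℝ} (hp : P.IsVertex p) {z : Fin n → ℂ}
    (hz : z ∈ chartTarget hp) : P.active (chartMoment hp z) ⊆ P.active p := by
  intro k hk
  by_contra h
  exact (hz k h).ne' (mem_active.1 hk)

/-- The chart at the vertex `p`; its inverse is
`z ↦ [p + ½ ∑ |z_i|² η_i^*, ∑ arg(z_i) η_i]`. -/
def chart {p : Fin n → ℝ} (hP : P.IsDelzant Λ) (hp : P.IsVertex p) :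
    PartialEquiv (ToricManifold P Λ hP) (Fin n → ℂ) where
  toFun := chartFun hP hp
  invFun z := pt hP (chartMoment hp z, chartAngle hp z)
  source := chartSource hP p
  target := chartTarget hp
  map_source' := by
    intro m hm k hk
    obtain ⟨θ, h⟩ := exists_pt m
    have hx := moment_mem m
    rw [h, chartFun_pt hp hx hm, chartMoment_coord hp hx]
    exact lt_of_le_of_ne (hx k) (fun e => hk (hm (mem_active.2 e.symm)))
  map_target' := by
    intro z hz
    change P.active _ ⊆ _
    rw [moment_pt (chartMoment_mem hp hz)]
    exact active_chartMoment hp hz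
  left_inv' := by
    intro m hm
    obtain ⟨θ, h⟩ := exists_pt m
    have hx := moment_mem m
    have hm' : P.active (moment m) ⊆ P.active p := hm
    generalize moment m = x at *
    subst h
    rw [chartFun_pt hp hx hm', chartMoment_coord hp hx, pt_eq_pt hx, mem_isotropy]
    -- the integers comparing the two angles away from the active facets
    have hint : ∀ i, ∃ N : ℤ, vertexIdx hp i ∉ P.active x →
        Complex.arg (coord hp x θ i) - (θ ᵥ* (vertexMat hp)⁻¹) i = 2 * Real.pi * N := by
      intro i
      by_cases hi : vertexIdx hp i ∈ P.active x
      · exact ⟨0, fun h => absurd hi h⟩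
      · have hpos : 0 < P.L (vertexIdx hp i) x :=
          lt_of_le_of_ne (hx _) (fun e => hi (mem_active.2 e.symm))
        have hr : 0 < Real.sqrt (2 * P.L (vertexIdx hp i) x) := Real.sqrt_pos.2 (by positivity)
        have h1 := Complex.norm_mul_exp_arg_mul_I (coord hp x θ i)
        rw [norm_coord] at h1
        have h2 : Complex.exp ((Complex.arg (coord hp x θ i) : ℝ) * Complex.I) =
            Complex.exp (((θ ᵥ* (vertexMat hp)⁻¹) i : ℝ) * Complex.I) := by
          have : (Real.sqrt (2 * P.L (vertexIdx hp i) x) : ℂ) ≠ 0 := by exact_mod_cast hr.ne'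
          exact mul_left_cancel₀ this h1
        obtain ⟨N, hN⟩ := Complex.exp_eq_exp_iff_exists_int.1 h2
        refine ⟨N, fun _ => ?_⟩
        have h3 : ((Complex.arg (coord hp x θ i) : ℂ) -
            (((θ ᵥ* (vertexMat hp)⁻¹) i : ℝ) : ℂ) - 2 * Real.pi * N) * Complex.I = 0 := by
          linear_combination hN
        have h4 := (mul_eq_zero.1 h3).resolve_right Complex.I_ne_zero
        have h5 : Complex.arg (coord hp x θ i) - (θ ᵥ* (vertexMat hp)⁻¹) i - 2 * Real.pi * N = 0 := by
          exact_mod_cast h4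
        linarith
    choose N hN using hint
    let c : Fin n → ℝ := fun i => Complex.arg (coord hp x θ i) - (θ ᵥ* (vertexMat hp)⁻¹) i
    have hsum : chartAngle hp (coord hp x θ) - θ = ∑ i, c i • P.normal (vertexIdx hp i) := by
      have h1 : θ = (θ ᵥ* (vertexMat hp)⁻¹) ᵥ* vertexMat hp := by
        rw [Matrix.vecMul_vecMul, vertexMat_inv_mul, Matrix.vecMul_one]
      conv_lhs => rw [h1]
      rw [chartAngle, ← Matrix.sub_vecMul, ← h1, Matrix.vecMul_eq_sum]
      rfl
    refine ⟨∑ i, N i • P.normal (vertexIdx hp i),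
      Submodule.sum_mem _ fun i _ => Λ.smul_mem _ (hP.rational _),
      ∑ i, (c i - 2 * Real.pi * N i) • P.normal (vertexIdx hp i), ?_, ?_⟩
    · refine Submodule.sum_mem _ fun i _ => ?_
      by_cases hi : vertexIdx hp i ∈ P.active x
      · exact Submodule.smul_mem _ _ (Submodule.subset_span ⟨_, hi, rfl⟩)
      · have : c i - 2 * Real.pi * N i = 0 := by rw [← hN i hi]; simp [c]
        rw [this, zero_smul]; exact zero_mem _
    · rw [hsum, Finset.smul_sum, ← Finset.sum_add_distrib]
      refine Finset.sum_congr rfl fun i _ => ?_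
      rw [← Int.cast_smul_eq_zsmul ℝ, smul_smul, ← add_smul]
      congr 1; ring
  right_inv' := by
    intro z hz
    have hx := chartMoment_mem hp hz
    rw [chartFun_pt hp hx (active_chartMoment hp hz)]
    ext i
    rw [coord, L_chartMoment, chartAngle, Matrix.vecMul_vecMul, vertexMat_mul_inv,
      Matrix.vecMul_one]
    have : 2 * (1 / 2 * ‖z i‖ ^ 2) = ‖z i‖ ^ 2 := by ring
    rw [this, Real.sqrt_sq (norm_nonneg _)]
    exact Complex.norm_mul_exp_arg_mul_I _

/-! ### The smooth structure -/

lemma contDiff_chartMoment {p : Fin n → ℝ} (hp : P.IsVertex p) :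
    ContDiff ℝ ∞ (chartMoment hp) := by
  have h : ContDiff ℝ ∞ (fun z : Fin n → ℂ => fun i => 1 / 2 * ‖z i‖ ^ 2) :=
    contDiff_pi.2 fun i => contDiff_const.mul ((contDiff_apply ℝ ℂ i).norm_sq ℝ)
  have h2 : ContDiff ℝ ∞ (fun y : Fin n → ℝ => (vertexMat hp)⁻¹ *ᵥ y) :=
    (LinearMap.toContinuousLinearMap (Matrix.mulVecLin (vertexMat hp)⁻¹)).contDiff
  exact contDiff_const.add (h2.comp h)

lemma contDiff_L (k : Fin d) : ContDiff ℝ ∞ (P.L k) := by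
  unfold L dotProduct; fun_prop

/-- The part of `U_p` that the chart at `p` maps to the domain of the chart at `q`. -/
def overlap {p : Fin n → ℝ} (hp : P.IsVertex p) (q : Fin n → ℝ) : Set (Fin n → ℂ) :=
  {z | ∀ k, (k ∉ P.active p ∨ k ∉ P.active q) → 0 < P.L k (chartMoment hp z)}

lemma isOpen_overlap {p : Fin n → ℝ} (hp : P.IsVertex p) (q : Fin n → ℝ) :
    IsOpen (overlap hp q) := by
  have : overlap hp q = ⋂ k, {z | (k ∉ P.active p ∨ k ∉ P.active q) →
      0 < P.L k (chartMoment hp z)} := by ext z; simp [overlap]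
  rw [this]
  refine isOpen_iInter_of_finite fun k => ?_
  by_cases h : k ∉ P.active p ∨ k ∉ P.active q
  · simp only [h, forall_const]
    exact isOpen_lt continuous_const
      ((continuous_L k).comp (contDiff_chartMoment hp).continuous)
  · simp [h]

lemma trans_source {p q : Fin n → ℝ} (hp : P.IsVertex p) (hq : P.IsVertex q) :
    ((chart hP hp).symm.trans (chart hP hq)).source = overlap hp q := by
  ext z
  rw [PartialEquiv.trans_source]
  change (z ∈ chartTarget hp ∧ P.active (moment (pt hP _)) ⊆ P.active q) ↔ _
  constructor
  · rintro ⟨h1, h2⟩ k hk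
    have hx := chartMoment_mem hp h1
    rw [moment_pt hx] at h2
    refine lt_of_le_of_ne (hx k) fun e => ?_
    rcases hk with hk | hk
    · exact (h1 k hk).ne e
    · exact hk (h2 (mem_active.2 e.symm))
  · intro h
    have h1 : z ∈ chartTarget hp := fun k hk => h k (Or.inl hk)
    refine ⟨h1, ?_⟩
    rw [moment_pt (chartMoment_mem hp h1)]
    intro k hk
    by_contra hkq
    exact (h k (Or.inr hkq)).ne' (mem_active.1 hk)

lemma trans_eqOn {p q : Fin n → ℝ} (hp : P.IsVertex p) (hq : P.IsVertex q) :
    Set.EqOn ((chart hP hp).symm.trans (chart hP hq))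
      (fun z => coord hq (chartMoment hp z) (chartAngle hp z)) (overlap hp q) := by
  intro z hz
  rw [← trans_source (hP := hP) hp hq, PartialEquiv.trans_source] at hz
  have h1 : z ∈ chartTarget hp := hz.1
  have hx := chartMoment_mem hp h1
  have h2 : P.active (moment (pt hP (chartMoment hp z, chartAngle hp z))) ⊆ P.active q := hz.2
  rw [moment_pt hx] at h2
  exact chartFun_pt hq hx h2

lemma contDiffAt_unit (N : ℤ) (i : Fin n) {z : Fin n → ℂ} (hz : z i ≠ 0) :
    ContDiffAt ℝ ∞ (fun z : Fin n → ℂ => (z i * ((‖z i‖ : ℝ) : ℂ)⁻¹) ^ N) z := by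
  have h0 : ContDiffAt ℝ ∞ (fun z : Fin n → ℂ => z i) z := contDiffAt_pi.1 contDiffAt_id i
  have hn : ContDiffAt ℝ ∞ (fun z : Fin n → ℂ => ((‖z i‖ : ℝ) : ℂ)) z :=
    Complex.ofRealCLM.contDiff.contDiffAt.comp z (h0.norm ℝ hz)
  have hne : ((‖z i‖ : ℝ) : ℂ) ≠ 0 := by exact_mod_cast norm_ne_zero_iff.2 hz
  have h1 := h0.mul (hn.inv hne)
  cases N with
  | ofNat N => simpa using h1.pow N
  | negSucc N =>
    simp only [zpow_negSucc]
    exact (h1.pow (N + 1)).inv (pow_ne_zero _ (mul_ne_zero hz (inv_ne_zero hne)))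

lemma contDiffOn_trans {p q : Fin n → ℝ} (hP : P.IsDelzant Λ) (hp : P.IsVertex p)
    (hq : P.IsVertex q) :
    ContDiffOn ℝ ∞ (fun z => coord hq (chartMoment hp z) (chartAngle hp z)) (overlap hp q) := by
  classical
  rw [contDiffOn_pi]
  intro j
  choose N hN using fun i => int_of_mem hP hq (hP.rational (vertexIdx hp i)) j
  let S : Finset (Fin n) := Finset.univ.filter fun i => vertexIdx hp i ∉ P.active q
  let U : (Fin n → ℂ) → ℂ := fun z => ∏ i ∈ S, (z i * ((‖z i‖ : ℝ) : ℂ)⁻¹) ^ N i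
  have hne : ∀ z ∈ overlap hp q, ∀ i ∈ S, z i ≠ 0 := by
    intro z hz i hi h0
    have h1 := hz (vertexIdx hp i) (Or.inr (Finset.mem_filter.1 hi).2)
    rw [L_chartMoment, h0] at h1
    simp at h1
  have hU : ContDiffOn ℝ ∞ U (overlap hp q) := by
    intro z hz
    refine ContDiffWithinAt.congr_of_mem (f := U) ?_ (fun _ _ => rfl) hz
    exact (contDiffAt_prod fun i hi => contDiffAt_unit (N i) i (hne z hz i hi)).contDiffWithinAt
  -- the phase factor
  have hang : ∀ z : Fin n → ℂ, (chartAngle hp z ᵥ* (vertexMat hq)⁻¹) j =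
      ∑ i, Complex.arg (z i) * N i := by
    intro z
    rw [chartAngle, Matrix.vecMul_vecMul]
    simp only [Matrix.vecMul, dotProduct]
    refine Finset.sum_congr rfl fun i _ => ?_
    rw [← hN i]; rfl
  have hexp : ∀ z ∈ overlap hp q,
      Complex.exp (((chartAngle hp z ᵥ* (vertexMat hq)⁻¹) j : ℝ) * Complex.I) =
      U z * ∏ i ∈ Finset.univ.filter (fun i => ¬ vertexIdx hp i ∉ P.active q),
        Complex.exp ((Complex.arg (z i) : ℝ) * Complex.I) ^ N i := by
    intro z hz
    have h1 : Complex.exp (((chartAngle hp z ᵥ* (vertexMat hq)⁻¹) j : ℝ) * Complex.I) =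
        ∏ i, Complex.exp ((Complex.arg (z i) : ℝ) * Complex.I) ^ N i := by
      rw [hang]
      push_cast
      rw [Finset.sum_mul, Complex.exp_sum]
      refine Finset.prod_congr rfl fun i _ => ?_
      rw [← Complex.exp_int_mul]
      congr 1; ring
    rw [h1, ← Finset.prod_filter_mul_prod_filter_not Finset.univ
      (fun i => vertexIdx hp i ∉ P.active q)]
    congr 1
    refine Finset.prod_congr rfl fun i hi => ?_
    congr 1
    have hz0 : ((‖z i‖ : ℝ) : ℂ) ≠ 0 := by exact_mod_cast norm_ne_zero_iff.2 (hne z hz i hi)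
    rw [eq_mul_inv_iff_mul_eq₀ hz0, mul_comm]
    exact Complex.norm_mul_exp_arg_mul_I _
  have hdelta : ∀ i i', vertexIdx hq i' = vertexIdx hp i → N i = if j = i' then 1 else 0 := by
    intro i i' h
    have := hN i
    rw [← h, normal_vecMul_inv, Pi.single_apply] at this
    split_ifs at this ⊢ <;> exact_mod_cast this.symm
  by_cases hj : vertexIdx hq j ∈ P.active p
  · obtain ⟨i0, hi0⟩ := (mem_active_vertex hp).1 hj
    refine ContDiffOn.congr (f := fun z => U z * z i0)
      (hU.mul (contDiff_apply ℝ ℂ i0).contDiffOn) fun z hz => ?_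
    have hprod : ∏ i ∈ Finset.univ.filter (fun i => ¬ vertexIdx hp i ∉ P.active q),
        Complex.exp ((Complex.arg (z i) : ℝ) * Complex.I) ^ N i =
        Complex.exp ((Complex.arg (z i0) : ℝ) * Complex.I) := by
      rw [Finset.prod_eq_single i0]
      · rw [hdelta i0 j hi0.symm]; simp
      · intro i hi hii
        have hiq : vertexIdx hp i ∈ P.active q := by simpa using hi
        obtain ⟨i', hi'⟩ := (mem_active_vertex hq).1 hiq
        rw [hdelta i i' hi', if_neg, zpow_zero]
        rintro rfl
        exact hii ((vertexIdx hp).injective (hi'.symm.trans hi0.symm))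
      · intro h
        refine absurd ?_ h
        have : vertexIdx hp i0 ∈ P.active q := by
          rw [hi0]; exact (mem_active_vertex hq).2 ⟨j, rfl⟩
        simpa using this
    rw [coord, hexp z hz, hprod, ← hi0, L_chartMoment]
    have : 2 * (1 / 2 * ‖z i0‖ ^ 2) = ‖z i0‖ ^ 2 := by ring
    rw [this, Real.sqrt_sq (norm_nonneg _)]
    have := Complex.norm_mul_exp_arg_mul_I (z i0)
    linear_combination U z * this
  · have hs : ContDiffOn ℝ ∞
        (fun z => ((Real.sqrt (2 * P.L (vertexIdx hq j) (chartMoment hp z)) : ℝ) : ℂ))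
        (overlap hp q) := by
      intro z hz
      have hpos := hz _ (Or.inl hj)
      have h1 : ContDiffAt ℝ ∞ (fun z => 2 * P.L (vertexIdx hq j) (chartMoment hp z)) z :=
        (contDiff_const.mul ((contDiff_L _).comp (contDiff_chartMoment hp))).contDiffAt
      have h2 := h1.sqrt (by positivity)
      exact (Complex.ofRealCLM.contDiff.contDiffAt.comp z h2).contDiffWithinAt
    refine ContDiffOn.congr (hs.mul hU) fun z hz => ?_
    have hprod : ∏ i ∈ Finset.univ.filter (fun i => ¬ vertexIdx hp i ∉ P.active q),
        Complex.exp ((Complex.arg (z i) : ℝ) * Complex.I) ^ N i = 1 := by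
      refine Finset.prod_eq_one fun i hi => ?_
      have hiq : vertexIdx hp i ∈ P.active q := by simpa using hi
      obtain ⟨i', hi'⟩ := (mem_active_vertex hq).1 hiq
      rw [hdelta i i' hi', if_neg, zpow_zero]
      rintro rfl
      exact hj (by rw [hi']; exact (mem_active_vertex hp).2 ⟨i, rfl⟩)
    rw [coord, hexp z hz, hprod, mul_one]

variable (hP) in
/-- A vertex on the smallest face that contains `moment m`. -/
def vertexAt (m : ToricManifold P Λ hP) : Fin n → ℝ := (exists_vertex (moment_mem m)).choose

lemma isVertex_vertexAt (m : ToricManifold P Λ hP) : P.IsVertex (vertexAt hP m) :=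
  (exists_vertex (moment_mem m)).choose_spec.1

variable (P Λ hP) in
/-- The atlas of `M`: the charts at the vertices. -/
def core : ChartedSpaceCore (Fin n → ℂ) (ToricManifold P Λ hP) where
  atlas := {e | ∃ (p : Fin n → ℝ) (hp : P.IsVertex p), e = chart hP hp}
  chartAt m := chart hP (isVertex_vertexAt m)
  mem_chart_source m := (exists_vertex (moment_mem m)).choose_spec.2
  chart_mem_atlas m := ⟨_, isVertex_vertexAt m, rfl⟩
  open_source := by
    rintro _ _ ⟨p, hp, rfl⟩ ⟨q, hq, rfl⟩
    rw [trans_source]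
    exact isOpen_overlap hp q
  continuousOn_toFun := by
    rintro _ _ ⟨p, hp, rfl⟩ ⟨q, hq, rfl⟩
    rw [trans_source]
    exact (contDiffOn_trans hP hp hq).continuousOn.congr (trans_eqOn hp hq)

instance : TopologicalSpace (ToricManifold P Λ hP) := (core P Λ hP).toTopologicalSpace

instance : ChartedSpace (Fin n → ℂ) (ToricManifold P Λ hP) := (core P Λ hP).toChartedSpace

instance : IsManifold 𝓘(ℝ, Fin n → ℂ) ∞ (ToricManifold P Λ hP) := by
  refine isManifold_of_contDiffOn _ _ _ ?_
  rintro e e' he he'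
  have key : ∀ f : OpenPartialHomeomorph (ToricManifold P Λ hP) (Fin n → ℂ),
      f ∈ atlas (Fin n → ℂ) (ToricManifold P Λ hP) →
      ∃ (p : Fin n → ℝ) (hp : P.IsVertex p), f.toPartialEquiv = chart hP hp := by
    intro f hf
    change f ∈ ⋃ (e : PartialEquiv _ _) (he : e ∈ (core P Λ hP).atlas),
      {(core P Λ hP).openPartialHomeomorph e he} at hf
    simp only [Set.mem_iUnion, Set.mem_singleton_iff] at hf
    obtain ⟨e, ⟨p, hp, rfl⟩, rfl⟩ := hf
    exact ⟨p, hp, rfl⟩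
  obtain ⟨p, hp, h1⟩ := key e he
  obtain ⟨q, hq, h2⟩ := key e' he'
  have hs : (e.symm.trans e').source = overlap hp q := by
    rw [← trans_source (hP := hP) hp hq, ← h1, ← h2]; rfl
  have hf : ∀ z, (e.symm.trans e') z = ((chart hP hp).symm.trans (chart hP hq)) z := by
    intro z; rw [← h1, ← h2]; rfl
  simp only [modelWithCornersSelf_coe, modelWithCornersSelf_coe_symm, Set.range_id, Set.inter_univ,
    Set.preimage_id, Function.id_comp, Function.comp_id, hs]
  refine (contDiffOn_trans hP hp hq).congr fun z hz => ?_
  exact (hf z).trans (trans_eqOn hp hq hz)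

/-! ### `M` is a compact Hausdorff space -/

/-- The chart at the vertex `p`, as a homeomorphism. -/
def chartHomeo (hP : P.IsDelzant Λ) {p : Fin n → ℝ} (hp : P.IsVertex p) :
    OpenPartialHomeomorph (ToricManifold P Λ hP) (Fin n → ℂ) :=
  (core P Λ hP).openPartialHomeomorph (chart hP hp) ⟨p, hp, rfl⟩

lemma continuous_moment : Continuous (moment : ToricManifold P Λ hP → Fin n → ℝ) := by
  rw [continuous_iff_continuousAt]
  intro m
  obtain ⟨p, hp, hm⟩ := exists_vertex (moment_mem m)
  let e := chartHomeo hP hp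
  have hme : m ∈ e.source := hm
  have h1 : ContinuousAt (fun m' => chartMoment hp (e m')) m :=
    (contDiff_chartMoment hp).continuous.continuousAt.comp (e.continuousAt hme)
  refine h1.congr ?_
  filter_upwards [e.open_source.mem_nhds hme] with m' hm'
  obtain ⟨θ, h⟩ := exists_pt m'
  have hx := moment_mem m'
  have h2 : e m' = coord hp (moment m') θ := by
    conv_lhs => rw [h]
    exact chartFun_pt hp hx hm'
  change chartMoment hp (e m') = moment m'
  rw [h2, chartMoment_coord hp hx]

instance : T2Space (ToricManifold P Λ hP) := by
  refine ⟨fun m m' hne => ?_⟩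
  by_cases hx : moment m = moment m'
  · obtain ⟨p, hp, hm⟩ := exists_vertex (moment_mem m)
    let e := chartHomeo hP hp
    have hme : m ∈ e.source := hm
    have hme' : m' ∈ e.source := by
      change P.active (moment m') ⊆ P.active p
      rw [← hx]; exact hm
    obtain ⟨u, v, hu, hv, hmu, hmv, huv⟩ := t2_separation (e.injOn.ne hme hme' hne)
    refine ⟨e.source ∩ e ⁻¹' u, e.source ∩ e ⁻¹' v, e.isOpen_inter_preimage hu,
      e.isOpen_inter_preimage hv, ⟨hme, hmu⟩, ⟨hme', hmv⟩, ?_⟩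
    exact (huv.preimage e).mono Set.inter_subset_right Set.inter_subset_right
  · obtain ⟨u, v, hu, hv, hmu, hmv, huv⟩ := t2_separation hx
    exact ⟨moment ⁻¹' u, moment ⁻¹' v, hu.preimage continuous_moment,
      hv.preimage continuous_moment, hmu, hmv, huv.preimage _⟩

lemma continuous_coord {p : Fin n → ℝ} (hp : P.IsVertex p) :
    Continuous fun a : P.closedSet × (Fin n → ℝ) => coord hp a.1 a.2 := by
  refine continuous_pi fun i => ?_
  have h1 : Continuous fun a : P.closedSet × (Fin n → ℝ) => P.L (vertexIdx hp i) a.1 :=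
    (continuous_L _).comp (continuous_subtype_val.comp continuous_fst)
  have h2 : Continuous fun a : P.closedSet × (Fin n → ℝ) => (a.2 ᵥ* (vertexMat hp)⁻¹) i := by
    simp only [Matrix.vecMul, dotProduct]; fun_prop
  unfold coord
  fun_prop

lemma continuous_mk : Continuous (mk hP) := by
  refine continuous_generateFrom_iff.2 fun s hs => ?_
  simp only [Set.mem_iUnion, Set.mem_singleton_iff] at hs
  obtain ⟨e, ⟨p, hp, rfl⟩, s, hs, rfl⟩ := hs
  have h : mk hP ⁻¹' ((chart hP hp) ⁻¹' s ∩ (chart hP hp).source) =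
      (fun a : P.closedSet × (Fin n → ℝ) => coord hp a.1 a.2) ⁻¹' s ∩
        ⋂ k, {a | k ∉ P.active p → 0 < P.L k a.1} := by
    ext a
    have hsrc : mk hP a ∈ (chart hP hp).source ↔ ∀ k, k ∉ P.active p → 0 < P.L k a.1 := by
      change P.active a.1 ⊆ P.active p ↔ _
      constructor
      · intro h k hk
        exact lt_of_le_of_ne (a.1.2 k) fun e => hk (h (mem_active.2 e.symm))
      · intro h k hk
        by_contra hkp
        exact (h k hkp).ne' (mem_active.1 hk)
    simp only [Set.mem_preimage, Set.mem_inter_iff, Set.mem_iInter, Set.mem_ofPred_eq, hsrc]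
    refine and_congr_left fun h => ?_
    have : (chart hP hp) (mk hP a) = coord hp a.1 a.2 := if_pos (hsrc.2 h)
    rw [this]
  rw [h]
  refine (hs.preimage (continuous_coord hp)).inter (isOpen_iInter_of_finite fun k => ?_)
  by_cases hk : k ∈ P.active p
  · simp [hk]
  · simp only [hk, not_false_eq_true, forall_const]
    exact isOpen_lt continuous_const
      ((continuous_L k).comp (continuous_subtype_val.comp continuous_fst))

instance : CompactSpace (ToricManifold P Λ hP) := by
  obtain ⟨p, hp, -⟩ := exists_vertex P.basePoint.2
  let K : Set (Fin n → ℝ) := (fun φ => φ ᵥ* vertexMat hp) '' Set.Icc 0 (fun _ => 2 * Real.pi)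
  have hK : IsCompact K := by
    refine isCompact_Icc.image ?_
    refine continuous_pi fun i => ?_
    simp only [Matrix.vecMul, dotProduct]; fun_prop
  have : CompactSpace P.closedSet := isCompact_iff_compactSpace.1 isCompact_closedSet
  have hc : IsCompact (mk hP '' (Set.univ ×ˢ K)) := (isCompact_univ.prod hK).image continuous_mk
  refine ⟨?_⟩
  convert hc
  refine (Set.eq_univ_of_forall fun m => ?_).symm
  obtain ⟨θ, h⟩ := exists_pt m
  have hx := moment_mem m
  let φ := θ ᵥ* (vertexMat hp)⁻¹
  let N : Fin n → ℤ := fun i => ⌊φ i / (2 * Real.pi)⌋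
  let ψ : Fin n → ℝ := fun i => φ i - 2 * Real.pi * N i
  have hpi : 0 < 2 * Real.pi := by positivity
  refine ⟨(⟨moment m, hx⟩, ψ ᵥ* vertexMat hp), ⟨Set.mem_univ _, ψ, ⟨?_, ?_⟩, rfl⟩, ?_⟩
  · intro i
    have := Int.floor_le (φ i / (2 * Real.pi))
    rw [le_div_iff₀ hpi] at this
    simp only [Pi.zero_apply, ψ, N]; linarith
  · intro i
    have := (Int.lt_floor_add_one (φ i / (2 * Real.pi))).le
    rw [div_le_iff₀ hpi] at this
    simp only [ψ, N]; linarith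
  · rw [← pt_of_mem hx]
    conv_rhs => rw [h]
    rw [pt_eq_pt hx]
    have h1 : θ = φ ᵥ* vertexMat hp := by
      rw [Matrix.vecMul_vecMul, vertexMat_inv_mul, Matrix.vecMul_one]
    have h2 : ψ ᵥ* vertexMat hp - θ =
        (2 * Real.pi) • ∑ i, (-N i) • P.normal (vertexIdx hp i) := by
      rw [h1, ← Matrix.sub_vecMul, Matrix.vecMul_eq_sum, Finset.smul_sum]
      refine Finset.sum_congr rfl fun i _ => ?_
      rw [← Int.cast_smul_eq_zsmul ℝ, smul_smul]
      simp only [ψ, Pi.sub_apply]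
      push_cast
      congr 1; ring
    rw [h2]
    exact P.two_pi_smul_mem_isotropy Λ
      (Submodule.sum_mem _ fun i _ => Λ.smul_mem _ (hP.rational _))

end ToricManifold

end LabelledPolytope

/-! ### Tensor fields, Kähler metrics and cone angles

In this section `M` is a manifold of real dimension `2n`, with charts in `ℂⁿ = ℝ²ⁿ`. -/

section Tensor

variable {n : ℕ} {M : Type*} [TopologicalSpace M] [ChartedSpace (Fin n → ℂ) M]

variable (n M) in
/-- Covariant tensor fields of degree two. -/
abbrev Tensor2 : Type _ :=
  ∀ m : M, TangentSpace 𝓘(ℝ, Fin n → ℂ) m →L[ℝ] TangentSpace 𝓘(ℝ, Fin n → ℂ) m →L[ℝ] ℝ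

/-- The tensor field is smooth on `S`. -/
def SmoothOn [IsManifold 𝓘(ℝ, Fin n → ℂ) ∞ M] (g : Tensor2 n M) (S : Set M) : Prop :=
  ContMDiffOn 𝓘(ℝ, Fin n → ℂ)
    (𝓘(ℝ, Fin n → ℂ).prod 𝓘(ℝ, (Fin n → ℂ) →L[ℝ] (Fin n → ℂ) →L[ℝ] ℝ)) ∞
    (fun m => Bundle.TotalSpace.mk' ((Fin n → ℂ) →L[ℝ] (Fin n → ℂ) →L[ℝ] ℝ) m (g m)) S

/-- The tensor field is a smooth Riemannian metric on `S`. -/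
structure IsMetricOn [IsManifold 𝓘(ℝ, Fin n → ℂ) ∞ M] (g : Tensor2 n M) (S : Set M) : Prop where
  smooth : SmoothOn g S
  symm : ∀ m ∈ S, ∀ v w, g m v w = g m w v
  pos : ∀ m ∈ S, ∀ v, v ≠ 0 → 0 < g m v v

variable (n) in
/-- The differential of a function with values in a vector space. -/
def diff {W : Type*} [NormedAddCommGroup W] [NormedSpace ℝ W] (f : M → W) (m : M) :
    TangentSpace 𝓘(ℝ, Fin n → ℂ) m →L[ℝ] W :=
  mfderiv 𝓘(ℝ, Fin n → ℂ) 𝓘(ℝ, W) f m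

/-- The expression of a tensor field in the preferred chart at `m₀`. -/
def inChart (σ : Tensor2 n M) (m₀ : M) (y v w : Fin n → ℂ) : ℝ :=
  σ ((extChartAt 𝓘(ℝ, Fin n → ℂ) m₀).symm y)
    (mfderiv 𝓘(ℝ, Fin n → ℂ) 𝓘(ℝ, Fin n → ℂ) (extChartAt 𝓘(ℝ, Fin n → ℂ) m₀).symm y v)
    (mfderiv 𝓘(ℝ, Fin n → ℂ) 𝓘(ℝ, Fin n → ℂ) (extChartAt 𝓘(ℝ, Fin n → ℂ) m₀).symm y w)

/-- The exterior derivative of the two-form `σ` vanishes on `S`: in the chart at each `m ∈ S`, the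
cyclic sum of the directional derivatives of the coefficients is zero at `m`. -/
def IsClosedFormOn (σ : Tensor2 n M) (S : Set M) : Prop :=
  ∀ m ∈ S, ∀ a b c : Fin n → ℂ,
    fderiv ℝ (fun y => inChart σ m y b c) (extChartAt 𝓘(ℝ, Fin n → ℂ) m m) a +
    fderiv ℝ (fun y => inChart σ m y c a) (extChartAt 𝓘(ℝ, Fin n → ℂ) m m) b +
    fderiv ℝ (fun y => inChart σ m y a b) (extChartAt 𝓘(ℝ, Fin n → ℂ) m m) c = 0

/-- `g` is a Kähler metric on `S` compatible with the symplectic form `σ`: the endomorphism `J` with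
`σ = g(J ·, ·)` is an almost complex structure, it is integrable (there are local holomorphic
coordinates), and `σ` is a smooth closed two-form. -/
structure IsKahlerOn [IsManifold 𝓘(ℝ, Fin n → ℂ) ∞ M] (g σ : Tensor2 n M) (S : Set M) :
    Prop where
  metric : IsMetricOn g S
  smooth_form : SmoothOn σ S
  alternating : ∀ m ∈ S, ∀ v, σ m v v = 0
  closed : IsClosedFormOn σ S
  complex : ∃ J : ∀ m : M, TangentSpace 𝓘(ℝ, Fin n → ℂ) m →L[ℝ] TangentSpace 𝓘(ℝ, Fin n → ℂ) m,
    (∀ m ∈ S, ∀ v, J m (J m v) = -v) ∧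
    (∀ m ∈ S, ∀ v w, σ m v w = g m (J m v) w) ∧
    ∀ m₀ ∈ S, ∃ (U : Set M) (F : M → Fin n → ℂ), IsOpen U ∧ m₀ ∈ U ∧ U ⊆ S ∧
      ContMDiffOn 𝓘(ℝ, Fin n → ℂ) 𝓘(ℝ, Fin n → ℂ) ∞ F U ∧
      ∀ m ∈ U, Function.Bijective (diff n F m) ∧
        ∀ v, diff n F m (J m v) = Complex.I • diff n F m v

/-- The flat metric `dr² + a² r² dφ²` of a cone of total angle `2πa`, in polar coordinates
`z = r exp(√-1 φ)` on `ℂ ∖ {0}`, at the point `z` on the tangent vectors `ζ`, `ζ'`: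
`dr + √-1 r dφ = (z̄ / |z|) dz`. -/
def flatCone (a : ℝ) (z ζ ζ' : ℂ) : ℝ :=
  ((starRingEnd ℂ z * ζ).re * (starRingEnd ℂ z * ζ').re +
    a ^ 2 * ((starRingEnd ℂ z * ζ).im * (starRingEnd ℂ z * ζ').im)) / ‖z‖ ^ 2

/-- The metric `g`, given on `S`, has total angle `β` around the submanifold `D` of codimension two:
near each point of `D` there is a smooth submersion `w = r exp(√-1 φ)` to `ℂ` with `D = {w = 0}`,
and up to a factor `c > 0` the metric `g` off `D` is `dr² + (β/2π)² r² dφ²` plus a symmetric tensor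
`B` that is smooth across `D`; along `D`, the tensor `B` reduces to a Riemannian metric on `D`, in
the sense that it is positive definite on the tangent spaces of `D` and that its radical is
complementary to them. -/
def HasAngleAlong [IsManifold 𝓘(ℝ, Fin n → ℂ) ∞ M] (g : Tensor2 n M) (S D : Set M) (β : ℝ) : Prop :=
  ∀ q ∈ D, ∃ (U : Set M) (w : M → ℂ) (c : ℝ) (B : Tensor2 n M),
    IsOpen U ∧ q ∈ U ∧ U ⊆ S ∪ D ∧ 0 < c ∧
    ContMDiffOn 𝓘(ℝ, Fin n → ℂ) 𝓘(ℝ, ℂ) ∞ w U ∧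
    (∀ m ∈ U, Function.Surjective (diff n w m)) ∧
    (∀ m ∈ U, w m = 0 ↔ m ∈ D) ∧
    SmoothOn B U ∧
    (∀ m ∈ U, ∀ v v', B m v v' = B m v' v) ∧
    (∀ m ∈ U, m ∉ D → ∀ v v',
      g m v v' = c * flatCone (β / (2 * Real.pi)) (w m) (diff n w m v) (diff n w m v') + B m v v') ∧
    (∀ m ∈ U, m ∈ D →
      (∀ v, diff n w m v = 0 → v ≠ 0 → 0 < B m v v) ∧
      (∀ v, ∃ v', diff n w m v' = 0 ∧ ∀ v'', B m (v - v') v'' = 0))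

/-- `g` has a singularity of conical type and angle `β < 2π` along `D`. -/
def IsConicalAlong [IsManifold 𝓘(ℝ, Fin n → ℂ) ∞ M] (g : Tensor2 n M) (S D : Set M) (β : ℝ) :
    Prop :=
  0 < β ∧ β < 2 * Real.pi ∧ HasAngleAlong g S D β

/-- `g` has a singularity characterized by a large angle `β > 2π` along `D`. -/
def IsLargeAngleAlong [IsManifold 𝓘(ℝ, Fin n → ℂ) ∞ M] (g : Tensor2 n M) (S D : Set M) (β : ℝ) :
    Prop :=
  2 * Real.pi < β ∧ HasAngleAlong g S D β

/-- The metric `g`, given on `S`, extends to a smooth metric on `S ∪ D`. -/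
def IsSmoothAlong [IsManifold 𝓘(ℝ, Fin n → ℂ) ∞ M] (g : Tensor2 n M) (S D : Set M) : Prop :=
  ∃ g' : Tensor2 n M, IsMetricOn g' (S ∪ D) ∧ ∀ m ∈ S, g' m = g m

end Tensor

/-! ### The symplectic form and the metrics of symplectic potentials -/

section Metrics

open LabelledPolytope LabelledPolytope.ToricManifold

variable {n d : ℕ} {P : LabelledPolytope n d} {Λ : Submodule ℤ (Fin n → ℝ)} (hP : P.IsDelzant Λ)

/-- The symplectic form of `M`: the standard form `∑ d(Re z_j) ∧ d(Im z_j)` in the charts at the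
vertices (the tangent space at `m` is identified with `ℂⁿ` by the preferred chart at `m`). -/
def symplecticForm : Tensor2 n (ToricManifold P Λ hP) := fun m =>
  let re : Fin n → (TangentSpace 𝓘(ℝ, Fin n → ℂ) m →L[ℝ] ℝ) := fun j =>
    Complex.reCLM.comp (ContinuousLinearMap.proj (R := ℝ) (φ := fun _ : Fin n => ℂ) j)
  let im : Fin n → (TangentSpace 𝓘(ℝ, Fin n → ℂ) m →L[ℝ] ℝ) := fun j =>
    Complex.imCLM.comp (ContinuousLinearMap.proj (R := ℝ) (φ := fun _ : Fin n => ℂ) j)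
  ∑ j, ((re j).smulRight (im j) - (im j).smulRight (re j))

/-- The set of points with trivial stabilizer in `T`. -/
def freeLocus : Set (ToricManifold P Λ hP) := {m | ∀ t : Torus Λ, t +ᵥ m = m → t = 0}

/-- The preimage under the moment map of the interior of the facet `F_k`. -/
def divisor (k : Fin d) : Set (ToricManifold P Λ hP) := {m | moment m ∈ P.facetInterior k}

/-- The differential of the action-angle parametrization `P × 𝔱 → M` at `(x, θ)`. -/
def dpt (x θ : Fin n → ℝ) :
    (Fin n → ℝ) × (Fin n → ℝ) →L[ℝ] TangentSpace 𝓘(ℝ, Fin n → ℂ) (pt hP (x, θ)) :=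
  mfderiv 𝓘(ℝ, (Fin n → ℝ) × (Fin n → ℝ)) 𝓘(ℝ, Fin n → ℂ) (pt hP) (x, θ)

/-- The coframe `(dx, dθ)` of the action-angle coordinates at `m`: the inverse of the differential of
the action-angle parametrization. -/
def coframe (m : ToricManifold P Λ hP) :
    TangentSpace 𝓘(ℝ, Fin n → ℂ) m →L[ℝ] (Fin n → ℝ) × (Fin n → ℝ) :=
  ContinuousLinearMap.inverse (M := (Fin n → ℝ) × (Fin n → ℝ))
    (M₂ := TangentSpace 𝓘(ℝ, Fin n → ℂ) m) (dpt hP (moment m) (exists_pt m).choose)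

/-- The one-form `dx_i`. -/
def dx (m : ToricManifold P Λ hP) (i : Fin n) : TangentSpace 𝓘(ℝ, Fin n → ℂ) m →L[ℝ] ℝ :=
  (ContinuousLinearMap.proj (R := ℝ) (φ := fun _ : Fin n => ℝ) i).comp
    ((ContinuousLinearMap.fst ℝ (Fin n → ℝ) (Fin n → ℝ)).comp (coframe hP m))

/-- The one-form `dθ_i`. -/
def dtheta (m : ToricManifold P Λ hP) (i : Fin n) : TangentSpace 𝓘(ℝ, Fin n → ℂ) m →L[ℝ] ℝ :=
  (ContinuousLinearMap.proj (R := ℝ) (φ := fun _ : Fin n => ℝ) i).comp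
    ((ContinuousLinearMap.snd ℝ (Fin n → ℝ) (Fin n → ℝ)).comp (coframe hP m))

/-- The Hessian matrix of `u` at `x`. -/
def hess (u : (Fin n → ℝ) → ℝ) (x : Fin n → ℝ) : Matrix (Fin n) (Fin n) ℝ :=
  Matrix.of fun i j =>
    fderiv ℝ (fun y => fderiv ℝ u y (Pi.single j 1)) x (Pi.single i 1)

/-- The metric `g_u = ∑ G_ij dx_i ⊗ dx_j + H_ij dθ_i ⊗ dθ_j` on the part of `M` over the open
polytope, where `G = Hess u` and `H = G⁻¹`. -/
def metric (u : (Fin n → ℝ) → ℝ) : Tensor2 n (ToricManifold P Λ hP) := fun m =>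
  ∑ i, ∑ j, (hess u (moment m) i j • (dx hP m i).smulRight (dx hP m j) +
    (hess u (moment m))⁻¹ i j • (dtheta hP m i).smulRight (dtheta hP m j))

/-- `g` is invariant under the action of `T` at the points of `S`. -/
def IsInvariantOn (g : Tensor2 n (ToricManifold P Λ hP)) (S : Set (ToricManifold P Λ hP)) : Prop :=
  ∀ t : Torus Λ, ∀ m ∈ S, ∀ v w,
    g (t +ᵥ m)
      (mfderiv 𝓘(ℝ, Fin n → ℂ) 𝓘(ℝ, Fin n → ℂ) (fun m' : ToricManifold P Λ hP => t +ᵥ m') m v)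
      (mfderiv 𝓘(ℝ, Fin n → ℂ) 𝓘(ℝ, Fin n → ℂ) (fun m' : ToricManifold P Λ hP => t +ᵥ m') m w) =
    g m v w

end Metrics

end Toric

end

/-!
In the coordinates `L_j` at a vertex, the Hessian of the symplectic potential near the `i`-th facet
is the matrix with the single entry `(2 a L_i)⁻¹` at `(i, i)` plus a matrix smooth across the facet.
Hence its inverse is smooth across the facet too; its `i`-th row and column vanish there, and its
diagonal entry is `2 a L_i + O(L_i²)`. Since `L_i = |z_i|² / 2` in the chart `z` at the vertex, the
metric is `a⁻¹` times the flat cone `dr² + a² r² dφ²`, `z_i = r exp (√-1 φ)`, plus a tensor that is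
smooth across the facet and positive definite along it. The flat cone extends over its tip only for
`a = 1`. On the free locus, the functions `exp (∂u/∂L_j + √-1 θ_j)` are holomorphic coordinates,
which makes the metric Kähler.
-/

noncomputable section

namespace Toric

open LabelledPolytope LabelledPolytope.ToricManifold Topology

section LinearAlgebra

variable {𝕜 ι E F : Type*} [Fintype ι] [NontriviallyNormedField 𝕜]
  [NormedAddCommGroup E] [NormedSpace 𝕜 E] [NormedAddCommGroup F] [NormedSpace 𝕜 F]

lemma isInvertible_of_injective [CompleteSpace 𝕜] [FiniteDimensional 𝕜 E] [FiniteDimensional 𝕜 F]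
    (h : Module.finrank 𝕜 E = Module.finrank 𝕜 F) {D : E →L[𝕜] F} (hD : Function.Injective D) :
    D.IsInvertible :=
  ⟨(LinearEquiv.ofInjectiveOfFinrankEq D.toLinearMap hD h).toContinuousLinearEquiv, rfl⟩

variable {k : WithTop ℕ∞} {A B : E → Matrix ι ι 𝕜} {T : Set E}

lemma contDiffOn_matrix_mul (hA : ∀ i j, ContDiffOn 𝕜 k (fun x => A x i j) T)
    (hB : ∀ i j, ContDiffOn 𝕜 k (fun x => B x i j) T) (i j : ι) :
    ContDiffOn 𝕜 k (fun x => (A x * B x) i j) T := by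
  simp only [Matrix.mul_apply]
  exact ContDiffOn.sum fun l _ => (hA i l).mul (hB l j)

variable [DecidableEq ι]

lemma contDiffOn_matrix_det (hA : ∀ i j, ContDiffOn 𝕜 k (fun x => A x i j) T) :
    ContDiffOn 𝕜 k (fun x => (A x).det) T := by
  simp only [Matrix.det_apply']
  exact ContDiffOn.sum fun σ _ => contDiffOn_const.mul (contDiffOn_prod fun i _ => hA _ _)

lemma contDiffOn_matrix_inv (hA : ∀ i j, ContDiffOn 𝕜 k (fun x => A x i j) T)
    (hdet : ∀ x ∈ T, (A x).det ≠ 0) (i j : ι) : ContDiffOn 𝕜 k (fun x => (A x)⁻¹ i j) T := by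
  simp only [Matrix.inv_def, Matrix.smul_apply, smul_eq_mul, Ring.inverse_eq_inv',
    Matrix.adjugate_apply]
  refine ((contDiffOn_matrix_det hA).inv hdet).mul (contDiffOn_matrix_det fun l m => ?_)
  simp only [Matrix.updateRow_apply]
  split_ifs
  · exact contDiffOn_const
  · exact hA l m

end LinearAlgebra

/-! ### Inverses of matrices with one singular entry -/

section SingularEntry

variable {𝕜 ι : Type*} [Fintype ι] [DecidableEq ι]

/-- The matrix `K + t⁻¹ e_i e_iᵀ` with row `i` multiplied by `t`, an expression that is regular at
`t = 0`. -/
def regularized [CommRing 𝕜] (i : ι) (t : 𝕜) (K : Matrix ι ι 𝕜) : Matrix ι ι 𝕜 :=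
  K.updateRow i (Pi.single i 1 + t • K i)

/-- The remainder `(K + t⁻¹ e_i e_iᵀ)⁻¹ - t e_i e_iᵀ`, with row `i` and column `i` divided by `t`;
it is regular at `t = 0`. -/
def regularInverse [CommRing 𝕜] (i : ι) (t : 𝕜) (K : Matrix ι ι 𝕜) : Matrix ι ι 𝕜 :=
  ((regularized i t K)⁻¹).updateRow i (-(K * (regularized i t K)⁻¹) i)

section Field

variable [Field 𝕜] {i : ι} {t : 𝕜} {K : Matrix ι ι 𝕜}

lemma regularized_eq_diagonal_mul (ht : t ≠ 0) :
    regularized i t K =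
      Matrix.diagonal (Function.update 1 i t) * (Matrix.single i i t⁻¹ + K) := by
  ext j l
  rw [Matrix.diagonal_mul, regularized, Matrix.updateRow_apply, Matrix.add_apply]
  obtain rfl | hj := eq_or_ne j i
  · obtain rfl | hl := eq_or_ne l j
    · simp [mul_add, ht]
    · simp [hl, hl.symm]
  · simp [hj, hj.symm]

lemma det_regularized_ne_zero (ht : t ≠ 0) (h : (Matrix.single i i t⁻¹ + K).det ≠ 0) :
    (regularized i t K).det ≠ 0 := by
  rw [regularized_eq_diagonal_mul ht, Matrix.det_mul, Matrix.det_diagonal,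
    Finset.prod_update_of_mem (Finset.mem_univ i)]
  simpa using ⟨ht, h⟩

lemma regularized_inv_apply_self (h : (regularized i t K).det ≠ 0) (l : ι) :
    (regularized i t K)⁻¹ i l =
      (1 : Matrix ι ι 𝕜) i l - t * (K * (regularized i t K)⁻¹) i l := by
  have hmul := congrFun₂ (Matrix.mul_nonsing_inv _ (isUnit_iff_ne_zero.2 h)) i l
  set S := (regularized i t K)⁻¹
  simp only [Matrix.mul_apply, regularized, Matrix.updateRow_self, Pi.add_apply, Pi.smul_apply,
    smul_eq_mul, add_mul, Finset.sum_add_distrib] at hmul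
  rw [← hmul, Matrix.mul_apply, Finset.mul_sum]
  simp [Pi.single_apply, mul_assoc]

lemma inv_single_add_eq (ht : t ≠ 0) (h : (Matrix.single i i t⁻¹ + K).det ≠ 0) :
    (Matrix.single i i t⁻¹ + K)⁻¹ = Matrix.single i i t +
      Matrix.of fun j l => regularInverse i t K j l * (Function.update 1 i t : ι → 𝕜) j *
        (Function.update 1 i t : ι → 𝕜) l := by
  have hR := det_regularized_ne_zero ht h
  have hinv : (Matrix.single i i t⁻¹ + K)⁻¹ =
      (regularized i t K)⁻¹ * Matrix.diagonal (Function.update 1 i t) := by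
    refine Matrix.inv_eq_left_inv ?_
    rw [Matrix.mul_assoc, ← regularized_eq_diagonal_mul ht,
      Matrix.nonsing_inv_mul _ (isUnit_iff_ne_zero.2 hR)]
  rw [hinv]
  ext j l
  rw [Matrix.mul_diagonal, Matrix.add_apply, Matrix.of_apply, regularInverse,
    Matrix.updateRow_apply]
  obtain rfl | hj := eq_or_ne j i
  · rw [regularized_inv_apply_self hR]
    obtain rfl | hl := eq_or_ne l j
    · simp only [Matrix.one_apply_eq, Function.update_self, Matrix.single_apply_same, if_true,
        Pi.neg_apply]
      ring
    · simp only [ne_eq, hl.symm, not_false_eq_true, Matrix.one_apply_ne, hl, Function.update_of_ne,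
        Pi.one_apply, and_false, Matrix.single_apply_of_ne, if_true, Pi.neg_apply,
        Function.update_self]
      ring
  · simp [hj, hj.symm]

lemma regularInverse_isSymm (hK : K.IsSymm) (h : (regularized i t K).det ≠ 0) :
    (regularInverse i t K).IsSymm := by
  set R := regularized i t K with hR
  set N := (1 : Matrix ι ι 𝕜).updateRow i (-K i) with hN
  have hreg : regularInverse i t K = N * R⁻¹ := by
    rw [hN, Matrix.updateRow_mul, one_mul, Matrix.neg_vecMul]
    rfl
  have hRN : ∀ j l, (Rᵀ * N) j l = K l j - (1 : Matrix ι ι 𝕜) i l * K i j -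
      (1 : Matrix ι ι 𝕜) i j * K i l - t * K i j * K i l := by
    intro j l
    simp only [Matrix.mul_apply, Matrix.transpose_apply, hR, hN, regularized,
      Matrix.updateRow_apply]
    obtain rfl | hl := eq_or_ne l i
    · rw [Fintype.sum_eq_single l fun m hm => by simp [hm]]
      simp only [Matrix.one_apply, Pi.single_apply, if_pos, Pi.add_apply, Pi.smul_apply,
        Pi.neg_apply, smul_eq_mul, eq_comm]
      split_ifs <;> ring
    · rw [Fintype.sum_eq_add i l hl.symm fun m hm => by simp [hm.1, hm.2]]
      simp only [Matrix.one_apply, Pi.single_apply, if_pos, if_neg hl.symm,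
        Pi.add_apply, Pi.smul_apply, Pi.neg_apply, smul_eq_mul, eq_comm]
      split_ifs <;> ring
  have hsymm : (Rᵀ * N).IsSymm := Matrix.IsSymm.ext fun j l => by
    rw [hRN, hRN, hK.apply]
    ring
  have hNR : N * R⁻¹ = R⁻¹ᵀ * (Rᵀ * N) * R⁻¹ := by
    rw [← Matrix.mul_assoc, ← Matrix.transpose_mul,
      Matrix.mul_nonsing_inv _ (isUnit_iff_ne_zero.2 h), Matrix.transpose_one, Matrix.one_mul]
  rw [hreg, hNR, Matrix.IsSymm, Matrix.transpose_mul, Matrix.transpose_mul, hsymm.eq,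
    Matrix.transpose_transpose, Matrix.mul_assoc R⁻¹ᵀ]

lemma regularized_zero_mulVec (ξ : ι → 𝕜) :
    regularized i 0 K *ᵥ ξ = Function.update (K *ᵥ ξ) i (ξ i) := by
  ext j
  obtain rfl | hj := eq_or_ne j i <;> simp [Matrix.mulVec, regularized, *]

/-- As `v i = 0`, row `i` of the matrices does not enter the pairing with `v`; in the other rows
`regularized i 0 K` agrees with `K`. -/
lemma dotProduct_regularized_zero_mulVec {v : ι → 𝕜} (hv : v i = 0) (w : ι → 𝕜) :
    v ⬝ᵥ regularized i 0 K *ᵥ w = v ⬝ᵥ K *ᵥ w := by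
  rw [regularized_zero_mulVec]
  refine Finset.sum_congr rfl fun j _ => ?_
  obtain rfl | hj := eq_or_ne j i <;> simp [*]

lemma dotProduct_regularInverse_mulVec {v : ι → 𝕜} (hv : v i = 0) (w : ι → 𝕜) :
    v ⬝ᵥ regularInverse i t K *ᵥ w = v ⬝ᵥ (regularized i t K)⁻¹ *ᵥ w := by
  refine Finset.sum_congr rfl fun j _ => ?_
  obtain rfl | hj := eq_or_ne j i <;> simp [Matrix.mulVec, regularInverse, *]

end Field

section Positivity

variable [Field 𝕜] [PartialOrder 𝕜] {i : ι} {K : Matrix ι ι 𝕜}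

lemma det_regularized_zero_ne_zero (hK : ∀ ξ : ι → 𝕜, ξ ≠ 0 → ξ i = 0 → 0 < ξ ⬝ᵥ K *ᵥ ξ) :
    (regularized i 0 K).det ≠ 0 := by
  intro hdet
  obtain ⟨ξ, hξ, hker⟩ := Matrix.exists_mulVec_eq_zero_iff.2 hdet
  have hi : ξ i = 0 := by simpa [regularized_zero_mulVec] using congrFun hker i
  have hzero : ξ ⬝ᵥ K *ᵥ ξ = 0 := by
    rw [← dotProduct_regularized_zero_mulVec hi, hker, dotProduct_zero]
  exact (hK ξ hξ hi).ne' hzero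

lemma regularInverse_zero_pos (hK : ∀ ξ : ι → 𝕜, ξ ≠ 0 → ξ i = 0 → 0 < ξ ⬝ᵥ K *ᵥ ξ)
    {ψ : ι → 𝕜} (hψ : ψ ≠ 0) (hi : ψ i = 0) : 0 < ψ ⬝ᵥ regularInverse i 0 K *ᵥ ψ := by
  set ξ := (regularized i 0 K)⁻¹ *ᵥ ψ with hξ
  have hψξ : regularized i 0 K *ᵥ ξ = ψ := by
    rw [hξ, Matrix.mulVec_mulVec, Matrix.mul_nonsing_inv _
      (isUnit_iff_ne_zero.2 (det_regularized_zero_ne_zero hK)), Matrix.one_mulVec]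
  have hξ0 : ξ ≠ 0 := by
    rintro h
    exact hψ (by rw [← hψξ, h, Matrix.mulVec_zero])
  have hξi : ξ i = 0 := by
    rw [← hi, ← hψξ, regularized_zero_mulVec, Function.update_self]
  rw [dotProduct_regularInverse_mulVec hi, ← hξ]
  nth_rw 1 [← hψξ]
  rw [dotProduct_comm, dotProduct_regularized_zero_mulVec hξi]
  exact hK ξ hξ0 hξi

end Positivity

lemma contDiffOn_regularInverse {E : Type*} [NontriviallyNormedField 𝕜] [NormedAddCommGroup E]
    [NormedSpace 𝕜 E] {k : WithTop ℕ∞} {T : Set E} {i : ι} {t : E → 𝕜} {K : E → Matrix ι ι 𝕜}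
    (ht : ContDiffOn 𝕜 k t T) (hK : ∀ j l, ContDiffOn 𝕜 k (fun x => K x j l) T)
    (hdet : ∀ x ∈ T, (regularized i (t x) (K x)).det ≠ 0) (j l : ι) :
    ContDiffOn 𝕜 k (fun x => regularInverse i (t x) (K x) j l) T := by
  have hR : ∀ j l, ContDiffOn 𝕜 k (fun x => regularized i (t x) (K x) j l) T := by
    intro j l
    simp only [regularized, Matrix.updateRow_apply]
    split_ifs
    · exact contDiffOn_const.add (ht.mul (hK i l))
    · exact hK j l
  have hS := contDiffOn_matrix_inv hR hdet
  simp only [regularInverse, Matrix.updateRow_apply]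
  split_ifs
  · exact (contDiffOn_matrix_mul hK hS i l).neg
  · exact hS j l

end SingularEntry

/-! ### Calculus -/

section Calculus

variable {E : Type*} [NormedAddCommGroup E] [NormedSpace ℝ E]

lemma hasFDerivAt_cexp_add_mul_I {r τ : E → ℝ} {r' τ' : E →L[ℝ] ℝ} {x : E}
    (hr : HasFDerivAt r r' x) (hτ : HasFDerivAt τ τ' x) :
    HasFDerivAt (fun y => Complex.exp (r y + τ y * Complex.I))
      (Complex.exp (r x + τ x * Complex.I) •
        (r'.smulRight (1 : ℂ) + τ'.smulRight Complex.I)) x := by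
  have hr' : HasFDerivAt (fun y => (r y : ℂ)) (r'.smulRight (1 : ℂ)) x := by
    simpa using hr.smul_const (1 : ℂ)
  have hτ' : HasFDerivAt (fun y => (τ y : ℂ) * Complex.I) (τ'.smulRight Complex.I) x := by
    simpa using hτ.smul_const Complex.I
  exact (hr'.add hτ').cexp

end Calculus

section Hessian

variable {n : ℕ} {f g : (Fin n → ℝ) → ℝ} {x : Fin n → ℝ}

lemma differentiableAt_fderiv (hf : ContDiffAt ℝ 2 f x) : DifferentiableAt ℝ (fderiv ℝ f) x :=
  (hf.fderiv_right (m := 1) one_add_one_eq_two.le).differentiableAt one_ne_zero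

lemma eventually_differentiableAt (hf : ContDiffAt ℝ 2 f x) :
    ∀ᶠ y in 𝓝 x, DifferentiableAt ℝ f y :=
  (hf.eventually (by simp)).mono fun _ hy => hy.differentiableAt two_ne_zero

lemma hess_apply (hf : ContDiffAt ℝ 2 f x) (i j : Fin n) :
    hess f x i j = fderiv ℝ (fderiv ℝ f) x (Pi.single i 1) (Pi.single j 1) := by
  simp only [hess, Matrix.of_apply]
  rw [((differentiableAt_fderiv hf).hasFDerivAt.clm_apply
    (hasFDerivAt_const (Pi.single j (1 : ℝ)) x)).fderiv]
  simp

lemma hess_isSymm (hf : ContDiffAt ℝ 2 f x) : (hess f x).IsSymm := by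
  ext i j
  rw [Matrix.transpose_apply, hess_apply hf, hess_apply hf]
  exact (hf.isSymmSndFDerivAt (by simp)).eq _ _

lemma dotProduct_hess_mulVec (hf : ContDiffAt ℝ 2 f x) (v w : Fin n → ℝ) :
    v ⬝ᵥ hess f x *ᵥ w = fderiv ℝ (fderiv ℝ f) x v w := by
  conv_rhs => rw [pi_eq_sum_univ' v, pi_eq_sum_univ' w]
  simp only [map_sum, map_smul, sum_apply, smul_apply, ← hess_apply hf, dotProduct, Matrix.mulVec,
    smul_eq_mul, Finset.mul_sum]
  rw [Finset.sum_comm]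
  exact Finset.sum_congr rfl fun i _ => Finset.sum_congr rfl fun j _ => by ring

lemma iteratedDeriv_two_line (hf : ContDiffAt ℝ 2 f x) (v : Fin n → ℝ) :
    iteratedDeriv 2 (fun t : ℝ => f (x + t • v)) 0 = v ⬝ᵥ hess f x *ᵥ v := by
  have hline : ∀ t : ℝ, HasDerivAt (fun t : ℝ => x + t • v) v t := fun t => by
    simpa using ((hasDerivAt_id t).smul_const v).const_add x
  have hx0 : x = x + (0 : ℝ) • v := by simp
  have hfirst : deriv (fun t : ℝ => f (x + t • v)) =ᶠ[𝓝 0] fun t => fderiv ℝ f (x + t • v) v := by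
    have hev := (hline 0).continuousAt.eventually (hx0 ▸ eventually_differentiableAt hf)
    filter_upwards [hev] with t ht
    exact (ht.hasFDerivAt.comp_hasDerivAt t (hline t)).deriv
  have hsecond : HasDerivAt (fun t : ℝ => fderiv ℝ f (x + t • v))
      (fderiv ℝ (fderiv ℝ f) (x + (0 : ℝ) • v) v) 0 :=
    (hx0 ▸ differentiableAt_fderiv hf).hasFDerivAt.comp_hasDerivAt 0 (hline 0)
  have happly : HasDerivAt (fun t : ℝ => fderiv ℝ f (x + t • v) v)
      (fderiv ℝ (fderiv ℝ f) (x + (0 : ℝ) • v) v v) 0 :=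
    (ContinuousLinearMap.apply ℝ ℝ v).hasFDerivAt.comp_hasDerivAt 0 hsecond
  rw [iteratedDeriv_succ, iteratedDeriv_one, hfirst.deriv_eq, dotProduct_hess_mulVec hf,
    happly.deriv, ← hx0]

lemma hess_add (hf : ContDiffAt ℝ 2 f x) (hg : ContDiffAt ℝ 2 g x) :
    hess (fun y => f y + g y) x = hess f x + hess g x := by
  have hev : fderiv ℝ (fun y => f y + g y) =ᶠ[𝓝 x] fun y => fderiv ℝ f y + fderiv ℝ g y := by
    filter_upwards [eventually_differentiableAt hf, eventually_differentiableAt hg] with y h₁ h₂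
    exact fderiv_fun_add h₁ h₂
  ext i j
  rw [Matrix.add_apply, hess_apply (hf.add hg), hess_apply hf, hess_apply hg, hev.fderiv_eq,
    fderiv_fun_add (differentiableAt_fderiv hf) (differentiableAt_fderiv hg)]
  rfl

lemma hess_congr (h : f =ᶠ[𝓝 x] g) : hess f x = hess g x := by
  ext i j
  have hfderiv : (fun y => fderiv ℝ f y (Pi.single j 1)) =ᶠ[𝓝 x]
      fun y => fderiv ℝ g y (Pi.single j 1) :=
    h.fderiv.fun_comp fun L => L (Pi.single j 1)
  simp only [hess, Matrix.of_apply, hfderiv.fderiv_eq]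

lemma contDiffOn_hess {W : Set (Fin n → ℝ)} (hW : IsOpen W) (hf : ContDiffOn ℝ ∞ f W)
    (i j : Fin n) : ContDiffOn ℝ ∞ (fun y => hess f y i j) W := by
  have hfderiv : ∀ {f : (Fin n → ℝ) → ℝ} (v : Fin n → ℝ), ContDiffOn ℝ ∞ f W →
      ContDiffOn ℝ ∞ (fun y => fderiv ℝ f y v) W := fun v hf =>
    (hf.fderiv_of_isOpen hW (by simp)).clm_apply contDiffOn_const
  exact hfderiv _ (hfderiv _ hf)

end Hessian

section FlatCone

lemma flatCone_one {z : ℂ} (hz : z ≠ 0) (ζ ζ' : ℂ) : flatCone 1 z ζ ζ' = inner ℝ ζ ζ' := by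
  have hnorm : z.re * z.re + z.im * z.im ≠ 0 := by
    simpa [Complex.normSq_apply] using (Complex.normSq_pos.2 hz).ne'
  rw [flatCone, ← Complex.normSq_eq_norm_sq, Complex.normSq_apply, div_eq_iff hnorm,
    Complex.inner]
  simp only [Complex.mul_re, Complex.mul_im, Complex.conj_re, Complex.conj_im]
  ring

lemma flatCone_ofReal_mul (a : ℝ) {s : ℝ} (hs : s ≠ 0) (z ζ ζ' : ℂ) :
    flatCone a (s * z) ζ ζ' = flatCone a z ζ ζ' := by
  simp only [flatCone, map_mul, Complex.conj_ofReal, mul_assoc, Complex.re_ofReal_mul,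
    Complex.im_ofReal_mul, norm_mul, Complex.norm_real, mul_pow, Real.norm_eq_abs, sq_abs]
  rw [← mul_div_mul_left _ (‖z‖ ^ 2) (pow_ne_zero 2 hs)]
  ring

lemma tendsto_flatCone {α : Type*} {l : Filter α} {f h : α → ℂ} {z ζ : ℂ} (a : ℝ) (hz : z ≠ 0)
    (hf : Filter.Tendsto f l (nhds z)) (hh : Filter.Tendsto h l (nhds ζ)) :
    Filter.Tendsto (fun x => flatCone a (f x) (h x) (h x)) l (nhds (flatCone a z ζ ζ)) := by
  have hconj : Filter.Tendsto (fun x => starRingEnd ℂ (f x) * h x) l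
      (nhds (starRingEnd ℂ z * ζ)) := ((Complex.continuous_conj.tendsto z).comp hf).mul hh
  have hre := (Complex.continuous_re.tendsto _).comp hconj
  have him := (Complex.continuous_im.tendsto _).comp hconj
  exact ((hre.mul hre).add ((him.mul him).const_mul _)).div (hf.norm.pow 2) (by simpa)

end FlatCone

/-! ### Smooth tensor fields -/

section TensorFields

open Bundle

lemma contMDiffAt_of_clm_apply {𝕜 E₀ H M E F : Type*} [NontriviallyNormedField 𝕜]
    [CompleteSpace 𝕜] [NormedAddCommGroup E₀] [NormedSpace 𝕜 E₀] [TopologicalSpace H]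
    {I : ModelWithCorners 𝕜 E₀ H} [TopologicalSpace M] [ChartedSpace H M] [NormedAddCommGroup E]
    [NormedSpace 𝕜 E] [FiniteDimensional 𝕜 E] [NormedAddCommGroup F] [NormedSpace 𝕜 F]
    {k : WithTop ℕ∞} {f : M → E →L[𝕜] F} {m₀ : M}
    (hf : ∀ v, ContMDiffAt I 𝓘(𝕜, F) k (fun m => f m v) m₀) :
    ContMDiffAt I 𝓘(𝕜, E →L[𝕜] F) k f m₀ := by
  let b := Module.finBasis 𝕜 E
  have hsum : f = fun m => ∑ i, ContinuousLinearMap.smulRightL 𝕜 E F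
      (LinearMap.toContinuousLinearMap (b.coord i)) (f m (b i)) := by
    ext m v
    conv_lhs => rw [← b.sum_repr v, map_sum]
    simp
  rw [hsum]
  exact contMDiffAt_finsetSum fun i _ =>
    (ContinuousLinearMap.contMDiff _).contMDiffAt.comp m₀ (hf (b i))

lemma eventually_mem_chartAt_source (H : Type*) [TopologicalSpace H] {M : Type*}
    [TopologicalSpace M] [ChartedSpace H M] (m₀ : M) :
    ∀ᶠ m in 𝓝 m₀, m ∈ (chartAt H m₀).source :=
  (chartAt H m₀).open_source.mem_nhds (mem_chart_source _ m₀)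

variable {n : ℕ} {M : Type*} [TopologicalSpace M] [ChartedSpace (Fin n → ℂ) M]
  [IsManifold 𝓘(ℝ, Fin n → ℂ) ∞ M]

variable (n) in
/-- The frame at `m` of the local trivialization of the tangent bundle at `m₀`, as a map from the
model space to the tangent space. It is only meaningful for `m` in the preferred chart at `m₀`. -/
def frame (m₀ m : M) : (Fin n → ℂ) →L[ℝ] TangentSpace 𝓘(ℝ, Fin n → ℂ) m :=
  (trivializationAt (Fin n → ℂ) (TangentSpace 𝓘(ℝ, Fin n → ℂ)) m₀).symmL ℝ m

lemma frame_self (m : M) : frame n m m = ContinuousLinearMap.id ℝ _ := by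
  have : IsManifold 𝓘(ℝ, Fin n → ℂ) 1 M := .of_le (n := ∞) (by simp)
  rw [frame, TangentBundle.symmL_trivializationAt (by simp), mfderivWithin_range_extChartAt_symm]
  rfl

lemma contMDiffAt_diff_frame {W : Type*} [NormedAddCommGroup W] [NormedSpace ℝ W] {f : M → W}
    {m₀ : M} (hf : ContMDiffAt 𝓘(ℝ, Fin n → ℂ) 𝓘(ℝ, W) ∞ f m₀) (v : Fin n → ℂ) :
    ContMDiffAt 𝓘(ℝ, Fin n → ℂ) 𝓘(ℝ, W) ∞ (fun m => diff n f m (frame n m₀ m v)) m₀ := by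
  have : IsManifold 𝓘(ℝ, Fin n → ℂ) 1 M := .of_le (n := ∞) (by simp)
  refine ((hf.mfderiv_const (m := ∞) (by simp)).clm_apply
    (contMDiffAt_const (c := v))).congr_of_eventuallyEq ?_
  filter_upwards [eventually_mem_chartAt_source (Fin n → ℂ) m₀] with m hm
  have hcoord := inTangentCoordinates_eq_mfderiv_comp (I := 𝓘(ℝ, Fin n → ℂ)) (I' := 𝓘(ℝ, W))
    (f := id) (g := f) (ϕ := diff n f) (x₀ := m₀) (x := m) hm
    (by rw [chartAt_self_eq]; exact Set.mem_univ _)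
  have hid : mfderiv 𝓘(ℝ, W) 𝓘(ℝ, W) (extChartAt 𝓘(ℝ, W) (f m₀)) (f m) =
      ContinuousLinearMap.id ℝ W := by
    rw [extChartAt_model_space_eq_id]; exact mfderiv_id
  rw [hid] at hcoord
  refine Eq.trans ?_ (DFunLike.congr_fun hcoord v).symm
  rw [frame, TangentBundle.symmL_trivializationAt hm]
  rfl

lemma inCoordinates_eventuallyEq_frame (g : Tensor2 n M) (m₀ : M) (v w : Fin n → ℂ) :
    (fun m => ContinuousLinearMap.inCoordinates (Fin n → ℂ)
      (TangentSpace 𝓘(ℝ, Fin n → ℂ)) ((Fin n → ℂ) →L[ℝ] ℝ)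
      (fun m : M => TangentSpace 𝓘(ℝ, Fin n → ℂ) m →L[ℝ] ℝ) m₀ m m₀ m (g m) v w) =ᶠ[𝓝 m₀]
      fun m => g m (frame n m₀ m v) (frame n m₀ m w) := by
  filter_upwards [eventually_mem_chartAt_source (Fin n → ℂ) m₀] with m hm
  have hbase : m ∈ (trivializationAt (Fin n → ℂ)
    (TangentSpace 𝓘(ℝ, Fin n → ℂ)) m₀).baseSet := by simpa using hm
  rw [inCoordinates_apply_eq₂ hbase hbase (by simp)]
  simp only [frame, Bundle.Trivialization.symmL_apply _ hbase]
  simp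

lemma tensor_contMDiffAt_iff {g : Tensor2 n M} {m₀ : M} :
    ContMDiffAt 𝓘(ℝ, Fin n → ℂ)
      (𝓘(ℝ, Fin n → ℂ).prod 𝓘(ℝ, (Fin n → ℂ) →L[ℝ] (Fin n → ℂ) →L[ℝ] ℝ)) ∞
      (fun m => Bundle.TotalSpace.mk' ((Fin n → ℂ) →L[ℝ] (Fin n → ℂ) →L[ℝ] ℝ) m (g m)) m₀ ↔
    ∀ v w, ContMDiffAt 𝓘(ℝ, Fin n → ℂ) 𝓘(ℝ, ℝ) ∞
      (fun m => g m (frame n m₀ m v) (frame n m₀ m w)) m₀ := by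
  rw [contMDiffAt_hom_bundle]
  constructor
  · rintro ⟨-, h⟩ v w
    exact ((h.clm_apply contMDiffAt_const).clm_apply contMDiffAt_const).congr_of_eventuallyEq
      (inCoordinates_eventuallyEq_frame g m₀ v w).symm
  · intro h
    exact ⟨contMDiffAt_id, contMDiffAt_of_clm_apply fun v => contMDiffAt_of_clm_apply fun w =>
      (h v w).congr_of_eventuallyEq (inCoordinates_eventuallyEq_frame g m₀ v w)⟩

variable {g g' : Tensor2 n M} {U : Set M}

lemma smoothOn_iff_frame (hU : IsOpen U) :
    SmoothOn g U ↔ ∀ m₀ ∈ U, ∀ v w, ContMDiffAt 𝓘(ℝ, Fin n → ℂ) 𝓘(ℝ, ℝ) ∞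
      (fun m => g m (frame n m₀ m v) (frame n m₀ m w)) m₀ := by
  refine forall₂_congr fun m₀ hm₀ => ?_
  rw [← tensor_contMDiffAt_iff]
  exact ⟨fun h => h.contMDiffAt (hU.mem_nhds hm₀), ContMDiffAt.contMDiffWithinAt⟩

lemma SmoothOn.continuousAt_frame (hg : SmoothOn g U) (hU : IsOpen U) {q : M} (hq : q ∈ U)
    (v w : Fin n → ℂ) : ContinuousAt (fun m => g m (frame n q m v) (frame n q m w)) q :=
  ((smoothOn_iff_frame hU).1 hg q hq v w).continuousAt

lemma SmoothOn.add (hU : IsOpen U) (hg : SmoothOn g U) (hg' : SmoothOn g' U) :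
    SmoothOn (fun m => g m + g' m) U :=
  (smoothOn_iff_frame hU).2 fun m hm v w =>
    ((smoothOn_iff_frame hU).1 hg m hm v w).add ((smoothOn_iff_frame hU).1 hg' m hm v w)

lemma SmoothOn.sub (hU : IsOpen U) (hg : SmoothOn g U) (hg' : SmoothOn g' U) :
    SmoothOn (fun m => g m - g' m) U :=
  (smoothOn_iff_frame hU).2 fun m hm v w =>
    ((smoothOn_iff_frame hU).1 hg m hm v w).sub ((smoothOn_iff_frame hU).1 hg' m hm v w)

lemma smoothOn_of_pullback {W : Type*} [NormedAddCommGroup W] [NormedSpace ℝ W] {f : M → W}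
    (hU : IsOpen U) (hf : ContMDiffOn 𝓘(ℝ, Fin n → ℂ) 𝓘(ℝ, W) ∞ f U)
    {β : M → W →L[ℝ] W →L[ℝ] ℝ}
    (hβ : ContMDiffOn 𝓘(ℝ, Fin n → ℂ) 𝓘(ℝ, W →L[ℝ] W →L[ℝ] ℝ) ∞ β U)
    (hg : ∀ m ∈ U, ∀ v w, g m v w = β m (diff n f m v) (diff n f m w)) : SmoothOn g U := by
  refine (smoothOn_iff_frame hU).2 fun m₀ hm₀ v w => ?_
  have hnhds := hU.mem_nhds hm₀
  have hdiff := contMDiffAt_diff_frame (hf.contMDiffAt hnhds)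
  refine (((hβ.contMDiffAt hnhds).clm_apply (hdiff v)).clm_apply
    (hdiff w)).congr_of_eventuallyEq ?_
  filter_upwards [hnhds] with m hm using hg m hm _ _

end TensorFields

/-! ### The charts at the vertices -/

section Charts

variable {n d : ℕ} {P : LabelledPolytope n d}

lemma active_eq_empty {x : Fin n → ℝ} (hx : x ∈ P.openSet) : P.active x = ∅ := by
  ext k; simp [mem_active, (hx k).ne']

lemma isOpen_openSet : IsOpen P.openSet := by
  have : P.openSet = ⋂ k, {x | 0 < P.L k x} := by ext x; simp [openSet]
  rw [this]
  exact isOpen_iInter_of_finite fun k => isOpen_lt continuous_const (continuous_L k)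

lemma exists_isVertex (P : LabelledPolytope n d) : ∃ p, P.IsVertex p :=
  (exists_vertex P.basePoint.2).imp fun _ h => h.1

variable {Λ : Submodule ℤ (Fin n → ℝ)} {hP : P.IsDelzant Λ} {p : Fin n → ℝ} (hp : P.IsVertex p)
  {m : ToricManifold P Λ hP}

lemma isOpen_chartSource {p : Fin n → ℝ} (hp : P.IsVertex p) : IsOpen (chartSource hP p) :=
  (chartHomeo hP hp).open_source

lemma chartHomeo_mem_atlas : chartHomeo hP hp ∈ atlas (Fin n → ℂ) (ToricManifold P Λ hP) := by
  change _ ∈ ⋃ (e : PartialEquiv _ _) (he : e ∈ (core P Λ hP).atlas),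
    {(core P Λ hP).openPartialHomeomorph e he}
  simp only [Set.mem_iUnion, Set.mem_singleton_iff]
  exact ⟨chart hP hp, ⟨p, hp, rfl⟩, rfl⟩

lemma contMDiffOn_chartFun : ContMDiffOn 𝓘(ℝ, Fin n → ℂ) 𝓘(ℝ, Fin n → ℂ) ∞ (chartFun hP hp)
    (chartSource hP p) :=
  contMDiffOn_of_mem_maximalAtlas
    (IsManifold.subset_maximalAtlas (chartHomeo_mem_atlas (hP := hP) hp))

lemma contMDiffAt_chartFun (hm : m ∈ chartSource hP p) :
    ContMDiffAt 𝓘(ℝ, Fin n → ℂ) 𝓘(ℝ, Fin n → ℂ) ∞ (chartFun hP hp) m :=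
  (contMDiffOn_chartFun hp).contMDiffAt ((isOpen_chartSource hp).mem_nhds hm)

lemma mdifferentiable_chartHomeo : (chartHomeo hP hp).MDifferentiable 𝓘(ℝ, Fin n → ℂ)
    𝓘(ℝ, Fin n → ℂ) := by
  have : IsManifold 𝓘(ℝ, Fin n → ℂ) 1 (ToricManifold P Λ hP) := .of_le (n := ∞) (by simp)
  exact mdifferentiable_of_mem_atlas (chartHomeo_mem_atlas hp)

lemma diff_chartFun_bijective (hm : m ∈ chartSource hP p) :
    Function.Bijective (diff n (chartFun hP hp) m) :=
  (mdifferentiable_chartHomeo (hP := hP) hp).mfderiv_bijective hm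

section Lift

variable {E H N : Type*} [NormedAddCommGroup E] [NormedSpace ℝ E] [TopologicalSpace H]
  {I : ModelWithCorners ℝ E H} [TopologicalSpace N] [ChartedSpace H N]
  {f : N → ToricManifold P Λ hP} {g : N → Fin n → ℂ} {b : N}

lemma mdifferentiableAt_of_chartFun_comp (hf : ∀ᶠ b' in 𝓝 b, f b' ∈ chartSource hP p)
    (hfg : chartFun hP hp ∘ f =ᶠ[𝓝 b] g) (hg : MDifferentiableAt I 𝓘(ℝ, Fin n → ℂ) g b) :
    MDifferentiableAt I 𝓘(ℝ, Fin n → ℂ) f b := by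
  have hgb : g b = chartHomeo hP hp (f b) := hfg.self_of_nhds.symm
  have hfsymm : f =ᶠ[𝓝 b] (chartHomeo hP hp).symm ∘ g := by
    filter_upwards [hf, hfg] with b' hb' hgb'
    rw [Function.comp_apply, ← hgb']
    exact ((chartHomeo hP hp).left_inv hb').symm
  refine MDifferentiableAt.congr_of_eventuallyEq (MDifferentiableAt.comp b
    ((mdifferentiable_chartHomeo hp).mdifferentiableAt_symm ?_) hg) hfsymm
  rw [hgb]
  exact (chartHomeo hP hp).map_source hf.self_of_nhds

lemma diff_chartFun_mfderiv (hf : ∀ᶠ b' in 𝓝 b, f b' ∈ chartSource hP p)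
    (hfg : chartFun hP hp ∘ f =ᶠ[𝓝 b] g) (hg : MDifferentiableAt I 𝓘(ℝ, Fin n → ℂ) g b)
    (v : TangentSpace I b) :
    diff n (chartFun hP hp) (f b) (mfderiv I 𝓘(ℝ, Fin n → ℂ) f b v) =
      mfderiv I 𝓘(ℝ, Fin n → ℂ) g b v := by
  have hchain := mfderiv_comp b
    ((contMDiffAt_chartFun hp hf.self_of_nhds).mdifferentiableAt (by simp))
    (mdifferentiableAt_of_chartFun_comp hp hf hfg hg)
  rw [hfg.mfderiv_eq] at hchain
  exact (DFunLike.congr_fun hchain v).symm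

end Lift

lemma diff_chartFun_vertexAt (m : ToricManifold P Λ hP) :
    diff n (chartFun hP (isVertex_vertexAt m)) m = ContinuousLinearMap.id ℝ (Fin n → ℂ) := by
  have : IsManifold 𝓘(ℝ, Fin n → ℂ) 1 (ToricManifold P Λ hP) := .of_le (n := ∞) (by simp)
  exact mfderiv_extChartAt_self (I := 𝓘(ℝ, Fin n → ℂ)) (x := m)

lemma mem_chartSource_vertexAt (m : ToricManifold P Λ hP) : m ∈ chartSource hP (vertexAt hP m) :=
  (exists_vertex (moment_mem m)).choose_spec.2

lemma chartMoment_chartFun (hm : m ∈ chartSource hP p) :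
    chartMoment hp (chartFun hP hp m) = moment m := by
  obtain ⟨θ, hθ⟩ := exists_pt m
  conv_lhs => rw [hθ]
  rw [chartFun_pt hp (moment_mem m) hm, chartMoment_coord hp (moment_mem m)]

lemma L_moment_eq (hm : m ∈ chartSource hP p) (i : Fin n) :
    P.L (vertexIdx hp i) (moment m) = 1 / 2 * ‖chartFun hP hp m i‖ ^ 2 := by
  rw [← chartMoment_chartFun hp hm, L_chartMoment]

lemma chartFun_ne_zero (hm : m ∈ chartSource hP p) {i : Fin n}
    (hi : P.L (vertexIdx hp i) (moment m) ≠ 0) : chartFun hP hp m i ≠ 0 := by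
  intro hzero
  rw [L_moment_eq hp hm, hzero] at hi
  simp at hi

lemma contMDiff_moment :
    ContMDiff 𝓘(ℝ, Fin n → ℂ) 𝓘(ℝ, Fin n → ℝ) ∞ (moment : ToricManifold P Λ hP → _) := by
  intro m
  have hm := mem_chartSource_vertexAt m
  refine ((contDiff_chartMoment (isVertex_vertexAt m)).contMDiff.contMDiffAt.comp m
    (contMDiffAt_chartFun (isVertex_vertexAt m) hm)).congr_of_eventuallyEq ?_
  filter_upwards [(isOpen_chartSource (isVertex_vertexAt m)).mem_nhds hm] with m' hm'
  exact (chartMoment_chartFun _ hm').symm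

lemma mem_chartSource_of_moment_mem_openSet (hm : moment m ∈ P.openSet) :
    m ∈ chartSource hP p := by
  change P.active _ ⊆ _
  simp [active_eq_empty hm]

lemma pt_mem_chartSource {x : Fin n → ℝ} (hx : x ∈ P.openSet) (θ : Fin n → ℝ) :
    pt hP (x, θ) ∈ chartSource hP p := by
  apply mem_chartSource_of_moment_mem_openSet
  rwa [moment_pt (closedSet_of_openSet hx)]

lemma chartFun_pt_of_mem_openSet {x : Fin n → ℝ} (hx : x ∈ P.openSet) (θ : Fin n → ℝ) :
    chartFun hP hp (pt hP (x, θ)) = coord hp x θ :=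
  chartFun_pt hp (closedSet_of_openSet hx) (by simp [active_eq_empty hx])

end Charts

/-! ### The action-angle coframe in a chart -/

section Coframe

variable {n d : ℕ} {P : LabelledPolytope n d} {p : Fin n → ℝ} (hp : P.IsVertex p)

/-- The action-angle coframe at the point with complex coordinates `z`: the pair of
`dx = ∑ Re(z̄_i dz_i) η_i^*` and `dθ = ∑ Im(z̄_i dz_i) / |z_i|² η_i`. -/
def polarCoframe (z ζ : Fin n → ℂ) : (Fin n → ℝ) × (Fin n → ℝ) :=
  ((vertexMat hp)⁻¹ *ᵥ (fun i => (starRingEnd ℂ (z i) * ζ i).re),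
    (fun i => (starRingEnd ℂ (z i) * ζ i).im / ‖z i‖ ^ 2) ᵥ* vertexMat hp)

lemma polarCoframe_self_mul {z : Fin n → ℂ} (hz : ∀ i, z i ≠ 0) (w : Fin n → ℂ) :
    polarCoframe hp z (z * w) = ((vertexMat hp)⁻¹ *ᵥ (fun i => ‖z i‖ ^ 2 * (w i).re),
      (fun i => (w i).im) ᵥ* vertexMat hp) := by
  have hnorm : ∀ i, ‖z i‖ ^ 2 ≠ 0 := fun i => pow_ne_zero 2 (norm_ne_zero_iff.2 (hz i))
  simp only [polarCoframe, Pi.mul_apply, ← mul_assoc, Complex.conj_mul', ← Complex.ofReal_pow,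
    Complex.re_ofReal_mul, Complex.im_ofReal_mul, mul_div_cancel_left₀ _ (hnorm _)]

lemma polarCoframe_mul_mul {c : Fin n → ℂ} (hc : ∀ i, ‖c i‖ = 1) (z ζ : Fin n → ℂ) :
    polarCoframe hp (c * z) (c * ζ) = polarCoframe hp z ζ := by
  have hconj : ∀ i, starRingEnd ℂ (c i * z i) * (c i * ζ i) = starRingEnd ℂ (z i) * ζ i := by
    intro i
    rw [map_mul, mul_mul_mul_comm, Complex.conj_mul', hc]
    simp
  simp only [polarCoframe, Pi.mul_apply, hconj, norm_mul, hc, one_mul]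

lemma coord_eq_exp {x : Fin n → ℝ} (hx : x ∈ P.openSet) (θ : Fin n → ℝ) (i : Fin n) :
    coord hp x θ i = Complex.exp ((Real.log (2 * P.L (vertexIdx hp i) x) / 2 : ℝ) +
      ((θ ᵥ* (vertexMat hp)⁻¹) i : ℝ) * Complex.I) := by
  have hL := hx (vertexIdx hp i)
  rw [coord, Complex.exp_add, ← Complex.ofReal_exp, Real.exp_half, Real.exp_log (by positivity)]

lemma hasFDerivAt_coord_apply {x : Fin n → ℝ} (hx : x ∈ P.openSet) (θ : Fin n → ℝ) (i : Fin n) :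
    HasFDerivAt (fun b : (Fin n → ℝ) × (Fin n → ℝ) => coord hp b.1 b.2 i)
      (coord hp x θ i •
        (((2 * P.L (vertexIdx hp i) x)⁻¹ • ((ContinuousLinearMap.proj i).comp
          ((vertexMat hp).mulVecLin.toContinuousLinearMap.comp
            (ContinuousLinearMap.fst ℝ _ _)))).smulRight (1 : ℂ) +
        ((ContinuousLinearMap.proj i).comp
          ((vertexMat hp)⁻¹.vecMulLinear.toContinuousLinearMap.comp
            (ContinuousLinearMap.snd ℝ _ _))).smulRight Complex.I)) (x, θ) := by
  set A := (ContinuousLinearMap.proj (R := ℝ) (φ := fun _ : Fin n => ℝ) i).comp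
    ((vertexMat hp).mulVecLin.toContinuousLinearMap.comp
      (ContinuousLinearMap.fst ℝ (Fin n → ℝ) (Fin n → ℝ)))
  set B := (ContinuousLinearMap.proj (R := ℝ) (φ := fun _ : Fin n => ℝ) i).comp
    ((vertexMat hp)⁻¹.vecMulLinear.toContinuousLinearMap.comp
      (ContinuousLinearMap.snd ℝ (Fin n → ℝ) (Fin n → ℝ)))
  have hL : HasFDerivAt (fun b => P.L (vertexIdx hp i) b.1) A (x, θ) := by
    refine (A.hasFDerivAt.add_const (P.const (vertexIdx hp i))).congr_of_eventuallyEq ?_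
    exact .of_forall fun b => congrArg (· + _) (dotProduct_comm _ _)
  have hlog : HasFDerivAt (fun b => Real.log (2 * P.L (vertexIdx hp i) b.1) * 2⁻¹)
      ((2 * P.L (vertexIdx hp i) x)⁻¹ • A) (x, θ) := by
    have hne : 2 * P.L (vertexIdx hp i) x ≠ 0 := by simpa using (hx _).ne'
    refine (((hL.const_mul 2).log hne).mul_const 2⁻¹).congr_fderiv ?_
    ext a <;> simp <;> ring
  have hev : (fun b : (Fin n → ℝ) × (Fin n → ℝ) => coord hp b.1 b.2 i) =ᶠ[𝓝 (x, θ)] fun b =>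
      Complex.exp ((Real.log (2 * P.L (vertexIdx hp i) b.1) / 2 : ℝ) + B b * Complex.I) := by
    filter_upwards [continuous_fst.continuousAt.eventually (isOpen_openSet.mem_nhds hx)] with b hb
    exact coord_eq_exp hp hb b.2 i
  simp only [div_eq_mul_inv] at hev
  rw [coord_eq_exp hp hx, div_eq_mul_inv]
  exact (hasFDerivAt_cexp_add_mul_I hlog B.hasFDerivAt).congr_of_eventuallyEq hev

lemma differentiableAt_coord {x : Fin n → ℝ} (hx : x ∈ P.openSet) (θ : Fin n → ℝ) :
    DifferentiableAt ℝ (fun b : (Fin n → ℝ) × (Fin n → ℝ) => coord hp b.1 b.2) (x, θ) :=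
  differentiableAt_pi.2 fun i => (hasFDerivAt_coord_apply hp hx θ i).differentiableAt

lemma fderiv_coord {x : Fin n → ℝ} (hx : x ∈ P.openSet) (θ : Fin n → ℝ)
    (a : (Fin n → ℝ) × (Fin n → ℝ)) :
    fderiv ℝ (fun b : (Fin n → ℝ) × (Fin n → ℝ) => coord hp b.1 b.2) (x, θ) a =
      coord hp x θ * fun i => (((2 * P.L (vertexIdx hp i) x)⁻¹ * (vertexMat hp *ᵥ a.1) i : ℝ) +
        ((a.2 ᵥ* (vertexMat hp)⁻¹) i : ℝ) * Complex.I) := by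
  rw [(hasFDerivAt_pi.2 (hasFDerivAt_coord_apply hp hx θ)).fderiv]
  ext i
  simp [mul_add]

lemma polarCoframe_coord {x : Fin n → ℝ} (hx : x ∈ P.openSet) (θ : Fin n → ℝ)
    (a : (Fin n → ℝ) × (Fin n → ℝ)) :
    polarCoframe hp (coord hp x θ)
      (fderiv ℝ (fun b : (Fin n → ℝ) × (Fin n → ℝ) => coord hp b.1 b.2) (x, θ) a) = a := by
  have hnorm : ∀ i, ‖coord hp x θ i‖ ^ 2 = 2 * P.L (vertexIdx hp i) x := fun i => by
    rw [norm_coord, Real.sq_sqrt (by linarith [hx (vertexIdx hp i)])]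
  have hne : ∀ i, 2 * P.L (vertexIdx hp i) x ≠ 0 := fun i => by simpa using (hx _).ne'
  have hcoord : ∀ i, coord hp x θ i ≠ 0 := fun i hi => hne i (by rw [← hnorm, hi]; simp)
  simp only [fderiv_coord hp hx, polarCoframe_self_mul hp hcoord, hnorm, Complex.add_re,
    Complex.add_im, Complex.ofReal_re, Complex.ofReal_im, Complex.re_ofReal_mul,
    Complex.im_ofReal_mul, Complex.I_re, Complex.I_im, mul_zero, mul_one, add_zero, zero_add,
    mul_inv_cancel_left₀ (hne _), Matrix.mulVec_mulVec, Matrix.vecMul_vecMul, vertexMat_inv_mul,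
    Matrix.one_mulVec, Matrix.vecMul_one]

variable {Λ : Submodule ℤ (Fin n → ℝ)} {hP : P.IsDelzant Λ}

lemma eventually_pt_mem_chartSource {x : Fin n → ℝ} (hx : x ∈ P.openSet) (θ : Fin n → ℝ) :
    ∀ᶠ b in 𝓝 (x, θ), pt hP b ∈ chartSource hP p :=
  (continuous_fst.continuousAt.eventually (isOpen_openSet.mem_nhds hx)).mono
    fun b hb => pt_mem_chartSource hb b.2

lemma chartFun_comp_pt_eventuallyEq {x : Fin n → ℝ} (hx : x ∈ P.openSet) (θ : Fin n → ℝ) :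
    chartFun hP hp ∘ pt hP =ᶠ[𝓝 (x, θ)] fun b => coord hp b.1 b.2 :=
  (continuous_fst.continuousAt.eventually (isOpen_openSet.mem_nhds hx)).mono
    fun b hb => chartFun_pt_of_mem_openSet hp hb b.2

lemma diff_chartFun_dpt {x : Fin n → ℝ} (hx : x ∈ P.openSet) (θ : Fin n → ℝ)
    (a : (Fin n → ℝ) × (Fin n → ℝ)) :
    diff n (chartFun hP hp) (pt hP (x, θ)) (dpt hP x θ a) =
      fderiv ℝ (fun b : (Fin n → ℝ) × (Fin n → ℝ) => coord hp b.1 b.2) (x, θ) a := by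
  rw [← mfderiv_eq_fderiv]
  exact diff_chartFun_mfderiv hp (eventually_pt_mem_chartSource hx θ)
    (chartFun_comp_pt_eventuallyEq hp hx θ) (differentiableAt_coord hp hx θ).mdifferentiableAt a

lemma diff_dpt {W : Type*} [NormedAddCommGroup W] [NormedSpace ℝ W] {F : ToricManifold P Λ hP → W}
    {x θ : Fin n → ℝ} (hF : MDifferentiableAt 𝓘(ℝ, Fin n → ℂ) 𝓘(ℝ, W) F (pt hP (x, θ)))
    (hx : x ∈ P.openSet) (a : (Fin n → ℝ) × (Fin n → ℝ)) :
    diff n F (pt hP (x, θ)) (dpt hP x θ a) = fderiv ℝ (F ∘ pt hP) (x, θ) a := by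
  obtain ⟨p, hp⟩ := exists_isVertex P
  have hpt : MDifferentiableAt 𝓘(ℝ, (Fin n → ℝ) × (Fin n → ℝ)) 𝓘(ℝ, Fin n → ℂ) (pt hP) (x, θ) :=
    mdifferentiableAt_of_chartFun_comp hp (eventually_pt_mem_chartSource hx θ)
      (chartFun_comp_pt_eventuallyEq hp hx θ) (differentiableAt_coord hp hx θ).mdifferentiableAt
  rw [← mfderiv_eq_fderiv]
  exact (DFunLike.congr_fun (mfderiv_comp (x, θ) hF hpt) a).symm

lemma polarCoframe_dpt {x : Fin n → ℝ} (hx : x ∈ P.openSet) (θ : Fin n → ℝ)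
    (a : (Fin n → ℝ) × (Fin n → ℝ)) :
    polarCoframe hp (chartFun hP hp (pt hP (x, θ)))
      (diff n (chartFun hP hp) (pt hP (x, θ)) (dpt hP x θ a)) = a := by
  rw [diff_chartFun_dpt hp hx, chartFun_pt_of_mem_openSet hp hx, polarCoframe_coord hp hx]

/-- Stated for the continuous linear maps between the model spaces, to which the tangent spaces are
definitionally equal. -/
lemma dpt_isInvertible {x : Fin n → ℝ} (hx : x ∈ P.openSet) (θ : Fin n → ℝ) :
    (show (Fin n → ℝ) × (Fin n → ℝ) →L[ℝ] (Fin n → ℂ) from dpt hP x θ).IsInvertible := by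
  obtain ⟨p, hp⟩ := exists_isVertex P
  refine isInvertible_of_injective (by simp [Module.finrank_pi_fintype]; ring) fun a b hab => ?_
  rw [← polarCoframe_dpt (hP := hP) hp hx θ a, ← polarCoframe_dpt (hP := hP) hp hx θ b]
  exact congrArg _ (congrArg _ hab)

variable {m : ToricManifold P Λ hP}

lemma coframe_eq (hm : moment m ∈ P.openSet) (v : TangentSpace 𝓘(ℝ, Fin n → ℂ) m) :
    coframe hP m v = polarCoframe hp (chartFun hP hp m) (diff n (chartFun hP hp) m v) := by
  let D : (Fin n → ℝ) × (Fin n → ℝ) →L[ℝ] (Fin n → ℂ) := dpt hP (moment m) (exists_pt m).choose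
  have hD : D.IsInvertible := dpt_isInvertible hm _
  have hleft : ∀ m', m' = pt hP (moment m, (exists_pt m).choose) → ∀ a,
      polarCoframe hp (chartFun hP hp m') (diff n (chartFun hP hp) m' (D a)) = a := by
    rintro _ rfl a
    exact polarCoframe_dpt hp hm _ a
  obtain ⟨a, rfl⟩ := hD.surjective v
  exact (hD.inverse_apply_self a).trans (hleft m (exists_pt m).choose_spec a).symm

lemma coframe_dpt {x : Fin n → ℝ} (hx : x ∈ P.openSet) (θ : Fin n → ℝ)
    (a : (Fin n → ℝ) × (Fin n → ℝ)) : coframe hP (pt hP (x, θ)) (dpt hP x θ a) = a := by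
  obtain ⟨p, hp⟩ := exists_isVertex P
  rw [coframe_eq hp (by rwa [moment_pt (closedSet_of_openSet hx)]), polarCoframe_dpt hp hx]

/-- Stated for the continuous linear maps between the model spaces, as for `dpt_isInvertible`. -/
lemma coframe_isInvertible (hm : moment m ∈ P.openSet) :
    (show (Fin n → ℂ) →L[ℝ] (Fin n → ℝ) × (Fin n → ℝ) from coframe hP m).IsInvertible :=
  (dpt_isInvertible hm _).inverse

lemma coframe_bijective (hm : moment m ∈ P.openSet) : Function.Bijective (coframe hP m) :=
  (coframe_isInvertible hm).bijective

end Coframe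

/-! ### The locus of trivial stabilizers -/

section FreeLocus

variable {n d : ℕ} {P : LabelledPolytope n d}

lemma normal_ne_zero (P : LabelledPolytope n d) (k : Fin d) : P.normal k ≠ 0 := by
  intro hzero
  obtain ⟨x, hx⟩ := P.nonempty'
  obtain ⟨y, hy, -⟩ := P.facet' k
  have hxk := hx k
  simp only [hzero, dotProduct_zero, zero_add] at hxk hy
  exact hxk.ne' hy

lemma L_lineMap (k : Fin d) (x y : Fin n → ℝ) (t : ℝ) :
    P.L k (AffineMap.lineMap x y t) = (1 - t) * P.L k x + t * P.L k y := by
  simp only [L, AffineMap.lineMap_apply_module, add_dotProduct, smul_dotProduct, smul_eq_mul]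
  ring

lemma lineMap_mem_openSet {x y : Fin n → ℝ} (hx : x ∈ P.closedSet) (hy : y ∈ P.openSet) {t : ℝ}
    (ht₀ : 0 < t) (ht₁ : t ≤ 1) : AffineMap.lineMap x y t ∈ P.openSet := fun k => by
  rw [L_lineMap]
  exact add_pos_of_nonneg_of_pos (mul_nonneg (sub_nonneg.2 ht₁) (hx k)) (mul_pos ht₀ (hy k))

lemma closedSet_subset_closure_openSet : P.closedSet ⊆ closure P.openSet := by
  intro x hx
  obtain ⟨y, hy⟩ := P.nonempty'
  have hlim : Filter.Tendsto (AffineMap.lineMap (k := ℝ) x y) (𝓝[>] 0) (𝓝 x) := by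
    have := (AffineMap.lineMap_continuous (R := ℝ) (p := x) (q := y)).tendsto 0
    rw [AffineMap.lineMap_apply_zero] at this
    exact this.mono_left nhdsWithin_le_nhds
  refine mem_closure_of_tendsto hlim ?_
  filter_upwards [Ioc_mem_nhdsGT one_pos] with t ht
  exact lineMap_mem_openSet hx hy ht.1 ht.2

variable {Λ : Submodule ℤ (Fin n → ℝ)} {hP : P.IsDelzant Λ} {m : ToricManifold P Λ hP}

lemma vadd_smul_normal_eq_self {k : Fin d} (hk : P.L k (moment m) = 0) (c : ℝ) :
    (QuotientAddGroup.mk (c • P.normal k) : Torus Λ) +ᵥ m = m := by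
  obtain ⟨θ, hθ⟩ := exists_pt m
  rw [hθ, mk_vadd_pt, pt_eq_pt (moment_mem m), add_sub_cancel_right]
  refine (P.mem_isotropy Λ).2 ⟨0, zero_mem _, c • P.normal k, ?_, by simp⟩
  exact Submodule.smul_mem _ _ (Submodule.subset_span ⟨k, mem_active.2 hk, rfl⟩)

lemma mk_pi_smul_normal_ne_zero (hP : P.IsDelzant Λ) {p : Fin n → ℝ} (hp : P.IsVertex p)
    (i : Fin n) : (QuotientAddGroup.mk (Real.pi • P.normal (vertexIdx hp i)) : Torus Λ) ≠ 0 := by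
  rw [Ne, QuotientAddGroup.eq_zero_iff]
  rintro ⟨l, hl, hπ : (2 * Real.pi) • l = Real.pi • P.normal (vertexIdx hp i)⟩
  obtain ⟨N, hN⟩ := int_of_mem hP hp hl i
  have htwo := congrFun (congrArg (fun y => y ᵥ* (vertexMat hp)⁻¹) hπ) i
  simp only [Matrix.smul_vecMul, Pi.smul_apply, hN, normal_vecMul_inv, Pi.single_eq_same,
    smul_eq_mul, mul_comm 2 Real.pi, mul_assoc, mul_right_inj' Real.pi_ne_zero] at htwo
  have : 2 * N = 1 := by exact_mod_cast htwo
  omega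

lemma freeLocus_eq : freeLocus hP = {m | moment m ∈ P.openSet} := by
  ext m
  constructor
  · intro hfree k
    refine (moment_mem m k).lt_of_ne' fun hk => ?_
    obtain ⟨p, hp, hpm⟩ := exists_vertex (moment_mem m)
    obtain ⟨i, rfl⟩ := (mem_active_vertex hp).1 (hpm (mem_active.2 hk))
    exact mk_pi_smul_normal_ne_zero hP hp i (hfree _ (vadd_smul_normal_eq_self hk _))
  · intro hm t ht
    obtain ⟨θ, hθ⟩ := exists_pt m
    induction t using QuotientAddGroup.induction_on with
    | H s =>
      rw [hθ, mk_vadd_pt, pt_eq_pt (moment_mem m), add_sub_cancel_right, isotropy,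
        active_eq_empty hm] at ht
      rw [QuotientAddGroup.eq_zero_iff]
      simpa using ht

lemma isOpen_freeLocus : IsOpen (freeLocus hP) := by
  rw [freeLocus_eq]
  exact isOpen_openSet.preimage continuous_moment

lemma dense_freeLocus : Dense (freeLocus hP) := by
  have hclosed : Dense {x : P.closedSet | (x : Fin n → ℝ) ∈ P.openSet} := by
    refine Subtype.dense_iff.2 fun x hx => closure_mono ?_ (closedSet_subset_closure_openSet hx)
    exact fun y hy => ⟨⟨y, closedSet_of_openSet hy⟩, hy, rfl⟩
  have hsurj : Function.Surjective (mk hP) := Quotient.exists_rep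
  refine (hsurj.denseRange.dense_image continuous_mk (hclosed.prod dense_univ)).mono ?_
  rintro _ ⟨⟨x, θ⟩, ⟨hx, -⟩, rfl⟩
  rw [freeLocus_eq]
  exact hx

end FreeLocus

/-! ### Invariance under the torus -/

section Invariance

variable {n d : ℕ} {P : LabelledPolytope n d} {Λ : Submodule ℤ (Fin n → ℝ)} {hP : P.IsDelzant Λ}
  {p : Fin n → ℝ} (hp : P.IsVertex p)

lemma moment_vadd (t : Torus Λ) (m : ToricManifold P Λ hP) : moment (t +ᵥ m) = moment m := by
  obtain ⟨θ, hθ⟩ := exists_pt m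
  induction t using QuotientAddGroup.induction_on with
  | H s =>
    conv_lhs => rw [hθ, mk_vadd_pt, moment_pt (moment_mem m)]

lemma vadd_mem_chartSource (t : Torus Λ) {m : ToricManifold P Λ hP} (hm : m ∈ chartSource hP p) :
    t +ᵥ m ∈ chartSource hP p := by
  change P.active _ ⊆ _
  rwa [moment_vadd]

/-- The phases by which `exp s ∈ T` acts on the complex coordinates at the vertex `p`. -/
def vertexPhase (s : Fin n → ℝ) (i : Fin n) : ℂ :=
  Complex.exp (((s ᵥ* (vertexMat hp)⁻¹) i : ℝ) * Complex.I)

lemma norm_vertexPhase (s : Fin n → ℝ) (i : Fin n) : ‖vertexPhase hp s i‖ = 1 :=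
  Complex.norm_exp_ofReal_mul_I _

lemma coord_add (x s θ : Fin n → ℝ) : coord hp x (s + θ) = vertexPhase hp s * coord hp x θ := by
  ext i
  simp only [coord, vertexPhase, Matrix.add_vecMul, Pi.add_apply, Pi.mul_apply, Complex.ofReal_add,
    add_mul, Complex.exp_add]
  ring

lemma chartFun_vadd (s : Fin n → ℝ) {m : ToricManifold P Λ hP} (hm : m ∈ chartSource hP p) :
    chartFun hP hp ((QuotientAddGroup.mk s : Torus Λ) +ᵥ m) =
      vertexPhase hp s * chartFun hP hp m := by
  obtain ⟨θ, hθ⟩ := exists_pt m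
  rw [hθ, mk_vadd_pt, chartFun_pt hp (moment_mem m) hm, chartFun_pt hp (moment_mem m) hm, coord_add]

lemma diff_chartFun_vadd (s : Fin n → ℝ) {m : ToricManifold P Λ hP} (hm : m ∈ chartSource hP p)
    (v : TangentSpace 𝓘(ℝ, Fin n → ℂ) m) :
    diff n (chartFun hP hp) ((QuotientAddGroup.mk s : Torus Λ) +ᵥ m)
      (mfderiv 𝓘(ℝ, Fin n → ℂ) 𝓘(ℝ, Fin n → ℂ)
        (fun m' : ToricManifold P Λ hP => (QuotientAddGroup.mk s : Torus Λ) +ᵥ m') m v) =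
      vertexPhase hp s * diff n (chartFun hP hp) m v := by
  let A : (Fin n → ℂ) →L[ℝ] (Fin n → ℂ) := ContinuousLinearMap.mul ℝ _ (vertexPhase hp s)
  have hev : ∀ᶠ m' in 𝓝 m, m' ∈ chartSource hP p := (isOpen_chartSource hp).mem_nhds hm
  have hchart := (contMDiffAt_chartFun hp hm).mdifferentiableAt (by simp)
  have hA : MDifferentiableAt 𝓘(ℝ, Fin n → ℂ) 𝓘(ℝ, Fin n → ℂ) A (chartFun hP hp m) :=
    A.differentiableAt.mdifferentiableAt
  have hcomp : mfderiv 𝓘(ℝ, Fin n → ℂ) 𝓘(ℝ, Fin n → ℂ) (A ∘ chartFun hP hp) m =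
      A.comp (diff n (chartFun hP hp) m) := by
    rw [mfderiv_comp m hA hchart, mfderiv_eq_fderiv, A.fderiv]
    rfl
  exact (diff_chartFun_mfderiv hp (hev.mono fun m' => vadd_mem_chartSource _)
    (hev.mono fun m' => chartFun_vadd hp s) (hA.comp m hchart) v).trans (DFunLike.congr_fun hcomp v)

lemma coframe_vadd (t : Torus Λ) {m : ToricManifold P Λ hP} (hm : moment m ∈ P.openSet)
    (v : TangentSpace 𝓘(ℝ, Fin n → ℂ) m) :
    coframe hP (t +ᵥ m) (mfderiv 𝓘(ℝ, Fin n → ℂ) 𝓘(ℝ, Fin n → ℂ)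
        (fun m' : ToricManifold P Λ hP => t +ᵥ m') m v) = coframe hP m v := by
  obtain ⟨p, hp⟩ := exists_isVertex P
  have hmp := mem_chartSource_of_moment_mem_openSet (p := p) hm
  induction t using QuotientAddGroup.induction_on with
  | H s =>
    rw [coframe_eq hp (by rwa [moment_vadd]), coframe_eq hp hm, diff_chartFun_vadd hp s hmp,
      chartFun_vadd hp s hmp, polarCoframe_mul_mul hp (norm_vertexPhase hp s)]

lemma metric_apply (u : (Fin n → ℝ) → ℝ) (m : ToricManifold P Λ hP)
    (v w : TangentSpace 𝓘(ℝ, Fin n → ℂ) m) :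
    metric hP u m v w =
      (coframe hP m v).1 ⬝ᵥ hess u (moment m) *ᵥ (coframe hP m w).1 +
      (coframe hP m v).2 ⬝ᵥ (hess u (moment m))⁻¹ *ᵥ (coframe hP m w).2 := by
  unfold metric
  simp only [sum_apply, add_apply, ContinuousLinearMap.smulRight_apply, smul_apply, dotProduct,
    Matrix.mulVec, Finset.mul_sum, ← Finset.sum_add_distrib, smul_eq_mul]
  refine Finset.sum_congr rfl fun i _ => Finset.sum_congr rfl fun j _ => ?_
  simp only [dx, dtheta, ContinuousLinearMap.comp_apply, ContinuousLinearMap.proj_apply,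
    ContinuousLinearMap.coe_fst', ContinuousLinearMap.coe_snd']
  ring

lemma metric_dpt (u : (Fin n → ℝ) → ℝ) {x : Fin n → ℝ} (hx : x ∈ P.openSet) (θ : Fin n → ℝ)
    (a b : (Fin n → ℝ) × (Fin n → ℝ)) :
    metric hP u (pt hP (x, θ)) (dpt hP x θ a) (dpt hP x θ b) =
      a.1 ⬝ᵥ hess u x *ᵥ b.1 + a.2 ⬝ᵥ (hess u x)⁻¹ *ᵥ b.2 := by
  rw [metric_apply, coframe_dpt hx, coframe_dpt hx, moment_pt (closedSet_of_openSet hx)]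

lemma isInvariantOn_metric (u : (Fin n → ℝ) → ℝ) :
    IsInvariantOn hP (metric hP u) (freeLocus hP) := by
  intro t m hm v w
  rw [freeLocus_eq] at hm
  rw [metric_apply, metric_apply, coframe_vadd t hm, coframe_vadd t hm, moment_vadd]

end Invariance

/-! ### The symplectic form -/

section SymplecticForm

variable (n : ℕ) in
/-- The standard symplectic form `∑ d(Re z_j) ∧ d(Im z_j)` on `ℂⁿ`. -/
def standardForm : (Fin n → ℂ) →L[ℝ] (Fin n → ℂ) →L[ℝ] ℝ :=
  let re : Fin n → ((Fin n → ℂ) →L[ℝ] ℝ) := fun j =>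
    Complex.reCLM.comp (ContinuousLinearMap.proj (R := ℝ) (φ := fun _ : Fin n => ℂ) j)
  let im : Fin n → ((Fin n → ℂ) →L[ℝ] ℝ) := fun j =>
    Complex.imCLM.comp (ContinuousLinearMap.proj (R := ℝ) (φ := fun _ : Fin n => ℂ) j)
  ∑ j, ((re j).smulRight (im j) - (im j).smulRight (re j))

lemma standardForm_apply {n : ℕ} (ζ ζ' : Fin n → ℂ) :
    standardForm n ζ ζ' = ∑ j, ((ζ j).re * (ζ' j).im - (ζ j).im * (ζ' j).re) := by
  simp [standardForm]

variable {n d : ℕ} {P : LabelledPolytope n d} {Λ : Submodule ℤ (Fin n → ℝ)} {hP : P.IsDelzant Λ}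
  {p : Fin n → ℝ} (hp : P.IsVertex p)

lemma mulVec_inv_dotProduct_vecMul (a b : Fin n → ℝ) :
    ((vertexMat hp)⁻¹ *ᵥ a) ⬝ᵥ (b ᵥ* vertexMat hp) = a ⬝ᵥ b := by
  rw [dotProduct_comm, ← Matrix.dotProduct_mulVec, Matrix.mulVec_mulVec, vertexMat_mul_inv,
    Matrix.one_mulVec, dotProduct_comm]

lemma polarCoframe_symplectic {z : Fin n → ℂ} (hz : ∀ i, z i ≠ 0) (ζ ζ' : Fin n → ℂ) :
    (polarCoframe hp z ζ).1 ⬝ᵥ (polarCoframe hp z ζ').2 -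
      (polarCoframe hp z ζ).2 ⬝ᵥ (polarCoframe hp z ζ').1 = standardForm n ζ ζ' := by
  have hmul : ∀ w w' : Fin n → ℂ, (polarCoframe hp z (z * w)).1 ⬝ᵥ (polarCoframe hp z (z * w')).2 -
      (polarCoframe hp z (z * w)).2 ⬝ᵥ (polarCoframe hp z (z * w')).1 =
        standardForm n (z * w) (z * w') := by
    intro w w'
    rw [polarCoframe_self_mul hp hz, polarCoframe_self_mul hp hz, mulVec_inv_dotProduct_vecMul,
      dotProduct_comm (_ ᵥ* _), mulVec_inv_dotProduct_vecMul, standardForm_apply, dotProduct,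
      dotProduct, ← Finset.sum_sub_distrib]
    refine Finset.sum_congr rfl fun j _ => ?_
    rw [← Complex.normSq_eq_norm_sq, Complex.normSq_apply, Pi.mul_apply, Pi.mul_apply]
    simp only [Complex.mul_re, Complex.mul_im]
    ring
  have hdiv : ∀ ζ : Fin n → ℂ, z * (ζ / z) = ζ := fun ζ => funext fun i => mul_div_cancel₀ _ (hz i)
  simpa only [hdiv] using hmul (ζ / z) (ζ' / z)

variable {m : ToricManifold P Λ hP}

lemma symplecticForm_eq_coframe (hm : moment m ∈ P.openSet)
    (v w : TangentSpace 𝓘(ℝ, Fin n → ℂ) m) :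
    symplecticForm hP m v w = (coframe hP m v).1 ⬝ᵥ (coframe hP m w).2 -
      (coframe hP m v).2 ⬝ᵥ (coframe hP m w).1 := by
  rw [coframe_eq (isVertex_vertexAt m) hm, coframe_eq (isVertex_vertexAt m) hm,
    polarCoframe_symplectic, diff_chartFun_vertexAt]
  · rfl
  · exact fun i => chartFun_ne_zero _ (mem_chartSource_vertexAt m) (hm _).ne'

lemma symplecticForm_eq_chart (hm : moment m ∈ P.openSet) (v w : TangentSpace 𝓘(ℝ, Fin n → ℂ) m) :
    symplecticForm hP m v w =
      standardForm n (diff n (chartFun hP hp) m v) (diff n (chartFun hP hp) m w) := by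
  rw [symplecticForm_eq_coframe hm, coframe_eq hp hm, coframe_eq hp hm, polarCoframe_symplectic]
  exact fun i => chartFun_ne_zero _ (mem_chartSource_of_moment_mem_openSet hm) (hm _).ne'

lemma symplecticForm_dpt {x : Fin n → ℝ} (hx : x ∈ P.openSet) (θ : Fin n → ℝ)
    (a b : (Fin n → ℝ) × (Fin n → ℝ)) :
    symplecticForm hP (pt hP (x, θ)) (dpt hP x θ a) (dpt hP x θ b) =
      a.1 ⬝ᵥ b.2 - a.2 ⬝ᵥ b.1 := by
  rw [symplecticForm_eq_coframe (by rwa [moment_pt (closedSet_of_openSet hx)]), coframe_dpt hx,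
    coframe_dpt hx]

lemma smoothOn_symplecticForm : SmoothOn (symplecticForm hP) (freeLocus hP) := by
  obtain ⟨p, hp⟩ := exists_isVertex P
  rw [freeLocus_eq]
  refine smoothOn_of_pullback (isOpen_openSet.preimage continuous_moment)
    ((contMDiffOn_chartFun hp).mono fun m hm => mem_chartSource_of_moment_mem_openSet hm)
    (contMDiffOn_const (c := standardForm n)) fun m hm => symplecticForm_eq_chart hp hm

lemma inChart_symplecticForm_eventuallyEq (hm : m ∈ freeLocus hP) (v w : Fin n → ℂ) :
    (fun y => inChart (symplecticForm hP) m y v w) =ᶠ[𝓝 (extChartAt 𝓘(ℝ, Fin n → ℂ) m m)]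
      fun _ => standardForm n v w := by
  have : IsManifold 𝓘(ℝ, Fin n → ℂ) 1 (ToricManifold P Λ hP) := .of_le (n := ∞) (by simp)
  have hfree : ∀ᶠ y in 𝓝 (extChartAt 𝓘(ℝ, Fin n → ℂ) m m),
      (extChartAt 𝓘(ℝ, Fin n → ℂ) m).symm y ∈ freeLocus hP := by
    refine (continuousAt_extChartAt_symm m).eventually ?_
    rw [extChartAt_to_inv]
    exact isOpen_freeLocus.mem_nhds hm
  filter_upwards [hfree, extChartAt_target_mem_nhds m] with y hy hyt
  rw [freeLocus_eq] at hy
  have hinv := mfderiv_extChartAt_comp_mfderivWithin_extChartAt_symm hyt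
  rw [modelWithCornersSelf_coe, Set.range_id, mfderivWithin_univ] at hinv
  rw [inChart, symplecticForm_eq_chart (isVertex_vertexAt m) hy]
  exact congrArg₂ (fun a b => standardForm n a b) (DFunLike.congr_fun hinv v)
    (DFunLike.congr_fun hinv w)

lemma isClosedFormOn_symplecticForm : IsClosedFormOn (symplecticForm hP) (freeLocus hP) := by
  intro m hm a b c
  simp only [(inChart_symplecticForm_eventuallyEq hm _ _).fderiv_eq, fderiv_const_apply,
    zero_apply, add_zero]

end SymplecticForm

/-! ### Symplectic potentials near a facet -/

section Potential

variable {n d : ℕ} {P Q : LabelledPolytope n d} {k : Fin d} {x : Fin n → ℝ}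

lemma hasFDerivAt_L (k : Fin d) (x : Fin n → ℝ) :
    HasFDerivAt (P.L k) (dotProductEquiv ℝ (Fin n) (P.normal k)).toContinuousLinearMap x := by
  have hL : P.L k = fun y =>
      (dotProductEquiv ℝ (Fin n) (P.normal k)).toContinuousLinearMap y + P.const k := by
    ext y
    simp [L, dotProduct_comm]
  rw [hL]
  exact (ContinuousLinearMap.hasFDerivAt _).add_const _

lemma hess_comp_L {φ φ' : ℝ → ℝ} {c : ℝ} (hφ : ∀ᶠ t in 𝓝 (P.L k x), HasDerivAt φ (φ' t) t)
    (hφ' : HasDerivAt φ' c (P.L k x)) :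
    hess (fun y => φ (P.L k y)) x = c • Matrix.vecMulVec (P.normal k) (P.normal k) := by
  ext i j
  have hfst : (fun y => fderiv ℝ (fun y => φ (P.L k y)) y (Pi.single j 1)) =ᶠ[𝓝 x]
      fun y => φ' (P.L k y) * P.normal k j := by
    filter_upwards [(continuous_L k).continuousAt.eventually hφ] with y hy
    have hd : fderiv ℝ (fun y => φ (P.L k y)) y = _ :=
      (hy.comp_hasFDerivAt y (hasFDerivAt_L k y)).fderiv
    rw [hd]
    simp
  have hsnd : fderiv ℝ (fun y => φ' (P.L k y) * P.normal k j) x = _ :=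
    ((hφ'.comp_hasFDerivAt x (hasFDerivAt_L k x)).mul_const (P.normal k j)).fderiv
  simp only [hess, Matrix.of_apply, hfst.fderiv_eq, hsnd]
  simp [Matrix.vecMulVec_apply]
  ring

lemma contDiffAt_mul_log (hx : 0 < P.L k x) :
    ContDiffAt ℝ ∞ (fun y => 1 / 2 * (P.L k y * Real.log (P.L k y))) x :=
  contDiffAt_const.mul ((contDiff_L k).contDiffAt.mul ((contDiff_L k).contDiffAt.log hx.ne'))

lemma hess_mul_log (hx : 0 < P.L k x) :
    hess (fun y => 1 / 2 * (P.L k y * Real.log (P.L k y))) x =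
      (1 / (2 * P.L k x)) • Matrix.vecMulVec (P.normal k) (P.normal k) := by
  refine hess_comp_L (φ := fun t => 1 / 2 * (t * Real.log t))
    (φ' := fun t => 1 / 2 * (Real.log t + 1)) ?_ ?_
  · filter_upwards [lt_mem_nhds hx] with t ht
    exact (Real.hasDerivAt_mul_log ht.ne').const_mul _
  · exact (((Real.hasDerivAt_log hx.ne').add_const 1).const_mul _).congr_deriv (by ring)

/-- The points at which all defining functions but `L_k` are positive: an open set that contains the
open polytope and the relative interior of the facet `F_k`. -/
def LabelledPolytope.facetCollar (P : LabelledPolytope n d) (k : Fin d) : Set (Fin n → ℝ) :=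
  {x | ∀ j ≠ k, 0 < P.L j x}

lemma isOpen_facetCollar (k : Fin d) : IsOpen (P.facetCollar k) := by
  simp only [facetCollar, Set.ofPred_forall]
  exact isOpen_iInter_of_finite fun j => isOpen_iInter_of_finite fun _ =>
    isOpen_lt continuous_const (continuous_L j)

lemma openSet_subset_facetCollar (k : Fin d) : P.openSet ⊆ P.facetCollar k :=
  fun _ hx j _ => hx j

lemma facetInterior_subset_facetCollar (k : Fin d) : P.facetInterior k ⊆ P.facetCollar k :=
  fun _ hx => hx.2

lemma mem_closedSet_iff_of_mem_facetCollar (hx : x ∈ P.facetCollar k) :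
    x ∈ P.closedSet ↔ 0 ≤ P.L k x := by
  refine ⟨fun h => h k, fun h j => ?_⟩
  obtain rfl | hj := eq_or_ne j k
  exacts [h, (hx j hj).le]

lemma facetInterior_subset_closedSet (k : Fin d) : P.facetInterior k ⊆ P.closedSet := fun _ hx =>
  (mem_closedSet_iff_of_mem_facetCollar (facetInterior_subset_facetCollar k hx)).2 hx.1.ge

lemma L_add_smul_eq_zero (hx : P.L k x = 0) {v : Fin n → ℝ} (hv : v ⬝ᵥ P.normal k = 0) (t : ℝ) :
    P.L k (x + t • v) = 0 := by
  rw [L_add, hx, smul_dotProduct, hv, smul_zero, add_zero]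

lemma eventually_add_smul_mem_facetInterior (hx : x ∈ P.facetInterior k) {v : Fin n → ℝ}
    (hv : v ⬝ᵥ P.normal k = 0) : ∀ᶠ t : ℝ in 𝓝 0, x + t • v ∈ P.facetInterior k := by
  have hline : ContinuousAt (fun t : ℝ => x + t • v) 0 := by fun_prop
  have hcollar : x + (0 : ℝ) • v ∈ P.facetCollar k := by
    rw [zero_smul, add_zero]
    exact facetInterior_subset_facetCollar k hx
  filter_upwards [hline.eventually_mem ((isOpen_facetCollar k).mem_nhds hcollar)] with t ht
  exact ⟨L_add_smul_eq_zero hx.1 hv t, ht⟩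

lemma exists_eq_smul_of_orthogonal_subset {ι : Type*} [Fintype ι] {v w : ι → ℝ}
    (h : ∀ ξ, ξ ⬝ᵥ v = 0 → ξ ⬝ᵥ w = 0) : ∃ c : ℝ, c • v = w := by
  classical
  have hspan : dotProductEquiv ℝ ι w ∈
      Submodule.span ℝ (Set.range fun _ : Unit => dotProductEquiv ℝ ι v) := by
    refine mem_span_of_iInf_ker_le_ker fun ξ hξ => ?_
    simpa [dotProduct_comm] using h ξ (by simpa [dotProduct_comm] using hξ)
  rw [Set.range_const, Submodule.mem_span_singleton] at hspan
  obtain ⟨c, hc⟩ := hspan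
  exact ⟨c, (dotProductEquiv ℝ ι).injective (by rw [map_smul, hc])⟩

namespace LabelledPolytope.SamePolytope

lemma symm (h : P.SamePolytope Q) : Q.SamePolytope P :=
  ⟨h.openSet_eq.symm, fun k => (h.facet_eq k).symm⟩

lemma L_eq_zero (h : P.SamePolytope Q) (hx : x ∈ P.facetInterior k) : Q.L k x = 0 := by
  have hmem : x ∈ P.facet k := ⟨facetInterior_subset_closedSet k hx, hx.1⟩
  rw [← h.facet_eq] at hmem
  exact hmem.2

lemma dotProduct_normal_eq_zero (h : P.SamePolytope Q) {v : Fin n → ℝ}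
    (hv : v ⬝ᵥ P.normal k = 0) : v ⬝ᵥ Q.normal k = 0 := by
  obtain ⟨x, hx⟩ : (P.facetInterior k).Nonempty := P.facet' k
  obtain ⟨t, hmem, ht⟩ := ((eventually_add_smul_mem_facetInterior hx hv).filter_mono
    nhdsWithin_le_nhds |>.and self_mem_nhdsWithin : ∀ᶠ t : ℝ in 𝓝[≠] 0, _).exists
  have hQ := h.L_eq_zero hmem
  rw [L_add, h.L_eq_zero hx, zero_add, smul_dotProduct, smul_eq_mul] at hQ
  exact (mul_eq_zero.1 hQ).resolve_left ht

lemma exists_smul_normal_eq (h : P.SamePolytope Q) (k : Fin d) :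
    ∃ a : ℝ, a • Q.normal k = P.normal k :=
  exists_eq_smul_of_orthogonal_subset fun _ => h.symm.dotProduct_normal_eq_zero

variable {a : ℝ}

lemma L_eq_mul_of_smul_normal_eq (h : P.SamePolytope Q) (ha : a • Q.normal k = P.normal k)
    (x : Fin n → ℝ) : P.L k x = a * Q.L k x := by
  obtain ⟨x₀, hx₀⟩ : (P.facetInterior k).Nonempty := P.facet' k
  rw [← add_sub_cancel x₀ x, L_add, L_add, h.L_eq_zero hx₀, hx₀.1, ← ha, dotProduct_smul,
    smul_eq_mul, zero_add, zero_add]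

lemma pos_of_smul_normal_eq (h : P.SamePolytope Q) (ha : a • Q.normal k = P.normal k) :
    0 < a := by
  obtain ⟨x, hx⟩ : P.openSet.Nonempty := P.nonempty'
  have hxQ : x ∈ Q.openSet := h.openSet_eq ▸ hx
  have hpos := hx k
  rw [h.L_eq_mul_of_smul_normal_eq ha] at hpos
  exact pos_of_mul_pos_left hpos (hxQ k).le

lemma exists_pos_smul_normal_eq_iff (h : P.SamePolytope Q) (k : Fin d) :
    ∃ a : ℝ, 0 < a ∧ ∀ b : ℝ, b • Q.normal k = P.normal k ↔ b = a := by
  obtain ⟨a, ha⟩ := h.exists_smul_normal_eq k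
  refine ⟨a, h.pos_of_smul_normal_eq ha, fun b => ?_⟩
  rw [← ha, (smul_left_injective ℝ (normal_ne_zero Q k)).eq_iff]

lemma closedSet_eq (h : P.SamePolytope Q) : Q.closedSet = P.closedSet := by
  ext x
  refine forall_congr' fun k => ?_
  obtain ⟨a, ha⟩ := h.exists_smul_normal_eq k
  rw [h.L_eq_mul_of_smul_normal_eq ha, mul_nonneg_iff_of_pos_left (h.pos_of_smul_normal_eq ha)]

lemma facetCollar_eq (h : P.SamePolytope Q) (k : Fin d) : Q.facetCollar k = P.facetCollar k := by
  ext x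
  refine forall₂_congr fun j _ => ?_
  obtain ⟨a, ha⟩ := h.exists_smul_normal_eq j
  rw [h.L_eq_mul_of_smul_normal_eq ha, mul_pos_iff_of_pos_left (h.pos_of_smul_normal_eq ha)]

end LabelledPolytope.SamePolytope

lemma faceInterior_empty : P.faceInterior ∅ = P.openSet := by
  refine Set.Subset.antisymm (fun x hx k => (hx.1 k).lt_of_ne fun h => ?_)
    fun x hx => ⟨closedSet_of_openSet hx, active_eq_empty hx⟩
  have hk : k ∈ P.active x := mem_active.2 h.symm
  rw [hx.2] at hk
  exact Finset.notMem_empty k hk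

lemma faceInterior_singleton (k : Fin d) : P.faceInterior {k} = P.facetInterior k := by
  ext x
  constructor
  · rintro ⟨hx, hact⟩
    have hiff : ∀ j, P.L j x = 0 ↔ j = k := fun j => by
      rw [← mem_active, hact, Finset.mem_singleton]
    exact ⟨(hiff k).2 rfl, fun j hj => (hx j).lt_of_ne fun h => hj ((hiff j).1 h.symm)⟩
  · refine fun hx => ⟨facetInterior_subset_closedSet k hx, ?_⟩
    ext j
    rw [mem_active, Finset.mem_singleton]
    exact ⟨fun h => not_imp_comm.1 (hx.2 j) h.not_gt, fun h => h ▸ hx.1⟩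

namespace LabelledPolytope.IsSymplecticPotential

variable {u f : (Fin n → ℝ) → ℝ} (hu : P.IsSymplecticPotential u)
include hu

lemma exists_regular_part (k : Fin d) : ∃ (W : Set (Fin n → ℝ)) (f : (Fin n → ℝ) → ℝ),
    IsOpen W ∧ P.closedSet ∩ P.facetCollar k ⊆ W ∧ ContDiffOn ℝ ∞ f W ∧
      ∀ x ∈ P.closedSet, u x = 1 / 2 * (P.L k x * Real.log (P.L k x)) + f x := by
  obtain ⟨U, f, hU, hPU, hf, huf⟩ := hu.boundary
  refine ⟨U ∩ P.facetCollar k,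
    fun x => ∑ j ∈ Finset.univ.erase k, 1 / 2 * (P.L j x * Real.log (P.L j x)) + f x,
    hU.inter (isOpen_facetCollar k), Set.inter_subset_inter_left _ hPU, ?_, fun x hx => ?_⟩
  · refine ContDiffOn.add (ContDiffOn.sum fun j hj x hx => ?_) (hf.mono Set.inter_subset_left)
    exact (contDiffAt_mul_log (hx.2 j (Finset.ne_of_mem_erase hj))).contDiffWithinAt
  · beta_reduce
    rw [← huf x hx, guillemin, Finset.mul_sum, ← Finset.add_sum_erase _ _ (Finset.mem_univ k)]
    ring

lemma contDiffOn : ContDiffOn ℝ ∞ u P.openSet := by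
  rw [← faceInterior_empty]
  exact hu.smooth_face ∅

lemma contDiffAt (hx : x ∈ P.openSet) : ContDiffAt ℝ ∞ u x :=
  hu.contDiffOn.contDiffAt (isOpen_openSet.mem_nhds hx)

lemma hess_posDef (hx : x ∈ P.openSet) : (hess u x).PosDef := by
  have hu2 : ContDiffAt ℝ 2 u x := (hu.contDiffAt hx).of_le (by norm_cast)
  refine .of_dotProduct_mulVec_pos (hess_isSymm hu2) fun v hv => ?_
  rw [star_trivial, ← iteratedDeriv_two_line hu2]
  exact hu.convex_face ∅ x (by rwa [faceInterior_empty]) v hv (by simp)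

lemma dotProduct_hess_regular_part_pos (hx : x ∈ P.facetInterior k) (hf : ContDiffAt ℝ 2 f x)
    (huf : ∀ y ∈ P.closedSet, u y = 1 / 2 * (P.L k y * Real.log (P.L k y)) + f y)
    {v : Fin n → ℝ} (hv : v ≠ 0) (hvk : v ⬝ᵥ P.normal k = 0) : 0 < v ⬝ᵥ hess f x *ᵥ v := by
  have hline : (fun t : ℝ => u (x + t • v)) =ᶠ[𝓝 0] fun t => f (x + t • v) := by
    filter_upwards [eventually_add_smul_mem_facetInterior hx hvk] with t ht
    rw [huf _ (facetInterior_subset_closedSet k ht), ht.1, zero_mul, mul_zero, zero_add]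
  rw [← iteratedDeriv_two_line hf, ← hline.iteratedDeriv_eq]
  exact hu.convex_face {k} x (by rwa [faceInterior_singleton]) v hv (by simpa using hvk)

end LabelledPolytope.IsSymplecticPotential

end Potential

/-! ### The metric of a potential -/

section PolarForm

variable {n : ℕ}

/-- The one-form `½ d|z_j|²` on `ℂⁿ`. -/
def radialForm (z : Fin n → ℂ) (j : Fin n) : (Fin n → ℂ) →L[ℝ] ℝ :=
  (Complex.reCLM.comp (ContinuousLinearMap.mul ℝ ℂ (starRingEnd ℂ (z j)))).comp
    (ContinuousLinearMap.proj (R := ℝ) (φ := fun _ : Fin n => ℂ) j)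

/-- The one-form `|z_j|² d(arg z_j)` on `ℂⁿ`. -/
def angularForm (z : Fin n → ℂ) (j : Fin n) : (Fin n → ℂ) →L[ℝ] ℝ :=
  (Complex.imCLM.comp (ContinuousLinearMap.mul ℝ ℂ (starRingEnd ℂ (z j)))).comp
    (ContinuousLinearMap.proj (R := ℝ) (φ := fun _ : Fin n => ℂ) j)

/-- The bilinear form on `ℂⁿ` with matrix `A` in the forms `½ d|z_j|²` and matrix `C` in the forms
`|z_j|² d(arg z_j)`. -/
def polarForm (A C : Matrix (Fin n) (Fin n) ℝ) (z : Fin n → ℂ) :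
    (Fin n → ℂ) →L[ℝ] (Fin n → ℂ) →L[ℝ] ℝ :=
  ∑ j, ∑ l, (A j l • (radialForm z j).smulRight (radialForm z l) +
    C j l • (angularForm z j).smulRight (angularForm z l))

lemma polarForm_apply (A C : Matrix (Fin n) (Fin n) ℝ) (z ζ ζ' : Fin n → ℂ) :
    polarForm A C z ζ ζ' = (fun j => radialForm z j ζ) ⬝ᵥ A *ᵥ (fun j => radialForm z j ζ') +
      (fun j => angularForm z j ζ) ⬝ᵥ C *ᵥ (fun j => angularForm z j ζ') := by
  simp only [polarForm, sum_apply, add_apply, smul_apply, ContinuousLinearMap.smulRight_apply,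
    smul_eq_mul, dotProduct, Matrix.mulVec, Finset.mul_sum, ← Finset.sum_add_distrib]
  refine Finset.sum_congr rfl fun j _ => Finset.sum_congr rfl fun l _ => ?_
  ring

lemma contDiff_radialForm (j : Fin n) : ContDiff ℝ ∞ fun z : Fin n → ℂ => radialForm z j := by
  refine contDiff_clm_apply_iff.2 fun ζ => ?_
  simp only [radialForm, ContinuousLinearMap.comp_apply, ContinuousLinearMap.mul_apply']
  exact Complex.reCLM.contDiff.comp
    ((Complex.conjCLE.contDiff.comp (contDiff_apply ℝ ℂ j)).mul contDiff_const)

lemma contDiff_angularForm (j : Fin n) : ContDiff ℝ ∞ fun z : Fin n → ℂ => angularForm z j := by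
  refine contDiff_clm_apply_iff.2 fun ζ => ?_
  simp only [angularForm, ContinuousLinearMap.comp_apply, ContinuousLinearMap.mul_apply']
  exact Complex.imCLM.contDiff.comp
    ((Complex.conjCLE.contDiff.comp (contDiff_apply ℝ ℂ j)).mul contDiff_const)

lemma contMDiffOn_polarForm {E H M : Type*} [NormedAddCommGroup E] [NormedSpace ℝ E]
    [TopologicalSpace H] {I : ModelWithCorners ℝ E H} [TopologicalSpace M] [ChartedSpace H M]
    {A C : M → Matrix (Fin n) (Fin n) ℝ} {f : M → Fin n → ℂ} {U : Set M}
    (hA : ∀ j l, ContMDiffOn I 𝓘(ℝ, ℝ) ∞ (fun m => A m j l) U)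
    (hC : ∀ j l, ContMDiffOn I 𝓘(ℝ, ℝ) ∞ (fun m => C m j l) U)
    (hf : ContMDiffOn I 𝓘(ℝ, Fin n → ℂ) ∞ f U) :
    ContMDiffOn I 𝓘(ℝ, (Fin n → ℂ) →L[ℝ] (Fin n → ℂ) →L[ℝ] ℝ) ∞
      (fun m => polarForm (A m) (C m) (f m)) U := by
  have hprod : ∀ {α : (Fin n → ℂ) → Fin n → (Fin n → ℂ) →L[ℝ] ℝ},
      (∀ j, ContDiff ℝ ∞ fun z => α z j) → ∀ j l,
      ContMDiffOn I 𝓘(ℝ, (Fin n → ℂ) →L[ℝ] (Fin n → ℂ) →L[ℝ] ℝ) ∞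
        (fun m => (α (f m) j).smulRight (α (f m) l)) U := fun hα j l =>
    ((hα j).smulRight (hα l)).contMDiff.comp_contMDiffOn hf
  exact contMDiffOn_finsetSum fun j _ => contMDiffOn_finsetSum fun l _ =>
    ((hA j l).smul (hprod contDiff_radialForm j l)).add
      ((hC j l).smul (hprod contDiff_angularForm j l))

lemma mul_dotProduct_mulVec_mul (M : Matrix (Fin n) (Fin n) ℝ) (s a b : Fin n → ℝ) :
    (fun j => a j * s j) ⬝ᵥ M *ᵥ (fun j => b j * s j) =
      a ⬝ᵥ (Matrix.of fun j l => M j l * s j * s l) *ᵥ b := by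
  simp only [dotProduct, Matrix.mulVec, Finset.mul_sum, Matrix.of_apply]
  refine Finset.sum_congr rfl fun j _ => Finset.sum_congr rfl fun l _ => ?_
  ring

lemma dotProduct_mulVec_comm {A : Matrix (Fin n) (Fin n) ℝ} (hA : A.IsSymm) (a b : Fin n → ℝ) :
    a ⬝ᵥ A *ᵥ b = b ⬝ᵥ A *ᵥ a := by
  rw [← A.dotProduct_transpose_mulVec, hA.eq]

end PolarForm

section PolarCoordinates

variable {n d : ℕ} {P : LabelledPolytope n d} {Λ : Submodule ℤ (Fin n → ℝ)} {hP : P.IsDelzant Λ}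
  {p : Fin n → ℝ} (hp : P.IsVertex p) {m : ToricManifold P Λ hP}

/-- The values on `v` of the one-forms `½ d|z_j|²` in the coordinates at a vertex. -/
def polarRe (m : ToricManifold P Λ hP) (v : TangentSpace 𝓘(ℝ, Fin n → ℂ) m) (j : Fin n) : ℝ :=
  radialForm (chartFun hP hp m) j (diff n (chartFun hP hp) m v)

/-- The values on `v` of the one-forms `|z_j|² d(arg z_j)` in the coordinates at a vertex. -/
def polarIm (m : ToricManifold P Λ hP) (v : TangentSpace 𝓘(ℝ, Fin n → ℂ) m) (j : Fin n) : ℝ :=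
  angularForm (chartFun hP hp m) j (diff n (chartFun hP hp) m v)

lemma polarRe_add_polarIm_mul_I (v : TangentSpace 𝓘(ℝ, Fin n → ℂ) m) (j : Fin n) :
    (polarRe hp m v j : ℂ) + polarIm hp m v j * Complex.I =
      starRingEnd ℂ (chartFun hP hp m j) * diff n (chartFun hP hp) m v j :=
  Complex.re_add_im _

lemma smoothOn_of_polar {U : Set (ToricManifold P Λ hP)} (hU : IsOpen U)
    (hUp : U ⊆ chartSource hP p) {T : Set (Fin n → ℝ)} (hT : Set.MapsTo moment U T)
    {A C : (Fin n → ℝ) → Matrix (Fin n) (Fin n) ℝ}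
    (hA : ∀ j l, ContDiffOn ℝ ∞ (fun x => A x j l) T)
    (hC : ∀ j l, ContDiffOn ℝ ∞ (fun x => C x j l) T) {g : Tensor2 n (ToricManifold P Λ hP)}
    (hg : ∀ m ∈ U, ∀ v w, g m v w =
      polarRe hp m v ⬝ᵥ A (moment m) *ᵥ polarRe hp m w +
      polarIm hp m v ⬝ᵥ C (moment m) *ᵥ polarIm hp m w) : SmoothOn g U := by
  have hz := (contMDiffOn_chartFun (hP := hP) hp).mono hUp
  have hcoeff : ∀ {f : (Fin n → ℝ) → ℝ}, ContDiffOn ℝ ∞ f T → ContMDiffOn 𝓘(ℝ, Fin n → ℂ) 𝓘(ℝ, ℝ) ∞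
      (fun m : ToricManifold P Λ hP => f (moment m)) U := fun hf =>
    hf.contMDiffOn.comp contMDiff_moment.contMDiffOn hT
  refine smoothOn_of_pullback hU hz (contMDiffOn_polarForm (A := fun m => A (moment m))
    (C := fun m => C (moment m)) (fun j l => hcoeff (hA j l)) (fun j l => hcoeff (hC j l)) hz)
    fun m hm v w => ?_
  rw [hg m hm, polarForm_apply]
  rfl

lemma coframe_fst (hm : moment m ∈ P.openSet) (v : TangentSpace 𝓘(ℝ, Fin n → ℂ) m) :
    (coframe hP m v).1 = (vertexMat hp)⁻¹ *ᵥ polarRe hp m v := by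
  rw [coframe_eq hp hm]
  rfl

lemma coframe_snd (hm : moment m ∈ P.openSet) (v : TangentSpace 𝓘(ℝ, Fin n → ℂ) m) :
    (coframe hP m v).2 =
      (fun j => polarIm hp m v j * (2 * P.L (vertexIdx hp j) (moment m))⁻¹) ᵥ* vertexMat hp := by
  have hnorm : ∀ j, 2 * P.L (vertexIdx hp j) (moment m) = ‖chartFun hP hp m j‖ ^ 2 := fun j => by
    rw [L_moment_eq hp (mem_chartSource_of_moment_mem_openSet hm)]
    ring
  simp only [hnorm, ← div_eq_mul_inv]
  rw [coframe_eq hp hm]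
  rfl

/-- The Hessian in the coordinates `L_k` at a vertex. -/
def vertexHess (u : (Fin n → ℝ) → ℝ) (x : Fin n → ℝ) : Matrix (Fin n) (Fin n) ℝ :=
  ((vertexMat hp)⁻¹)ᵀ * hess u x * (vertexMat hp)⁻¹

variable {u : (Fin n → ℝ) → ℝ} {x : Fin n → ℝ}

lemma dotProduct_vertexHess_mulVec (u : (Fin n → ℝ) → ℝ) (x a b : Fin n → ℝ) :
    a ⬝ᵥ vertexHess hp u x *ᵥ b =
      ((vertexMat hp)⁻¹ *ᵥ a) ⬝ᵥ hess u x *ᵥ ((vertexMat hp)⁻¹ *ᵥ b) := by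
  rw [vertexHess, ← Matrix.mulVec_mulVec, ← Matrix.mulVec_mulVec, Matrix.dotProduct_mulVec,
    Matrix.vecMul_transpose]

lemma vertexHess_inv (u : (Fin n → ℝ) → ℝ) (x : Fin n → ℝ) :
    (vertexHess hp u x)⁻¹ = vertexMat hp * (hess u x)⁻¹ * (vertexMat hp)ᵀ := by
  rw [vertexHess, Matrix.mul_inv_rev, Matrix.mul_inv_rev, ← Matrix.transpose_nonsing_inv,
    Matrix.nonsing_inv_nonsing_inv _ (isUnit_det_vertexMat hp), Matrix.mul_assoc]

lemma vertexHess_posDef (h : (hess u x).PosDef) : (vertexHess hp u x).PosDef := by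
  rw [vertexHess, ← Matrix.conjTranspose_eq_transpose_of_trivial]
  refine h.conjTranspose_mul_mul_same (Matrix.mulVec_injective_of_isUnit ?_)
  rw [Matrix.isUnit_nonsing_inv_iff, Matrix.isUnit_iff_isUnit_det]
  exact isUnit_det_vertexMat hp

lemma contDiffOn_vertexHess {W : Set (Fin n → ℝ)} (hW : IsOpen W) (hu : ContDiffOn ℝ ∞ u W)
    (i j : Fin n) : ContDiffOn ℝ ∞ (fun x => vertexHess hp u x i j) W := by
  have hconst : ∀ (B : Matrix (Fin n) (Fin n) ℝ) i j, ContDiffOn ℝ ∞ (fun _ => B i j) W :=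
    fun _ _ _ => contDiffOn_const
  exact contDiffOn_matrix_mul (contDiffOn_matrix_mul (hconst _) (contDiffOn_hess hW hu))
    (hconst _) i j

lemma metric_eq_polar (u : (Fin n → ℝ) → ℝ) (hm : moment m ∈ P.openSet)
    (v w : TangentSpace 𝓘(ℝ, Fin n → ℂ) m) :
    metric hP u m v w = polarRe hp m v ⬝ᵥ vertexHess hp u (moment m) *ᵥ polarRe hp m w +
      polarIm hp m v ⬝ᵥ (Matrix.of fun j l => (vertexHess hp u (moment m))⁻¹ j l *
        (2 * P.L (vertexIdx hp j) (moment m))⁻¹ * (2 * P.L (vertexIdx hp l) (moment m))⁻¹) *ᵥ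
          polarIm hp m w := by
  rw [metric_apply, coframe_fst hp hm, coframe_fst hp hm, coframe_snd hp hm, coframe_snd hp hm,
    dotProduct_vertexHess_mulVec, vertexHess_inv, ← mul_dotProduct_mulVec_mul]
  rw [← Matrix.mulVec_mulVec, ← Matrix.mulVec_mulVec, Matrix.mulVec_transpose,
    ← Matrix.dotProduct_mulVec]

variable (hu : ContDiffOn ℝ ∞ u P.openSet) (hpos : ∀ x ∈ P.openSet, (hess u x).PosDef)
include hu hpos

lemma smoothOn_metric : SmoothOn (metric hP u) (freeLocus hP) := by
  obtain ⟨p, hp⟩ := exists_isVertex P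
  have hmem : Set.MapsTo moment (freeLocus hP) P.openSet := freeLocus_eq.subset
  have hL : ∀ j, ContDiffOn ℝ ∞ (fun x => (2 * P.L (vertexIdx hp j) x)⁻¹) P.openSet := fun j =>
    (contDiffOn_const.mul (contDiff_L _).contDiffOn).inv fun x hx =>
      mul_ne_zero two_ne_zero (hx _).ne'
  have hG := contDiffOn_vertexHess hp isOpen_openSet hu
  have hH := contDiffOn_matrix_inv hG fun x hx => (vertexHess_posDef hp (hpos x hx)).det_pos.ne'
  exact smoothOn_of_polar hp isOpen_freeLocus
    (fun m hm => mem_chartSource_of_moment_mem_openSet (hmem hm)) hmem hG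
    (fun j l => ((hH j l).mul (hL j)).mul (hL l)) fun m hm => metric_eq_polar hp u (hmem hm)

lemma isMetricOn_metric : IsMetricOn (metric hP u) (freeLocus hP) where
  smooth := smoothOn_metric hu hpos
  symm m hm v w := by
    rw [freeLocus_eq] at hm
    have hG := Matrix.isHermitian_iff_isSymm.1 (hpos _ hm).isHermitian
    have hH := Matrix.isHermitian_iff_isSymm.1 (hpos _ hm).inv.isHermitian
    rw [metric_apply, metric_apply, dotProduct_mulVec_comm hG, dotProduct_mulVec_comm hH]
  pos m hm v hv := by
    rw [freeLocus_eq] at hm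
    have hG := hpos _ hm
    have hne : coframe hP m v ≠ 0 := by
      rwa [Ne, map_eq_zero_iff _ (coframe_bijective hm).injective]
    rw [metric_apply]
    obtain hfst | hsnd := not_and_or.1 (mt Prod.ext_iff.2 hne)
    · exact add_pos_of_pos_of_nonneg (hG.dotProduct_mulVec_pos hfst)
        (hG.inv.posSemidef.dotProduct_mulVec_nonneg _)
    · exact add_pos_of_nonneg_of_pos (hG.posSemidef.dotProduct_mulVec_nonneg _)
        (hG.inv.dotProduct_mulVec_pos hsnd)

end PolarCoordinates

/-! ### The complex structure -/

section Kahler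

variable {n d : ℕ} {P : LabelledPolytope n d} {Λ : Submodule ℤ (Fin n → ℝ)} {hP : P.IsDelzant Λ}
  {u : (Fin n → ℝ) → ℝ}

/-- The complex structure in action-angle coordinates: `dx ∘ J = -H dθ` and `dθ ∘ J = G dx`. -/
def actionAngleJ (G : Matrix (Fin n) (Fin n) ℝ) :
    (Fin n → ℝ) × (Fin n → ℝ) →L[ℝ] (Fin n → ℝ) × (Fin n → ℝ) :=
  (-(G⁻¹.mulVecLin.toContinuousLinearMap.comp (ContinuousLinearMap.snd ℝ _ _))).prod
    (G.mulVecLin.toContinuousLinearMap.comp (ContinuousLinearMap.fst ℝ _ _))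

lemma actionAngleJ_apply (G : Matrix (Fin n) (Fin n) ℝ) (a : (Fin n → ℝ) × (Fin n → ℝ)) :
    actionAngleJ G a = (-(G⁻¹ *ᵥ a.2), G *ᵥ a.1) := rfl

lemma actionAngleJ_actionAngleJ {G : Matrix (Fin n) (Fin n) ℝ} (hG : IsUnit G.det)
    (a : (Fin n → ℝ) × (Fin n → ℝ)) : actionAngleJ G (actionAngleJ G a) = -a := by
  simp only [actionAngleJ_apply, Matrix.mulVec_neg, Matrix.mulVec_mulVec,
    Matrix.mul_nonsing_inv _ hG, Matrix.nonsing_inv_mul _ hG, Matrix.one_mulVec]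
  rfl

variable (hP u) in
/-- The almost complex structure of the metric of a potential. -/
def complexStructure (m : ToricManifold P Λ hP) :
    TangentSpace 𝓘(ℝ, Fin n → ℂ) m →L[ℝ] TangentSpace 𝓘(ℝ, Fin n → ℂ) m :=
  (ContinuousLinearMap.inverse (M := TangentSpace 𝓘(ℝ, Fin n → ℂ) m)
    (M₂ := (Fin n → ℝ) × (Fin n → ℝ)) (coframe hP m)).comp
    ((actionAngleJ (hess u (moment m))).comp (coframe hP m))

section Pointwise

variable {m : ToricManifold P Λ hP} (hm : moment m ∈ P.openSet)
include hm

lemma coframe_complexStructure (v : TangentSpace 𝓘(ℝ, Fin n → ℂ) m) :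
    coframe hP m (complexStructure hP u m v) =
      actionAngleJ (hess u (moment m)) (coframe hP m v) :=
  (coframe_isInvertible hm).self_apply_inverse _

lemma complexStructure_complexStructure (hdet : IsUnit (hess u (moment m)).det)
    (v : TangentSpace 𝓘(ℝ, Fin n → ℂ) m) :
    complexStructure hP u m (complexStructure hP u m v) = -v := by
  apply (coframe_bijective hm).injective
  rw [coframe_complexStructure hm, coframe_complexStructure hm, actionAngleJ_actionAngleJ hdet,
    map_neg]

lemma symplecticForm_eq_metric_complexStructure (hG : (hess u (moment m)).PosDef)
    (v w : TangentSpace 𝓘(ℝ, Fin n → ℂ) m) :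
    symplecticForm hP m v w = metric hP u m (complexStructure hP u m v) w := by
  have hdet := isUnit_iff_ne_zero.2 hG.det_pos.ne'
  rw [symplecticForm_eq_coframe hm, metric_apply, coframe_complexStructure hm, actionAngleJ_apply,
    dotProduct_mulVec_comm (Matrix.isHermitian_iff_isSymm.1 hG.isHermitian),
    dotProduct_mulVec_comm (Matrix.isHermitian_iff_isSymm.1 hG.inv.isHermitian), Matrix.mulVec_neg,
    Matrix.mulVec_mulVec, Matrix.mulVec_mulVec, Matrix.mul_nonsing_inv _ hdet,
    Matrix.nonsing_inv_mul _ hdet, Matrix.one_mulVec, Matrix.one_mulVec, dotProduct_neg,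
    dotProduct_comm _ (coframe hP m v).1, dotProduct_comm _ (coframe hP m v).2]
  ring

end Pointwise

variable {p : Fin n → ℝ} (hp : P.IsVertex p)

/-- The real part of the logarithm of `exp(∂u/∂L_j + √-1 θ_j) / z_j`, where the `z_j` are the
coordinates at a vertex. -/
def logRatio (u : (Fin n → ℝ) → ℝ) (j : Fin n) (x : Fin n → ℝ) : ℝ :=
  fderiv ℝ u x ((vertexMat hp)⁻¹ *ᵥ Pi.single j 1) - Real.log (2 * P.L (vertexIdx hp j) x) / 2

/-- The holomorphic coordinates `exp(∂u/∂L_j + √-1 θ_j)` on the free locus, written as multiples of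
the coordinates at a vertex. -/
def holomorphicCoord (u : (Fin n → ℝ) → ℝ) (m : ToricManifold P Λ hP) (j : Fin n) : ℂ :=
  chartFun hP hp m j * Complex.exp (logRatio hp u j (moment m))

lemma contMDiffOn_holomorphicCoord (hu : ContDiffOn ℝ ∞ u P.openSet) :
    ContMDiffOn 𝓘(ℝ, Fin n → ℂ) 𝓘(ℝ, Fin n → ℂ) ∞ (holomorphicCoord (hP := hP) hp u)
      {m | moment m ∈ P.openSet} := by
  refine contMDiffOn_pi_space.2 fun j => ?_
  have hratio : ContDiffOn ℝ ∞ (logRatio hp u j) P.openSet :=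
    ((hu.fderiv_of_isOpen isOpen_openSet (by simp)).clm_apply contDiffOn_const).sub
      (((contDiffOn_const.mul (contDiff_L _).contDiffOn).log fun x hx =>
        mul_ne_zero two_ne_zero (hx _).ne').div_const 2)
  have hexp : ContMDiffOn 𝓘(ℝ, Fin n → ℂ) 𝓘(ℝ, ℂ) ∞ (fun m : ToricManifold P Λ hP =>
      Complex.exp (logRatio hp u j (moment m))) {m | moment m ∈ P.openSet} :=
    (Complex.ofRealCLM.contDiff.comp_contDiffOn hratio).cexp.contMDiffOn.comp
      contMDiff_moment.contMDiffOn fun m hm => hm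
  exact contDiff_mul.contMDiff.comp_contMDiffOn (((contMDiffOn_pi_space.1
    (contMDiffOn_chartFun hp) j).mono
      fun m hm => mem_chartSource_of_moment_mem_openSet hm).prodMk_space hexp)

lemma holomorphicCoord_pt {x : Fin n → ℝ} (hx : x ∈ P.openSet) (θ : Fin n → ℝ) (j : Fin n) :
    holomorphicCoord hp u (pt hP (x, θ)) j =
      Complex.exp (fderiv ℝ u x ((vertexMat hp)⁻¹ *ᵥ Pi.single j 1) +
        ((θ ᵥ* (vertexMat hp)⁻¹) j : ℝ) * Complex.I) := by
  rw [holomorphicCoord, chartFun_pt_of_mem_openSet hp hx, moment_pt (closedSet_of_openSet hx),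
    coord_eq_exp hp hx, ← Complex.exp_add, logRatio, Complex.ofReal_sub]
  congr 1
  ring

lemma diff_holomorphicCoord_dpt (hu : ContDiffOn ℝ ∞ u P.openSet) {x : Fin n → ℝ}
    (hx : x ∈ P.openSet) (θ : Fin n → ℝ) (a : (Fin n → ℝ) × (Fin n → ℝ)) :
    diff n (holomorphicCoord hp u) (pt hP (x, θ)) (dpt hP x θ a) =
      holomorphicCoord hp u (pt hP (x, θ)) * fun j =>
        ((((hess u x *ᵥ a.1) ᵥ* (vertexMat hp)⁻¹) j : ℝ) +
          ((a.2 ᵥ* (vertexMat hp)⁻¹) j : ℝ) * Complex.I) := by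
  have hux : ContDiffAt ℝ 2 u x := (hu.contDiffAt (isOpen_openSet.mem_nhds hx)).of_le (by norm_cast)
  have hreal : ∀ e, HasFDerivAt (fun b : (Fin n → ℝ) × (Fin n → ℝ) => fderiv ℝ u b.1 e)
      (((fderiv ℝ (fderiv ℝ u) x).comp (ContinuousLinearMap.fst ℝ _ _)).flip e) (x, θ) := fun e =>
    ((ContinuousLinearMap.apply ℝ ℝ e).hasFDerivAt.comp _
      ((differentiableAt_fderiv hux).hasFDerivAt.comp (x, θ) hasFDerivAt_fst))
  let angle : (Fin n → ℝ) × (Fin n → ℝ) →L[ℝ] (Fin n → ℝ) :=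
    (vertexMat hp)⁻¹.vecMulLinear.toContinuousLinearMap.comp (ContinuousLinearMap.snd ℝ _ _)
  have hev : holomorphicCoord hp u ∘ pt hP =ᶠ[𝓝 (x, θ)] fun b j =>
      Complex.exp (fderiv ℝ u b.1 ((vertexMat hp)⁻¹ *ᵥ Pi.single j 1) +
        ((b.2 ᵥ* (vertexMat hp)⁻¹) j : ℝ) * Complex.I) := by
    filter_upwards [continuous_fst.continuousAt.eventually (isOpen_openSet.mem_nhds hx)] with b hb
    exact funext (holomorphicCoord_pt hp hb b.2)
  have hdiff : MDifferentiableAt 𝓘(ℝ, Fin n → ℂ) 𝓘(ℝ, Fin n → ℂ) (holomorphicCoord hp u)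
      (pt hP (x, θ)) :=
    ((contMDiffOn_holomorphicCoord hp hu).contMDiffAt
      ((isOpen_openSet.preimage continuous_moment).mem_nhds (by
        rwa [Set.mem_preimage, moment_pt (closedSet_of_openSet hx)]))).mdifferentiableAt (by simp)
  rw [diff_dpt hdiff hx, ((hasFDerivAt_pi.2 fun j =>
    hasFDerivAt_cexp_add_mul_I (hreal _)
    ((ContinuousLinearMap.proj j).comp angle).hasFDerivAt).congr_of_eventuallyEq hev).fderiv]
  ext j
  have hhess : ((hess u x *ᵥ a.1) ᵥ* (vertexMat hp)⁻¹) j =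
      fderiv ℝ (fderiv ℝ u) x a.1 ((vertexMat hp)⁻¹ *ᵥ Pi.single j 1) := by
    rw [← dotProduct_hess_mulVec hux, dotProduct_mulVec_comm (hess_isSymm hux),
      dotProduct_comm, Matrix.dotProduct_mulVec, dotProduct_single_one]
  rw [Pi.mul_apply, holomorphicCoord_pt hp hx, hhess]
  simp [angle, mul_add]

lemma diff_holomorphicCoord (hu : ContDiffOn ℝ ∞ u P.openSet) {m : ToricManifold P Λ hP}
    (hm : moment m ∈ P.openSet) (v : TangentSpace 𝓘(ℝ, Fin n → ℂ) m) (j : Fin n) :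
    diff n (holomorphicCoord hp u) m v j = holomorphicCoord hp u m j *
      ((((hess u (moment m) *ᵥ (coframe hP m v).1) ᵥ* (vertexMat hp)⁻¹) j : ℝ) +
        (((coframe hP m v).2 ᵥ* (vertexMat hp)⁻¹) j : ℝ) * Complex.I) := by
  obtain ⟨θ, hθ⟩ := exists_pt m
  generalize hx : moment m = x at hm hθ
  subst hθ
  obtain ⟨a, ha⟩ := (dpt_isInvertible (hP := hP) hm θ).surjective v
  change dpt hP x θ a = v at ha
  subst ha
  exact (congrFun (diff_holomorphicCoord_dpt hp hu hm θ a) j).trans (by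
    rw [Pi.mul_apply, coframe_dpt hm])

lemma holomorphicCoord_ne_zero (u : (Fin n → ℝ) → ℝ) {m : ToricManifold P Λ hP}
    (hm : moment m ∈ P.openSet) (j : Fin n) : holomorphicCoord hp u m j ≠ 0 :=
  mul_ne_zero (chartFun_ne_zero hp (mem_chartSource_of_moment_mem_openSet hm) (hm _).ne')
    (Complex.exp_ne_zero _)

section Potential

variable (hu : ContDiffOn ℝ ∞ u P.openSet) {m : ToricManifold P Λ hP} (hm : moment m ∈ P.openSet)
  (hdet : IsUnit (hess u (moment m)).det)
include hu hm hdet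

lemma diff_holomorphicCoord_bijective :
    Function.Bijective (diff n (holomorphicCoord hp u) m) := by
  have hV : Function.Injective fun a : Fin n → ℝ => a ᵥ* (vertexMat hp)⁻¹ :=
    Matrix.vecMul_injective_of_isUnit (Matrix.isUnit_nonsing_inv_iff.2
      ((Matrix.isUnit_iff_isUnit_det _).2 (isUnit_det_vertexMat hp)))
  have hG : Function.Injective (hess u (moment m)).mulVec :=
    Matrix.mulVec_injective_of_isUnit ((Matrix.isUnit_iff_isUnit_det _).2 hdet)
  have hinj : Function.Injective (diff n (holomorphicCoord hp u) m) := fun v w hvw => by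
    have hlog : ∀ j, _ := fun j => mul_left_cancel₀ (holomorphicCoord_ne_zero hp u hm j)
      ((diff_holomorphicCoord hp hu hm v j).symm.trans
        ((congrFun hvw j).trans (diff_holomorphicCoord hp hu hm w j)))
    refine (coframe_bijective hm).injective (Prod.ext
      (hG (hV (funext fun j => ?_))) (hV (funext fun j => ?_)))
    · simpa using congrArg Complex.re (hlog j)
    · simpa using congrArg Complex.im (hlog j)
  exact (isInvertible_of_injective (E := Fin n → ℂ) (F := Fin n → ℂ) rfl hinj).bijective

lemma diff_holomorphicCoord_complexStructure (v : TangentSpace 𝓘(ℝ, Fin n → ℂ) m) :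
    diff n (holomorphicCoord hp u) m (complexStructure hP u m v) =
      Complex.I • diff n (holomorphicCoord hp u) m v := by
  ext j
  rw [Pi.smul_apply, diff_holomorphicCoord hp hu hm, diff_holomorphicCoord hp hu hm,
    coframe_complexStructure hm, actionAngleJ_apply, Matrix.mulVec_neg, Matrix.mulVec_mulVec,
    Matrix.mul_nonsing_inv _ hdet, Matrix.one_mulVec, Matrix.neg_vecMul, Pi.neg_apply,
    Complex.ofReal_neg, smul_eq_mul]
  linear_combination (-holomorphicCoord hp u m j *
    (((coframe hP m v).2 ᵥ* (vertexMat hp)⁻¹) j : ℝ)) * Complex.I_mul_I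

end Potential

lemma isKahlerOn_metric (hu : ContDiffOn ℝ ∞ u P.openSet)
    (hpos : ∀ x ∈ P.openSet, (hess u x).PosDef) :
    IsKahlerOn (metric hP u) (symplecticForm hP) (freeLocus hP) where
  metric := isMetricOn_metric hu hpos
  smooth_form := smoothOn_symplecticForm
  alternating m _ v := (standardForm_apply v v).trans (Finset.sum_eq_zero fun j _ => by ring)
  closed := isClosedFormOn_symplecticForm
  complex := by
    obtain ⟨p, hp⟩ := exists_isVertex P
    have hmem : ∀ m ∈ freeLocus hP, moment m ∈ P.openSet := freeLocus_eq.subset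
    have hdet : ∀ m ∈ freeLocus hP, IsUnit (hess u (moment m)).det := fun m hm =>
      isUnit_iff_ne_zero.2 (hpos _ (hmem m hm)).det_pos.ne'
    refine ⟨complexStructure hP u,
      fun m hm => complexStructure_complexStructure (hmem m hm) (hdet m hm),
      fun m hm => symplecticForm_eq_metric_complexStructure (hmem m hm) (hpos _ (hmem m hm)),
      fun m₀ hm₀ => ⟨freeLocus hP, holomorphicCoord hp u, isOpen_freeLocus, hm₀, subset_rfl,
        (contMDiffOn_holomorphicCoord hp hu).mono hmem, fun m hm => ⟨?_, ?_⟩⟩⟩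
    · exact diff_holomorphicCoord_bijective hp hu (hmem m hm) (hdet m hm)
    · exact diff_holomorphicCoord_complexStructure hp hu (hmem m hm) (hdet m hm)

end Kahler

/-! ### Cone singularities -/

section ConeForm

variable {n : ℕ} {M : Type*} [TopologicalSpace M] [ChartedSpace (Fin n → ℂ) M]

lemma exists_curve_hasDerivAt_comp {W : Type*} [NormedAddCommGroup W] [NormedSpace ℝ W]
    {f : M → W} {q : M} (hf : MDifferentiableAt 𝓘(ℝ, Fin n → ℂ) 𝓘(ℝ, W) f q)
    (v : Fin n → ℂ) : ∃ γ : ℝ → M, γ 0 = q ∧ ContinuousAt γ 0 ∧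
      HasDerivAt (f ∘ γ) (diff n f q v) 0 := by
  let e := extChartAt 𝓘(ℝ, Fin n → ℂ) q
  have hline : e q + (0 : ℝ) • v = e q := by rw [zero_smul, add_zero]
  refine ⟨fun s : ℝ => e.symm (e q + s • v), ?_, ?_, ?_⟩
  · beta_reduce
    rw [hline]
    exact extChartAt_to_inv q
  · refine ContinuousAt.comp (g := e.symm) ?_ (by fun_prop)
    rw [hline]
    exact continuousAt_extChartAt_symm q
  · have hcoord : HasFDerivAt (f ∘ e.symm) (diff n f q) (e q) :=
      hf.hasMFDerivAt.2.hasFDerivAt (by simp only [mfld_simps, Filter.univ_mem])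
    exact hcoord.hasLineDerivAt v

variable (n) in
/-- The pullback along a map `f` to a vector space of a family of bilinear forms on that space. -/
def pullbackTensor {W : Type*} [NormedAddCommGroup W] [NormedSpace ℝ W] (f : M → W)
    (β : M → W →L[ℝ] W →L[ℝ] ℝ) : Tensor2 n M := fun m =>
  ContinuousLinearMap.bilinearComp (E' := Fin n → ℂ) (F' := Fin n → ℂ) (β m) (diff n f m)
    (diff n f m)

variable (n) in
/-- The symmetric tensor `dx² + dy²` of a complex-valued function `w = x + √-1 y`. -/
def flatTensor (w : M → ℂ) : Tensor2 n M := pullbackTensor n w fun _ => innerSL ℝ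

lemma flatTensor_apply (w : M → ℂ) (m : M) (v v' : TangentSpace 𝓘(ℝ, Fin n → ℂ) m) :
    flatTensor n w m v v' = inner ℝ (diff n w m v) (diff n w m v') := rfl

variable [IsManifold 𝓘(ℝ, Fin n → ℂ) ∞ M]

lemma smoothOn_flatTensor {w : M → ℂ} {U : Set M} (hU : IsOpen U)
    (hw : ContMDiffOn 𝓘(ℝ, Fin n → ℂ) 𝓘(ℝ, ℂ) ∞ w U) : SmoothOn (flatTensor n w) U :=
  smoothOn_of_pullback hU hw (β := fun _ => innerSL ℝ) contMDiffOn_const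
    fun m _ => flatTensor_apply w m

/-- On the open set `S ∪ D` with `D = {w = 0}`, the metric `g`, given on `S`, is the metric
`a⁻¹ (dr² + a² r² dφ²)` of a cone of total angle `2πa` in the coordinate `w = r exp(√-1 φ)`, plus a
symmetric tensor `B` that is smooth across `D` and reduces to a Riemannian metric on `D`. This is
the global form of `HasAngleAlong`, with the value `c = a⁻¹` that occurs for toric metrics. -/
structure IsConeForm (w : M → ℂ) (S D : Set M) (a : ℝ) (g B : Tensor2 n M) : Prop where
  isOpen : IsOpen (S ∪ D)
  contMDiffOn : ContMDiffOn 𝓘(ℝ, Fin n → ℂ) 𝓘(ℝ, ℂ) ∞ w (S ∪ D)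
  surjective : ∀ m ∈ S ∪ D, Function.Surjective (diff n w m)
  ne_zero : ∀ m ∈ S, w m ≠ 0
  eq_zero : ∀ m ∈ D, w m = 0
  smooth : SmoothOn B (S ∪ D)
  symm : ∀ m ∈ S ∪ D, ∀ v v', B m v v' = B m v' v
  eq : ∀ m ∈ S, ∀ v v',
    g m v v' = a⁻¹ * flatCone a (w m) (diff n w m v) (diff n w m v') + B m v v'
  pos : ∀ m ∈ D, ∀ v, diff n w m v = 0 → v ≠ 0 → 0 < B m v v
  exists_radical : ∀ m ∈ D, ∀ v, ∃ y, diff n w m y = 0 ∧ ∀ v', B m (v - y) v' = 0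

namespace IsConeForm

variable {w : M → ℂ} {S D : Set M} {a : ℝ} {g B : Tensor2 n M}

lemma eq_zero_iff (h : IsConeForm w S D a g B) {m : M} (hm : m ∈ S ∪ D) : w m = 0 ↔ m ∈ D :=
  ⟨fun hw => hm.resolve_left fun hS => h.ne_zero m hS hw, h.eq_zero m⟩

lemma hasAngleAlong (h : IsConeForm w S D a g B) (ha : 0 < a) :
    HasAngleAlong g S D (2 * Real.pi * a) := by
  refine fun q hq => ⟨S ∪ D, w, a⁻¹, B, h.isOpen, Or.inr hq, subset_rfl, inv_pos.2 ha,
    h.contMDiffOn, h.surjective, fun m => h.eq_zero_iff, h.smooth, h.symm, ?_,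
    fun m _ hmD => ⟨h.pos m hmD, h.exists_radical m hmD⟩⟩
  intro m hm hmD v v'
  rw [mul_div_cancel_left₀ a (by positivity)]
  exact h.eq m (hm.resolve_right hmD) v v'

lemma flatTensor_add_pos (h : IsConeForm w S D a g B) {m : M} (hm : m ∈ D)
    {v : TangentSpace 𝓘(ℝ, Fin n → ℂ) m} (hv : v ≠ 0) : 0 < flatTensor n w m v v + B m v v := by
  rw [flatTensor_apply]
  obtain ⟨y, hy, hrad⟩ := h.exists_radical m hm v
  have hB : B m v v = B m y y := by
    have hvv := hrad v
    have hvy := hrad y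
    rw [map_sub, sub_apply, sub_eq_zero] at hvv hvy
    rw [hvv, h.symm m (Or.inr hm), hvy]
  obtain hζ | hζ := eq_or_ne (diff n w m v) 0
  · rw [hζ, inner_zero_left, zero_add]
    exact h.pos m hm v hζ hv
  · have hB0 : 0 ≤ B m v v := by
      rw [hB]
      obtain rfl | hy0 := eq_or_ne y 0
      · simp
      · exact (h.pos m hm y hy hy0).le
    exact add_pos_of_pos_of_nonneg (real_inner_self_pos.2 hζ) hB0

lemma isSmoothAlong (h : IsConeForm w S D 1 g B) (hg : IsMetricOn g S) : IsSmoothAlong g S D := by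
  have heq : ∀ m ∈ S, flatTensor n w m + B m = g m := by
    intro m hm
    ext v v'
    rw [h.eq m hm, flatCone_one (h.ne_zero m hm), inv_one, one_mul]
    rfl
  refine ⟨fun m => flatTensor n w m + B m,
    ⟨(smoothOn_flatTensor h.isOpen h.contMDiffOn).add h.isOpen h.smooth, fun m hm v v' => ?_, ?_⟩,
    heq⟩
  · exact congrArg₂ (· + ·) (real_inner_comm (diff n w m v') (diff n w m v)) (h.symm m hm v v')
  · rintro m (hm | hm) v hv
    · rw [heq m hm]
      exact hg.pos m hm v hv
    · exact h.flatTensor_add_pos hm hv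

/-- Approach `q` along a curve on which `w` vanishes to first order with derivative `c`: since
`flatCone` is homogeneous of degree zero in its base point, the cone metric tends to its value at
the base point `c`. -/
lemma apply_self_eq_of_extends (h : IsConeForm w S D a g B) {U : Set M} {B' : Tensor2 n M}
    (hU : IsOpen U) (hB' : SmoothOn B' U) (hext : ∀ m ∈ U ∩ S, B' m = g m) {q : M} (hqU : q ∈ U)
    (hq : q ∈ D) {c : ℂ} (hc : c ≠ 0) (v : TangentSpace 𝓘(ℝ, Fin n → ℂ) q) :
    B' q v v = a⁻¹ * flatCone a c (diff n w q v) (diff n w q v) + B q v v := by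
  have hqSD : q ∈ S ∪ D := Or.inr hq
  have hw := h.contMDiffOn.contMDiffAt (h.isOpen.mem_nhds hqSD)
  obtain ⟨y, rfl⟩ := h.surjective q hqSD c
  obtain ⟨γ, hγ0, hγ, hγw⟩ := exists_curve_hasDerivAt_comp (hw.mdifferentiableAt (by simp)) y
  have hγq : Filter.Tendsto γ (𝓝[≠] 0) (𝓝 q) := hγ0 ▸ hγ.tendsto.mono_left nhdsWithin_le_nhds
  let ζ : M → ℂ := fun m => diff n w m (frame n q m v)
  have hζ : Filter.Tendsto (ζ ∘ γ) (𝓝[≠] 0) (𝓝 (diff n w q v)) := by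
    have hcont := (contMDiffAt_diff_frame hw v).continuousAt.tendsto
    rw [frame_self] at hcont
    exact hcont.comp hγq
  have hslope : Filter.Tendsto (fun s : ℝ => ((s⁻¹ : ℝ) : ℂ) * w (γ s)) (𝓝[≠] 0)
      (𝓝 (diff n w q y)) := by
    refine (hasDerivAt_iff_tendsto_slope_zero.1 hγw).congr fun s => ?_
    simp [hγ0, h.eq_zero q hq]
  have hframe : ∀ {A : Tensor2 n M} {V : Set M}, IsOpen V → q ∈ V → SmoothOn A V →
      Filter.Tendsto (fun s => A (γ s) (frame n q (γ s) v) (frame n q (γ s) v)) (𝓝[≠] 0)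
        (𝓝 (A q v v)) := by
    intro A V hV hqV hA
    have hcont := (hA.continuousAt_frame hV hqV v v).tendsto
    rw [frame_self] at hcont
    exact hcont.comp hγq
  have hne : ∀ᶠ s in 𝓝[≠] 0, w (γ s) ≠ 0 := by
    filter_upwards [hslope.eventually_ne hc] with s hs hws
    simp [hws] at hs
  refine tendsto_nhds_unique (hframe hU hqU hB') ((((tendsto_flatCone a hc hslope hζ).const_mul
    a⁻¹).add (hframe h.isOpen hqSD h.smooth)).congr' ?_)
  filter_upwards [hne, self_mem_nhdsWithin, hγq.eventually (hU.mem_nhds hqU),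
    hγq.eventually (h.isOpen.mem_nhds hqSD)] with s hws hs hsU hsSD
  have hsS : γ s ∈ S := hsSD.resolve_right fun hD => hws (h.eq_zero _ hD)
  rw [flatCone_ofReal_mul a (inv_ne_zero hs), hext _ ⟨hsU, hsS⟩, h.eq _ hsS]
  rfl

lemma not_extends (h : IsConeForm w S D a g B) (ha : 0 < a) (ha1 : a ≠ 1) {q : M} (hq : q ∈ D) :
    ¬ ∃ (U : Set M) (B' : Tensor2 n M), IsOpen U ∧ q ∈ U ∧ SmoothOn B' U ∧
      ∀ m ∈ U ∩ S, B' m = g m := by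
  rintro ⟨U, B', hU, hqU, hB', hext⟩
  obtain ⟨v, hv⟩ := h.surjective q (Or.inr hq) 1
  have hone := h.apply_self_eq_of_extends hU hB' hext hqU hq one_ne_zero v
  rw [h.apply_self_eq_of_extends hU hB' hext hqU hq Complex.I_ne_zero v, hv] at hone
  have hsq : a ^ 2 = 1 := by simpa [flatCone, ha.ne'] using hone
  exact ha1 ((pow_eq_one_iff_of_nonneg ha.le two_ne_zero).1 hsq)

lemma exists_sub {g' B' : Tensor2 n M} (h : IsConeForm w S D a g B)
    (h' : IsConeForm w S D a g' B') :
    ∃ A : Tensor2 n M, SmoothOn A (S ∪ D) ∧ ∀ m ∈ S, A m = g m - g' m := by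
  refine ⟨fun m => B m - B' m, h.smooth.sub h.isOpen h'.smooth, fun m hm => ?_⟩
  ext v v'
  change B m v v' - B' m v v' = g m v v' - g' m v v'
  rw [h.eq m hm, h'.eq m hm]
  ring

end IsConeForm

end ConeForm

/-! ### The metric near the preimage of a facet -/

section Facet

variable {n d : ℕ} {P : LabelledPolytope n d} {Λ : Submodule ℤ (Fin n → ℝ)} {hP : P.IsDelzant Λ}

lemma exists_vertexIdx_eq (P : LabelledPolytope n d) (k : Fin d) :
    ∃ (p : Fin n → ℝ) (hp : P.IsVertex p) (i : Fin n), vertexIdx hp i = k := by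
  obtain ⟨x, hx⟩ : (P.facetInterior k).Nonempty := P.facet' k
  obtain ⟨p, hp, hsub⟩ := exists_vertex (facetInterior_subset_closedSet k hx)
  exact ⟨p, hp, (mem_active_vertex hp).1 (hsub (mem_active.2 hx.1))⟩

lemma openSet_union_facetInterior (k : Fin d) :
    P.openSet ∪ P.facetInterior k = P.closedSet ∩ P.facetCollar k := by
  ext x
  constructor
  · rintro (hx | hx)
    · exact ⟨closedSet_of_openSet hx, openSet_subset_facetCollar k hx⟩
    · exact ⟨facetInterior_subset_closedSet k hx, facetInterior_subset_facetCollar k hx⟩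
  · rintro ⟨hx, hcollar⟩
    obtain hk | hk := (hx k).eq_or_lt
    · exact Or.inr ⟨hk.symm, hcollar⟩
    · refine Or.inl fun j => ?_
      obtain rfl | hj := eq_or_ne j k
      exacts [hk, hcollar j hj]

lemma freeLocus_union_divisor (k : Fin d) :
    freeLocus hP ∪ divisor hP k = moment ⁻¹' P.facetCollar k := by
  ext m
  have hiff := Set.ext_iff.1 (openSet_union_facetInterior (P := P) k) (moment m)
  rw [freeLocus_eq]
  exact hiff.trans (and_iff_right (moment_mem m))

lemma isOpen_freeLocus_union_divisor (k : Fin d) : IsOpen (freeLocus hP ∪ divisor hP k) := by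
  rw [freeLocus_union_divisor]
  exact (isOpen_facetCollar k).preimage continuous_moment

variable {p : Fin n → ℝ} (hp : P.IsVertex p) {i : Fin n}

lemma facetCollar_L_pos {x : Fin n → ℝ} (hx : x ∈ P.facetCollar (vertexIdx hp i)) {j : Fin n}
    (hj : j ≠ i) : 0 < P.L (vertexIdx hp j) x :=
  hx _ ((vertexIdx hp).injective.ne hj)

lemma freeLocus_union_divisor_subset_chartSource (i : Fin n) :
    freeLocus hP ∪ divisor hP (vertexIdx hp i) ⊆ chartSource hP p := by
  intro m hm j hj
  rw [freeLocus_union_divisor] at hm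
  rw [mem_active_vertex hp]
  exact ⟨i, not_imp_not.1 (fun hne => (hm j (Ne.symm hne)).ne') (mem_active.1 hj)⟩

lemma contMDiffOn_chartFun_apply (i : Fin n) :
    ContMDiffOn 𝓘(ℝ, Fin n → ℂ) 𝓘(ℝ, ℂ) ∞ (fun m => chartFun hP hp m i) (chartSource hP p) :=
  contMDiffOn_pi_space.1 (contMDiffOn_chartFun hp) i

variable {m : ToricManifold P Λ hP}

lemma diff_chartFun_apply (hm : m ∈ chartSource hP p) (v : TangentSpace 𝓘(ℝ, Fin n → ℂ) m)
    (i : Fin n) :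
    diff n (fun m => chartFun hP hp m i) m v = diff n (chartFun hP hp) m v i := by
  have hchart := (contMDiffAt_chartFun hp hm).mdifferentiableAt (by simp)
  let proj : (Fin n → ℂ) →L[ℝ] ℂ := ContinuousLinearMap.proj i
  have hcomp := mfderiv_comp m proj.differentiableAt.mdifferentiableAt hchart
  rw [mfderiv_eq_fderiv, proj.fderiv] at hcomp
  exact DFunLike.congr_fun hcomp v

lemma diff_chartFun_apply_eq_zero {v : TangentSpace 𝓘(ℝ, Fin n → ℂ) m} {j : Fin n}
    (hj : chartFun hP hp m j ≠ 0) (hre : polarRe hp m v j = 0) (him : polarIm hp m v j = 0) :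
    diff n (chartFun hP hp) m v j = 0 := by
  have hmul := polarRe_add_polarIm_mul_I hp v j
  simpa [hre, him, hj] using hmul.symm

lemma vertexHess_vecMulVec {u f : (Fin n → ℝ) → ℝ} {x : Fin n → ℝ} {s : ℝ}
    (h : hess u x = s • Matrix.vecMulVec (P.normal (vertexIdx hp i)) (P.normal (vertexIdx hp i)) +
      hess f x) : vertexHess hp u x = Matrix.single i i s + vertexHess hp f x := by
  rw [vertexHess, h, Matrix.mul_add, Matrix.add_mul, vertexHess]
  congr 1
  rw [Matrix.mul_smul, Matrix.smul_mul, Matrix.mul_vecMulVec, Matrix.vecMulVec_mul,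
    Matrix.mulVec_transpose, normal_vecMul_inv, ← Matrix.single_eq_single_vecMulVec_single,
    Matrix.smul_single, smul_eq_mul, mul_one]

lemma vertexHess_isSymm {f : (Fin n → ℝ) → ℝ} {x : Fin n → ℝ} (hf : ContDiffAt ℝ 2 f x) :
    (vertexHess hp f x).IsSymm := by
  rw [Matrix.IsSymm, vertexHess, Matrix.transpose_mul, Matrix.transpose_mul,
    Matrix.transpose_transpose, (hess_isSymm hf).eq, Matrix.mul_assoc]

/-- The Hessian of `u` in the coordinates `L_k` at a vertex is `(2 a L_i)⁻¹` in the entry `(i, i)`,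
up to a matrix `K` that is smooth across the interior of the `i`-th facet at the vertex and positive
definite along it. -/
structure IsRegularPart (i : Fin n) (a : ℝ) (u : (Fin n → ℝ) → ℝ)
    (K : (Fin n → ℝ) → Matrix (Fin n) (Fin n) ℝ) : Prop where
  contDiffOn : ∀ j l, ContDiffOn ℝ ∞ (fun x => K x j l)
    (P.closedSet ∩ P.facetCollar (vertexIdx hp i))
  isSymm : ∀ x ∈ P.closedSet ∩ P.facetCollar (vertexIdx hp i), (K x).IsSymm
  vertexHess_eq : ∀ x ∈ P.openSet,
    vertexHess hp u x = Matrix.single i i (2 * a * P.L (vertexIdx hp i) x)⁻¹ + K x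
  det_ne_zero : ∀ x ∈ P.openSet, (vertexHess hp u x).det ≠ 0
  pos : ∀ x ∈ P.facetInterior (vertexIdx hp i), ∀ ξ : Fin n → ℝ, ξ ≠ 0 → ξ i = 0 →
    0 < ξ ⬝ᵥ K x *ᵥ ξ

/-- The factors that turn the forms `|z_j|² d(arg z_j)` into forms in which the regular part of the
inverse Hessian stays bounded at the `i`-th facet. -/
def angularScale (i : Fin n) (a : ℝ) (x : Fin n → ℝ) : Fin n → ℝ :=
  Function.update (fun j => (2 * P.L (vertexIdx hp j) x)⁻¹) i a

/-- The coefficients, in the forms `|z_j|² d(arg z_j)`, of the part of the metric that is smooth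
across the `i`-th facet at a vertex. -/
def angularPart (i : Fin n) (a : ℝ) (K : (Fin n → ℝ) → Matrix (Fin n) (Fin n) ℝ)
    (x : Fin n → ℝ) : Matrix (Fin n) (Fin n) ℝ :=
  Matrix.of fun j l => regularInverse i (2 * a * P.L (vertexIdx hp i) x) (K x) j l *
    angularScale hp i a x j * angularScale hp i a x l

/-- The part of the metric that is smooth across the preimage of the `i`-th facet at a vertex. -/
def smoothPart (hP : P.IsDelzant Λ) (i : Fin n) (a : ℝ)
    (K : (Fin n → ℝ) → Matrix (Fin n) (Fin n) ℝ) : Tensor2 n (ToricManifold P Λ hP) :=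
  pullbackTensor n (chartFun hP hp) fun m =>
    polarForm (K (moment m)) (angularPart hp i a K (moment m)) (chartFun hP hp m)

variable {a : ℝ} {K : (Fin n → ℝ) → Matrix (Fin n) (Fin n) ℝ} {u : (Fin n → ℝ) → ℝ}
  {x : Fin n → ℝ}

lemma smoothPart_apply (m : ToricManifold P Λ hP) (v v' : TangentSpace 𝓘(ℝ, Fin n → ℂ) m) :
    smoothPart hp hP i a K m v v' =
      polarRe hp m v ⬝ᵥ K (moment m) *ᵥ polarRe hp m v' +
        polarIm hp m v ⬝ᵥ angularPart hp i a K (moment m) *ᵥ polarIm hp m v' :=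
  polarForm_apply _ _ _ _ _

lemma smoothPart_apply_eq_zero {v : TangentSpace 𝓘(ℝ, Fin n → ℂ) m}
    (hv : ∀ j, chartFun hP hp m j = 0 ∨ diff n (chartFun hP hp) m v j = 0)
    (v' : TangentSpace 𝓘(ℝ, Fin n → ℂ) m) : smoothPart hp hP i a K m v v' = 0 := by
  have hmul : ∀ j, starRingEnd ℂ (chartFun hP hp m j) * diff n (chartFun hP hp) m v j = 0 :=
    fun j => mul_eq_zero.2 ((hv j).imp_left fun h => by rw [h, map_zero])
  have hre : polarRe hp m v = 0 := funext fun j => congrArg Complex.re (hmul j)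
  have him : polarIm hp m v = 0 := funext fun j => congrArg Complex.im (hmul j)
  rw [smoothPart_apply, hre, him, zero_dotProduct, zero_dotProduct, add_zero]

lemma angularScale_ne_zero (ha : a ≠ 0) (hx : x ∈ P.facetCollar (vertexIdx hp i)) (j : Fin n) :
    angularScale hp i a x j ≠ 0 := by
  obtain rfl | hj := eq_or_ne j i
  · rwa [angularScale, Function.update_self]
  · rw [angularScale, Function.update_of_ne hj]
    exact inv_ne_zero (mul_ne_zero two_ne_zero (facetCollar_L_pos hp hx hj).ne')

lemma contDiffOn_angularScale (j : Fin n) :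
    ContDiffOn ℝ ∞ (fun x => angularScale hp i a x j) (P.facetCollar (vertexIdx hp i)) := by
  obtain rfl | hj := eq_or_ne j i
  · simp only [angularScale, Function.update_self]
    exact contDiffOn_const
  · simp only [angularScale, Function.update_of_ne hj]
    exact (contDiffOn_const.mul (contDiff_L _).contDiffOn).inv fun x hx =>
      mul_ne_zero two_ne_zero (facetCollar_L_pos hp hx hj).ne'

namespace IsRegularPart

variable {hp}

lemma det_regularized_ne_zero (h : IsRegularPart hp i a u K) (ha : a ≠ 0)
    (hx : x ∈ P.closedSet ∩ P.facetCollar (vertexIdx hp i)) :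
    (regularized i (2 * a * P.L (vertexIdx hp i) x) (K x)).det ≠ 0 := by
  rw [← openSet_union_facetInterior] at hx
  obtain hx | hx := hx
  · refine Toric.det_regularized_ne_zero (mul_ne_zero (by positivity) (hx _).ne') ?_
    rw [← h.vertexHess_eq x hx]
    exact h.det_ne_zero x hx
  · rw [hx.1, mul_zero]
    exact det_regularized_zero_ne_zero (h.pos x hx)

lemma angularPart_isSymm (h : IsRegularPart hp i a u K) (ha : a ≠ 0)
    (hx : x ∈ P.closedSet ∩ P.facetCollar (vertexIdx hp i)) :
    (angularPart hp i a K x).IsSymm := by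
  have hreg := regularInverse_isSymm (h.isSymm x hx) (h.det_regularized_ne_zero ha hx)
  refine Matrix.IsSymm.ext fun j l => ?_
  rw [angularPart, Matrix.of_apply, Matrix.of_apply, hreg.apply]
  ring

lemma smoothOn_smoothPart (h : IsRegularPart hp i a u K) (ha : a ≠ 0) :
    SmoothOn (smoothPart hp hP i a K) (freeLocus hP ∪ divisor hP (vertexIdx hp i)) := by
  have hmaps : Set.MapsTo moment (freeLocus hP ∪ divisor hP (vertexIdx hp i))
      (P.closedSet ∩ P.facetCollar (vertexIdx hp i)) := fun m hm =>
    ⟨moment_mem m, by rwa [freeLocus_union_divisor] at hm⟩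
  have hscale : ∀ j, ContDiffOn ℝ ∞ (fun x => angularScale hp i a x j)
      (P.closedSet ∩ P.facetCollar (vertexIdx hp i)) := fun j =>
    (contDiffOn_angularScale hp j).mono Set.inter_subset_right
  have hreg := contDiffOn_regularInverse (contDiffOn_const.mul (contDiff_L _).contDiffOn)
    h.contDiffOn fun x hx => h.det_regularized_ne_zero ha hx
  exact smoothOn_of_polar hp (isOpen_freeLocus_union_divisor _)
    (freeLocus_union_divisor_subset_chartSource hp i) hmaps h.contDiffOn
    (fun j l => ((hreg j l).mul (hscale j)).mul (hscale l)) fun m _ => smoothPart_apply hp m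

lemma smoothPart_symm (h : IsRegularPart hp i a u K) (ha : a ≠ 0)
    (hm : m ∈ freeLocus hP ∪ divisor hP (vertexIdx hp i))
    (v v' : TangentSpace 𝓘(ℝ, Fin n → ℂ) m) :
    smoothPart hp hP i a K m v v' = smoothPart hp hP i a K m v' v := by
  rw [freeLocus_union_divisor] at hm
  have hx := And.intro (moment_mem m) hm
  rw [smoothPart_apply, smoothPart_apply, dotProduct_mulVec_comm (h.isSymm _ hx),
    dotProduct_mulVec_comm (h.angularPart_isSymm ha hx)]

lemma inv_vertexHess_scaled (h : IsRegularPart hp i a u K) (ha : a ≠ 0) (hx : x ∈ P.openSet) :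
    (Matrix.of fun j l => (vertexHess hp u x)⁻¹ j l * (2 * P.L (vertexIdx hp j) x)⁻¹ *
      (2 * P.L (vertexIdx hp l) x)⁻¹) =
      Matrix.single i i (a * (2 * P.L (vertexIdx hp i) x)⁻¹) + angularPart hp i a K x := by
  set t := 2 * a * P.L (vertexIdx hp i) x with ht
  have hL := (hx (vertexIdx hp i)).ne'
  have ht0 : t ≠ 0 := mul_ne_zero (by positivity) hL
  have hscale : ∀ j, (2 * P.L (vertexIdx hp j) x)⁻¹ * (Function.update 1 i t : Fin n → ℝ) j =
      angularScale hp i a x j := by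
    intro j
    obtain rfl | hj := eq_or_ne j i
    · rw [angularScale, Function.update_self, Function.update_self, ht]
      field_simp
    · rw [angularScale, Function.update_of_ne hj, Function.update_of_ne hj, Pi.one_apply, mul_one]
  have hdet := h.det_ne_zero x hx
  rw [h.vertexHess_eq x hx] at hdet ⊢
  ext j l
  rw [inv_single_add_eq ht0 hdet]
  simp only [Matrix.of_apply, Matrix.add_apply, angularPart, ← hscale]
  obtain ⟨rfl, rfl⟩ | hjl := em (i = j ∧ i = l)
  · simp only [Matrix.single_apply_same, ht]
    field_simp
  · simp only [Matrix.single_apply, hjl, if_false]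
    ring

lemma metric_eq (h : IsRegularPart hp i a u K) (ha : a ≠ 0) (hm : m ∈ freeLocus hP)
    (v v' : TangentSpace 𝓘(ℝ, Fin n → ℂ) m) :
    metric hP u m v v' = a⁻¹ * flatCone a (chartFun hP hp m i) (diff n (chartFun hP hp) m v i)
      (diff n (chartFun hP hp) m v' i) + smoothPart hp hP i a K m v v' := by
  rw [freeLocus_eq] at hm
  have hnorm : ‖chartFun hP hp m i‖ ^ 2 = 2 * P.L (vertexIdx hp i) (moment m) := by
    rw [L_moment_eq hp (mem_chartSource_of_moment_mem_openSet hm)]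
    ring
  have hsingle : ∀ (r : ℝ) (b c : Fin n → ℝ), b ⬝ᵥ Matrix.single i i r *ᵥ c = r * (b i * c i) := by
    intro r b c
    rw [Matrix.single_mulVec, ← Pi.single, dotProduct_single]
    ring
  have hcone : (2 * a * P.L (vertexIdx hp i) (moment m))⁻¹ *
        (polarRe hp m v i * polarRe hp m v' i) +
      a * (2 * P.L (vertexIdx hp i) (moment m))⁻¹ * (polarIm hp m v i * polarIm hp m v' i) =
      a⁻¹ * flatCone a (chartFun hP hp m i) (diff n (chartFun hP hp) m v i)
        (diff n (chartFun hP hp) m v' i) := by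
    have hL := (hm (vertexIdx hp i)).ne'
    change _ = a⁻¹ * ((polarRe hp m v i * polarRe hp m v' i +
      a ^ 2 * (polarIm hp m v i * polarIm hp m v' i)) / ‖chartFun hP hp m i‖ ^ 2)
    rw [hnorm]
    field_simp
  rw [metric_eq_polar hp u hm, h.inv_vertexHess_scaled ha hm, h.vertexHess_eq _ hm, ← hcone,
    smoothPart_apply, Matrix.add_mulVec, Matrix.add_mulVec, dotProduct_add, dotProduct_add,
    hsingle, hsingle]
  ring

lemma angularPart_pos (h : IsRegularPart hp i a u K) (ha : a ≠ 0)
    (hx : x ∈ P.facetInterior (vertexIdx hp i)) {ψ : Fin n → ℝ} (hψ : ψ ≠ 0) (hψi : ψ i = 0) :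
    0 < ψ ⬝ᵥ angularPart hp i a K x *ᵥ ψ := by
  rw [angularPart, ← mul_dotProduct_mulVec_mul, hx.1, mul_zero]
  refine regularInverse_zero_pos (h.pos x hx) (fun hzero => hψ (funext fun j => ?_)) ?_
  · exact (mul_eq_zero.1 (congrFun hzero j)).resolve_right
      (angularScale_ne_zero hp ha (facetInterior_subset_facetCollar _ hx) j)
  · rw [hψi, zero_mul]

lemma smoothPart_pos (h : IsRegularPart hp i a u K) (ha : a ≠ 0)
    (hm : m ∈ divisor hP (vertexIdx hp i)) {v : TangentSpace 𝓘(ℝ, Fin n → ℂ) m}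
    (hvi : diff n (chartFun hP hp) m v i = 0) (hv : v ≠ 0) :
    0 < smoothPart hp hP i a K m v v := by
  have hms := freeLocus_union_divisor_subset_chartSource hp i (Or.inr hm)
  have hrei : polarRe hp m v i = 0 := by simp [polarRe, radialForm, hvi]
  have himi : polarIm hp m v i = 0 := by simp [polarIm, angularForm, hvi]
  have hne : polarRe hp m v ≠ 0 ∨ polarIm hp m v ≠ 0 := by
    by_contra! hzero
    refine hv ((diff_chartFun_bijective hp hms).injective (.trans (funext fun j => ?_)
      (map_zero _).symm))
    obtain rfl | hj := eq_or_ne j i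
    · exact hvi
    · have hzj := chartFun_ne_zero hp hms (facetCollar_L_pos hp hm.2 hj).ne'
      exact diff_chartFun_apply_eq_zero hp hzj (congrFun hzero.1 j) (congrFun hzero.2 j)
  have hre := h.pos _ hm (polarRe hp m v)
  have him := h.angularPart_pos ha hm (ψ := polarIm hp m v)
  rw [smoothPart_apply]
  by_cases hre0 : polarRe hp m v = 0
  · rw [hre0, zero_dotProduct, zero_add]
    exact him (hne.resolve_left (not_not.2 hre0)) himi
  · by_cases him0 : polarIm hp m v = 0
    · rw [him0, zero_dotProduct, add_zero]
      exact hre hre0 hrei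
    · exact add_pos (hre hre0 hrei) (him him0 himi)

lemma exists_smoothPart_radical (hm : m ∈ divisor hP (vertexIdx hp i))
    (v : TangentSpace 𝓘(ℝ, Fin n → ℂ) m) :
    ∃ y, diff n (chartFun hP hp) m y i = 0 ∧ ∀ v', smoothPart hp hP i a K m (v - y) v' = 0 := by
  have hms := freeLocus_union_divisor_subset_chartSource hp i (Or.inr hm)
  obtain ⟨y, hy⟩ := (diff_chartFun_bijective hp hms).surjective
    (Function.update (diff n (chartFun hP hp) m v) i 0)
  refine ⟨y, by rw [hy, Function.update_self], smoothPart_apply_eq_zero hp fun j => ?_⟩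
  obtain rfl | hj := eq_or_ne j i
  · left
    simpa [L_moment_eq hp hms] using hm.1
  · right
    rw [map_sub, hy, Pi.sub_apply, Function.update_of_ne hj, sub_self]

lemma isConeForm (h : IsRegularPart hp i a u K) (ha : a ≠ 0) :
    IsConeForm (fun m => chartFun hP hp m i) (freeLocus hP) (divisor hP (vertexIdx hp i)) a
      (metric hP u) (smoothPart hp hP i a K) := by
  have hsource := freeLocus_union_divisor_subset_chartSource (hP := hP) hp i
  have hdiff : ∀ m ∈ freeLocus hP ∪ divisor hP (vertexIdx hp i), ∀ v,
      diff n (fun m => chartFun hP hp m i) m v = diff n (chartFun hP hp) m v i := fun m hm v =>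
    diff_chartFun_apply hp (hsource hm) v i
  refine ⟨isOpen_freeLocus_union_divisor _, (contMDiffOn_chartFun_apply hp i).mono hsource,
    fun m hm c => ?_, fun m hm => ?_, fun m hm => ?_, h.smoothOn_smoothPart ha,
    fun m hm => h.smoothPart_symm ha hm, fun m hm v v' => ?_, fun m hm v hv => ?_,
    fun m hm v => ?_⟩
  · obtain ⟨v, hv⟩ := (diff_chartFun_bijective hp (hsource hm)).surjective (Pi.single i c)
    exact ⟨v, by rw [hdiff m hm, hv, Pi.single_eq_same]⟩
  · have hL := freeLocus_eq.subset hm (vertexIdx hp i)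
    exact chartFun_ne_zero hp (hsource (Or.inl hm)) hL.ne'
  · simpa [L_moment_eq hp (hsource (Or.inr hm))] using hm.1
  · rw [hdiff m (Or.inl hm), hdiff m (Or.inl hm)]
    exact h.metric_eq ha hm v v'
  · exact h.smoothPart_pos ha hm (hdiff m (Or.inr hm) v ▸ hv)
  · simp only [hdiff m (Or.inr hm)]
    exact exists_smoothPart_radical hm v

end IsRegularPart

lemma LabelledPolytope.SamePolytope.hess_eq_of_smul_normal_eq {Q : LabelledPolytope n d}
    (hPQ : P.SamePolytope Q) {k : Fin d} {f : (Fin n → ℝ) → ℝ}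
    (huf : ∀ y ∈ Q.closedSet, u y = 1 / 2 * (Q.L k y * Real.log (Q.L k y)) + f y)
    (hak : a • Q.normal k = P.normal k) (hx : x ∈ P.openSet) (hf : ContDiffAt ℝ 2 f x) :
    hess u x = (2 * a * P.L k x)⁻¹ • Matrix.vecMulVec (P.normal k) (P.normal k) + hess f x := by
  have hxQ : x ∈ Q.openSet := hPQ.openSet_eq ▸ hx
  have ha := (hPQ.pos_of_smul_normal_eq hak).ne'
  have hev : u =ᶠ[𝓝 x] fun y => 1 / 2 * (Q.L k y * Real.log (Q.L k y)) + f y := by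
    filter_upwards [isOpen_openSet.mem_nhds hxQ] with y hy using huf y (closedSet_of_openSet hy)
  rw [hess_congr hev, hess_add ((contDiffAt_mul_log (hxQ k)).of_le (by norm_cast)) hf,
    hess_mul_log (hxQ k), hPQ.L_eq_mul_of_smul_normal_eq hak, ← hak, Matrix.smul_vecMulVec,
    Matrix.vecMulVec_smul, smul_smul, smul_smul]
  congr 2
  field_simp

namespace LabelledPolytope.IsSymplecticPotential

variable {Q : LabelledPolytope n d} (hu : Q.IsSymplecticPotential u) (hPQ : P.SamePolytope Q)
include hu hPQ

lemma exists_isRegularPart (hp : P.IsVertex p)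
    (hak : a • Q.normal (vertexIdx hp i) = P.normal (vertexIdx hp i)) :
    ∃ K, IsRegularPart hp i a u K := by
  obtain ⟨W, f, hW, hmem, hf, huf⟩ := hu.exists_regular_part (vertexIdx hp i)
  rw [hPQ.closedSet_eq, hPQ.facetCollar_eq] at hmem
  have hf2 : ∀ x ∈ P.closedSet ∩ P.facetCollar (vertexIdx hp i), ContDiffAt ℝ 2 f x := fun x hx =>
    (hf.contDiffAt (hW.mem_nhds (hmem hx))).of_le (by norm_cast)
  have hunion := openSet_union_facetInterior (P := P) (vertexIdx hp i)
  refine ⟨vertexHess hp f, fun j l => (contDiffOn_vertexHess hp hW hf j l).mono hmem,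
    fun x hx => vertexHess_isSymm hp (hf2 x hx), fun x hx => ?_, fun x hx => ?_,
    fun x hx ξ hξ hξi => ?_⟩
  · exact vertexHess_vecMulVec hp
      (hPQ.hess_eq_of_smul_normal_eq huf hak hx (hf2 x (hunion ▸ Or.inl hx)))
  · exact (vertexHess_posDef hp (hu.hess_posDef (hPQ.openSet_eq ▸ hx))).det_pos.ne'
  · have hxQ : x ∈ Q.facetInterior (vertexIdx hp i) :=
      ⟨hPQ.L_eq_zero hx,
        (hPQ.facetCollar_eq _).symm.subset (facetInterior_subset_facetCollar _ hx)⟩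
    rw [dotProduct_vertexHess_mulVec]
    refine hu.dotProduct_hess_regular_part_pos hxQ (hf2 x (hunion ▸ Or.inr hx)) huf ?_
      (hPQ.dotProduct_normal_eq_zero ?_)
    · intro hzero
      refine hξ ?_
      rw [← Matrix.one_mulVec ξ, ← vertexMat_mul_inv hp, ← Matrix.mulVec_mulVec, hzero,
        Matrix.mulVec_zero]
    · rw [dotProduct_comm, Matrix.dotProduct_mulVec, normal_vecMul_inv, single_dotProduct, hξi,
        mul_zero]

lemma exists_isConeForm (hp : P.IsVertex p)
    (hak : a • Q.normal (vertexIdx hp i) = P.normal (vertexIdx hp i)) :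
    ∃ B, IsConeForm (fun m => chartFun hP hp m i) (freeLocus hP) (divisor hP (vertexIdx hp i)) a
      (metric hP u) B := by
  obtain ⟨K, hK⟩ := hu.exists_isRegularPart hPQ hp hak
  exact ⟨_, hK.isConeForm (hPQ.pos_of_smul_normal_eq hak).ne'⟩

end LabelledPolytope.IsSymplecticPotential

end Facet

end Toric

end

theorem mainTheorem10 {n d : ℕ} (P : Toric.LabelledPolytope n d) (Λ : Submodule ℤ (Fin n → ℝ))
    (hP : P.IsDelzant Λ) (Q : Toric.LabelledPolytope n d) (hPQ : P.SamePolytope Q)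
    (u : (Fin n → ℝ) → ℝ) (hu : Q.IsSymplecticPotential u) :
    -- the locus where the torus acts freely is open and dense, and lies over the open polytope
    (IsOpen (Toric.freeLocus hP) ∧ Dense (Toric.freeLocus hP) ∧
      Toric.freeLocus hP = {m | m.moment ∈ P.openSet}) ∧
    -- in action-angle coordinates the symplectic form is `dx ∧ dθ`, and `g_u` is `G dx² + H dθ²`
    (∀ x ∈ P.openSet, ∀ (θ : Fin n → ℝ) (a b : (Fin n → ℝ) × (Fin n → ℝ)),
      Toric.symplecticForm hP (.pt hP (x, θ))
          (Toric.dpt hP x θ a) (Toric.dpt hP x θ b) =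
        a.1 ⬝ᵥ b.2 - a.2 ⬝ᵥ b.1 ∧
      Toric.metric hP u (.pt hP (x, θ))
          (Toric.dpt hP x θ a) (Toric.dpt hP x θ b) =
        a.1 ⬝ᵥ Toric.hess u x *ᵥ b.1 + a.2 ⬝ᵥ (Toric.hess u x)⁻¹ *ᵥ b.2) ∧
    -- `g_u` is a `T`-invariant Kähler metric on the free locus, compatible with the symplectic form
    Toric.IsInvariantOn hP (Toric.metric hP u) (Toric.freeLocus hP) ∧
    Toric.IsKahlerOn (Toric.metric hP u) (Toric.symplecticForm hP) (Toric.freeLocus hP) ∧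
    -- the behaviour of `g_u` along the preimage of the interior of each facet
    ∀ k : Fin d, ∃ a : ℝ, 0 < a ∧ (∀ b : ℝ, b • Q.normal k = P.normal k ↔ b = a) ∧
      (a < 1 → Toric.IsConicalAlong (Toric.metric hP u) (Toric.freeLocus hP) (Toric.divisor hP k)
        (2 * Real.pi * a)) ∧
      (a = 1 → Toric.IsSmoothAlong (Toric.metric hP u) (Toric.freeLocus hP) (Toric.divisor hP k)) ∧
      (1 < a → Toric.IsLargeAngleAlong (Toric.metric hP u) (Toric.freeLocus hP) (Toric.divisor hP k)
        (2 * Real.pi * a)) ∧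
      -- for `a ≠ 1` the metric is singular at each point
      (a ≠ 1 → ∀ q ∈ Toric.divisor hP k, ¬ ∃ (U : Set (P.ToricManifold Λ hP))
        (B : Toric.Tensor2 n (P.ToricManifold Λ hP)), IsOpen U ∧ q ∈ U ∧ Toric.SmoothOn B U ∧
        ∀ m ∈ U ∩ Toric.freeLocus hP, B m = Toric.metric hP u m) ∧
      -- up to tensors that are smooth across the preimage, the metric depends only on `a`
      (∀ Q' : Toric.LabelledPolytope n d, P.SamePolytope Q' → a • Q'.normal k = P.normal k →
        ∀ u' : (Fin n → ℝ) → ℝ, Q'.IsSymplecticPotential u' →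
          ∃ B : Toric.Tensor2 n (P.ToricManifold Λ hP),
            Toric.SmoothOn B (Toric.freeLocus hP ∪ Toric.divisor hP k) ∧
            ∀ m ∈ Toric.freeLocus hP, B m = Toric.metric hP u m - Toric.metric hP u' m) := by
  refine ⟨⟨Toric.isOpen_freeLocus, Toric.dense_freeLocus, Toric.freeLocus_eq⟩,
    fun x hx θ a b => ⟨Toric.symplecticForm_dpt hx θ a b, Toric.metric_dpt u hx θ a b⟩,
    Toric.isInvariantOn_metric u, ?_⟩
  have hK : Toric.IsKahlerOn (Toric.metric hP u) (Toric.symplecticForm hP) (Toric.freeLocus hP) :=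
    Toric.isKahlerOn_metric (hPQ.openSet_eq ▸ hu.contDiffOn)
      fun x hx => hu.hess_posDef (by rwa [hPQ.openSet_eq])
  refine ⟨hK, fun k => ?_⟩
  obtain ⟨a, ha, hiff⟩ := hPQ.exists_pos_smul_normal_eq_iff k
  obtain ⟨p, hp, i, rfl⟩ := Toric.exists_vertexIdx_eq P k
  obtain ⟨B, hB⟩ := hu.exists_isConeForm (hP := hP) hPQ hp ((hiff a).2 rfl)
  have hpi := Real.pi_pos
  refine ⟨a, ha, hiff, fun h1 => ⟨by positivity, by nlinarith, hB.hasAngleAlong ha⟩, ?_,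
    fun h1 => ⟨by nlinarith, hB.hasAngleAlong ha⟩, fun h1 q hq => hB.not_extends ha h1 hq,
    fun Q' hPQ' hak u' hu' => ?_⟩
  · rintro rfl
    exact hB.isSmoothAlong hK.metric
  · obtain ⟨B', hB'⟩ := hu'.exists_isConeForm (hP := hP) hPQ' hp hak
    exact hB.exists_sub hB'
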